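/- Let $T=\mathbb R^n/\mathbb Z^n$ and let $(M,\omega,T,\mu)$ be a compact connected toric origami manifold of dimension $2n$ (without boundary) with fold $Z$, i.e. $\omega$ is a closed 2-form whose top power vanishes transversally on $Z$, the restriction of $\omega$ to $Z$ has maximal rank, $T$ acts effectively with moment map $\mu:M\to\mathfrak t^*$, $d\langle\mu,v\rangle=\iota(v^M)\omega$, and over each component of $Z$ the null foliation $\ker(\omega|_Z)$ is given by the orbits of a circle subgroup of $T$, generated by a $v_Z\in\mathbb Z^n$, that acts freely there. Let $(L,\nabla)$ be a $T$-equivariant pre-quantizing line bundle (a $T$-invariant Hermitian connection of curvature $-2\pi\sqrt{-1}\,\omega$, with $\nabla_{v^M}=\mathcal L_v+2\pi\sqrt{-1}\langle\mu,v\rangle$), let $g$ be a $T$-invariant Riemannian metric, and let $W$ be a $T$-equivariant $\mathbb Z/2$-graded Hermitian $Cl(TM)$-module bundle (for instance the one given by an invariant stable almost complex structure); put $W_L=W\otimes L$. For a subtorus $G\subset T$ with Lie algebra $\mathfrak h$ let $D_G=\sum_{a,b}g^{ab}c(v_a)\nabla_{v_b}$ be the Dirac operator along those $G$-orbits that have dimension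 $\dim G$. Here $(v_a)$ are the fundamental vector fields of a basis of $\mathfrak h$, $(g^{ab})$ is the inverse of their Gram matrix, and $\nabla$ is the tensor product of the flat connection of $W$ along the orbits given by the $T$-action with the connection of $L$. Fix a $T$-equivariant diffeomorphism $Z\times(-\varepsilon_0,\varepsilon_0)\to\mathcal U_0$ onto a neighbourhood of $Z$, equal to the inclusion on $Z\times\{0\}$, that pulls $\omega$ back to $p_Z^*(\omega|_Z)+d(t^2p_Z^*\alpha)$ for a $T$-invariant connection form $\alpha$ of the null fibration, and for small $\varepsilon$ let $\mathcal U$, $\mathcal U'$ be the images of $Z\times(-\varepsilon,\varepsilon)$, $Z\times(-\frac\varepsilon2,\frac\varepsilon2)$. For each component $M_i$ of $M\setminus Z$ let $\Delta_i=\mu(\overline{M_i})$. For each face $F$ of $\Delta_i$ let $T_F$ be the subtorus, of dimension $n-\dim F$, that is the stabilizer of all points of $M_i$ over the relative interior of $F$, and let $G_F$ be the orthogonal complement subtorus for a fixed rational metric on $\mathfrak t$; in particular $G_{\Delta_i}=T$. Put $\Delta_i'=\Delta_i\setminus\mu(\overline{\mathcal U}\cap \overline{M_i})$, $\tilde\Delta_{\Delta_i}=\mathrm{int}\,\Delta_i$,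 and, for the faces $F\ne\Delta_i$ in order of dimension, choose small open neighbourhoods $\tilde\Delta_F$ of $(\Delta_i'\setminus\bigcup_{\dim F'<\dim F}\tilde\Delta_{F'})\cap F$ in $\Delta_i'$, pairwise disjoint for faces of the same dimension; small means that the $G_F$-orbits over $\tilde\Delta_F$ have dimension $\dim G_F$ and that the groups of overlapping neighbourhoods are nested. Put $M_F=M_i\cap\mu^{-1}(\tilde\Delta_F)$, let $M_F^\circ\subset M_F$ be the set of the points where the restriction of $\mu$ to $\mathrm{Lie}(G_F)$ is not in the weight lattice of $G_F$, let $C_F=M_i\cap\mu^{-1}(\mu((\overline{\mathcal U}\setminus\mathcal U')\cap M_i)\cap F)$ for the facets $F$ (the cracks), and let $$V=\Bigl(\mathcal U'\cup\bigcup_{F}M_F^\circ\Bigr)\setminus\Bigl(Z\cup\bigcup_{F\text{ facet}}C_F\Bigr),$$ where the unions are over all $i$ and all faces (facets) $F$ of $\Delta_i$. On $\mathcal U'\cap V$ (for each component of $Z$) take the circle $S^1=\langle v_Z\rangle$ and $D_Z=D_{S^1}$, and on $M_F^\circ\cap V$ take $G_F$ and $D_F=D_{G_F}$. Then there is $\varepsilon_1>0$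 such that for all $0<\varepsilon<\varepsilon_1$ and all such choices of neighbourhoods the family $\{D_Z,D_F\}$ is an acyclic compatible system over $V$. Namely: 1. The sets cover $V$ and are $T$-invariant, the groups act on them with orbits of maximal dimension, and the groups of any two overlapping sets are nested. 2. The operators are first order, odd and formally self-adjoint, with the Clifford multiplication along the leaves as principal symbol; they restrict to the leaves and anti-commute with the Clifford multiplication by invariant normal vector fields along the leaves. 3. For each of the sets and each of its points $x$, the pull-back of the operator to the group $G$ under the finite covering $G\to G\cdot x$ has zero kernel on the smooth sections. 4. For any two of the operators, $D$ on the set $B$ and $D'$ on the set $B'$, the anti-commutator $DD'+D'D$ is non-negative on the smooth sections of $W_L$ with compact support in $B\cap B'$. -/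

import Mathlib

open Bundle Set MeasureTheory
open scoped Manifold ContDiff Topology TensorProduct

noncomputable section

namespace Origami

/-! ### Tori and torus actions

The `n`-dimensional torus is `T = ℝⁿ / ℤⁿ`.  Its Lie algebra and the dual of its Lie algebra are both
`Fin n → ℝ` (with the pairing `⬝ᵥ`), and the integral lattice and the weight lattice are both `ℤⁿ`. -/

/-- The lattice `ℤⁿ` in `ℝⁿ`. -/
def lattice (n : ℕ) : Set (Fin n → ℝ) := {v | ∀ i, ∃ k : ℤ, v i = k}

/-- The subspace `𝔥` of the Lie algebra is the Lie algebra of a subtorus. -/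
def IsRational {n : ℕ} (𝔥 : Submodule ℝ (Fin n → ℝ)) : Prop :=
  Submodule.span ℝ ((𝔥 : Set (Fin n → ℝ)) ∩ lattice n) = 𝔥

/-- `ξ` restricted to `𝔥` lies in the weight lattice of the subtorus with Lie algebra `𝔥`. -/
def IsWeightOn {n : ℕ} (𝔥 : Submodule ℝ (Fin n → ℝ)) (ξ : Fin n → ℝ) : Prop :=
  ∀ v ∈ 𝔥, v ∈ lattice n → ∃ k : ℤ, ξ ⬝ᵥ v = k

/-- The `2n`-dimensional model space. -/
abbrev Model (n : ℕ) : Type := EuclideanSpace ℝ (Fin (2 * n))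

/-- The `j`-th vector of the standard basis of the model space. -/
abbrev stdVec (n : ℕ) (j : Fin (2 * n)) : Model n := EuclideanSpace.single j 1

section Manifold

variable {n : ℕ} {M : Type*} [TopologicalSpace M] [ChartedSpace (Model n) M]

/-- An effective smooth action of the torus `ℝⁿ / ℤⁿ` on `M`, written as an action of `ℝⁿ`. -/
structure TorusAction (n : ℕ) (M : Type*) [TopologicalSpace M] [ChartedSpace (Model n) M] where
  act : (Fin n → ℝ) → M → M
  act_add : ∀ v w x, act (v + w) x = act v (act w x)
  act_lattice : ∀ v ∈ lattice n, ∀ x, act v x = x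
  smooth : ContMDiff (𝓘(ℝ, Fin n → ℝ).prod (𝓡 (2 * n))) (𝓡 (2 * n)) ∞
    (fun q : (Fin n → ℝ) × M => act q.1 q.2)
  effective : ∀ v, (∀ x, act v x = x) → v ∈ lattice n

/-- The fundamental vector field of `v` at `x`. -/
def TorusAction.field (A : TorusAction n M) (v : Fin n → ℝ) (x : M) : TangentSpace (𝓡 (2 * n)) x :=
  (mfderiv 𝓘(ℝ, ℝ) (𝓡 (2 * n)) (fun s : ℝ => A.act (s • v) x) 0 (1 : ℝ) : Model n)

/-- The differential of the action of `v` at `x`. -/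
def TorusAction.push (A : TorusAction n M) (v : Fin n → ℝ) (x : M) :
    TangentSpace (𝓡 (2 * n)) x →L[ℝ] TangentSpace (𝓡 (2 * n)) (A.act v x) :=
  mfderiv (𝓡 (2 * n)) (𝓡 (2 * n)) (A.act v) x

/-! ### Differential forms -/

/-- Covariant 2-tensor fields. -/
abbrev TwoTensor (n : ℕ) (M : Type*) [TopologicalSpace M] [ChartedSpace (Model n) M] :=
  ∀ x : M, TangentSpace (𝓡 (2 * n)) x →L[ℝ] TangentSpace (𝓡 (2 * n)) x →L[ℝ] ℝ

/-- Covector fields. -/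
abbrev OneForm (n : ℕ) (M : Type*) [TopologicalSpace M] [ChartedSpace (Model n) M] :=
  ∀ x : M, TangentSpace (𝓡 (2 * n)) x →L[ℝ] ℝ

/-- The differential of a real function. -/
def differential (n : ℕ) {M : Type*} [TopologicalSpace M] [ChartedSpace (Model n) M] (f : M → ℝ)
    (x : M) : TangentSpace (𝓡 (2 * n)) x →L[ℝ] ℝ :=
  mfderiv (𝓡 (2 * n)) 𝓘(ℝ, ℝ) f x

/-- The coordinate vector field of `u` in the chart at `x₀`, at the point with coordinates `y`. -/
def chartVec (x₀ : M) (y : Model n) (u : Model n) :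
    TangentSpace (𝓡 (2 * n)) ((extChartAt (𝓡 (2 * n)) x₀).symm y) :=
  mfderiv 𝓘(ℝ, Model n) (𝓡 (2 * n)) (extChartAt (𝓡 (2 * n)) x₀).symm y u

/-- The coordinates of a tangent vector at `x` in the chart at `x`. -/
def chartCoord (x : M) (u : TangentSpace (𝓡 (2 * n)) x) : Model n :=
  mfderiv (𝓡 (2 * n)) 𝓘(ℝ, Model n) (extChartAt (𝓡 (2 * n)) x) x u

/-- The coefficient `Ω(∂_u, ∂_w)` in the chart at `x₀`. -/
def chartCoeff (Ω : TwoTensor n M) (x₀ : M) (u w : Model n) (y : Model n) : ℝ :=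
  Ω ((extChartAt (𝓡 (2 * n)) x₀).symm y) (chartVec x₀ y u) (chartVec x₀ y w)

/-- The exterior derivative of a 1-form, computed at `x` in the chart at `x`. -/
def extDerivOne (β : OneForm n M) (x : M) (u w : TangentSpace (𝓡 (2 * n)) x) : ℝ :=
  let y₀ := extChartAt (𝓡 (2 * n)) x x
  fderiv ℝ (fun y => β ((extChartAt (𝓡 (2 * n)) x).symm y) (chartVec x y (chartCoord x w))) y₀
      (chartCoord x u) -
    fderiv ℝ (fun y => β ((extChartAt (𝓡 (2 * n)) x).symm y) (chartVec x y (chartCoord x u))) y₀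
      (chartCoord x w)

/-- A closed 2-form (the condition is the vanishing of `dΩ` in coordinates at every point). -/
def IsClosedForm (Ω : TwoTensor n M) : Prop :=
  ∀ (x : M) (u v w : Model n),
    fderiv ℝ (chartCoeff Ω x v w) (extChartAt (𝓡 (2 * n)) x x) u +
      fderiv ℝ (chartCoeff Ω x w u) (extChartAt (𝓡 (2 * n)) x x) v +
      fderiv ℝ (chartCoeff Ω x u v) (extChartAt (𝓡 (2 * n)) x x) w = 0

/-- The coefficient of the top power `Ωⁿ` (up to the factor `2ⁿ`) in the chart at `x₀`, as a function
on `M` near `x₀`. -/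
def topPower (Ω : TwoTensor n M) (x₀ : M) (x : M) : ℝ :=
  ∑ σ : Equiv.Perm (Fin (2 * n)), ((Equiv.Perm.sign σ : ℤ) : ℝ) *
    ∏ i : Fin n, chartCoeff Ω x₀ (stdVec n (σ ⟨2 * i, by omega⟩))
      (stdVec n (σ ⟨2 * i + 1, by omega⟩)) (extChartAt (𝓡 (2 * n)) x₀ x)

/-- The fold: the zero set of `Ωⁿ`. -/
def fold (Ω : TwoTensor n M) : Set M := {x | topPower Ω x x = 0}

/-- The tangent space of the fold at a point of the fold. -/
def foldTangent (Ω : TwoTensor n M) (x : M) : Submodule ℝ (TangentSpace (𝓡 (2 * n)) x) :=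
  LinearMap.ker (differential n (topPower Ω x) x).toLinearMap

/-- The kernel of the restriction of `Ω` to the fold, i.e. the null direction. -/
def nullSpace (Ω : TwoTensor n M) (x : M) : Set (TangentSpace (𝓡 (2 * n)) x) :=
  {u | u ∈ foldTangent Ω x ∧ ∀ w ∈ foldTangent Ω x, Ω x u w = 0}

/-! ### Toric origami manifolds -/

/-- A toric origami manifold of dimension `2n` whose null foliation is given by a circle subgroup of
the torus over each component of the fold. -/
structure ToricOrigami (n : ℕ) (M : Type*) [TopologicalSpace M] [ChartedSpace (Model n) M]
    [IsManifold (𝓡 (2 * n)) ∞ M] extends TorusAction n M where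
  /-- the folded symplectic form -/
  Ω : TwoTensor n M
  alternating : ∀ x u, Ω x u u = 0
  smooth_form : ContMDiff (𝓡 (2 * n))
    ((𝓡 (2 * n)).prod 𝓘(ℝ, Model n →L[ℝ] Model n →L[ℝ] ℝ)) ∞
    (fun x ↦ TotalSpace.mk' (Model n →L[ℝ] Model n →L[ℝ] ℝ) x (Ω x))
  closed : IsClosedForm Ω
  /-- `Ωⁿ` vanishes transversally -/
  transversal : ∀ x ∈ fold Ω, differential n (topPower Ω x) x ≠ 0
  /-- the moment map -/
  μ : M → Fin n → ℝ
  smooth_moment : ContMDiff (𝓡 (2 * n)) 𝓘(ℝ, Fin n → ℝ) ∞ μ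
  moment_invariant : ∀ v x, μ (act v x) = μ x
  moment_eq : ∀ v x (u : TangentSpace (𝓡 (2 * n)) x),
    differential n (fun y => μ y ⬝ᵥ v) x u = Ω x (toTorusAction.field v x) u
  /-- generator of the circle subgroup that gives the null fibration (used on the fold only) -/
  nullVec : M → Fin n → ℤ
  nullVec_locallyConstant : ContinuousOn nullVec (fold Ω)
  /-- the restriction of `Ω` to the fold has maximal rank, its kernel is spanned by the circle -/
  null_eq : ∀ x ∈ fold Ω, nullSpace Ω x =
    (Submodule.span ℝ {toTorusAction.field (fun i => (nullVec x i : ℝ)) x} :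
      Submodule ℝ (TangentSpace (𝓡 (2 * n)) x))
  /-- the circle acts freely on the fold -/
  null_free : ∀ x ∈ fold Ω, ∀ s : ℝ,
    act (s • fun i => (nullVec x i : ℝ)) x = x → ∃ k : ℤ, s = k

variable [IsManifold (𝓡 (2 * n)) ∞ M]

namespace ToricOrigami

/-- The fold of a toric origami manifold. -/
def Z (X : ToricOrigami n M) : Set M := fold X.Ω

/-- The generator of the null circle, as an element of the Lie algebra. -/
def nullGen (X : ToricOrigami n M) (z : M) : Fin n → ℝ := fun i => (X.nullVec z i : ℝ)

/-- `N` is a connected component of the complement of the fold. -/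
def IsSheet (X : ToricOrigami n M) (N : Set M) : Prop :=
  ∃ x ∈ X.Zᶜ, N = connectedComponentIn X.Zᶜ x

/-- `C` is a connected component of the fold. -/
def IsFoldComponent (X : ToricOrigami n M) (C : Set M) : Prop :=
  ∃ x ∈ X.Z, C = connectedComponentIn X.Z x

/-- The moment polytope of a component of the complement of the fold. -/
def polytope (X : ToricOrigami n M) (N : Set M) : Set (Fin n → ℝ) := X.μ '' closure N

/-- `F` is a (nonempty) face of the polytope of `N`; the polytope itself is a face. -/
def IsFace (X : ToricOrigami n M) (N : Set M) (F : Set (Fin n → ℝ)) : Prop :=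
  F.Nonempty ∧ IsExposed ℝ (X.polytope N) F

end ToricOrigami

/-- The dimension of a face. -/
def faceDim (F : Set (Fin n → ℝ)) : ℕ := Module.finrank ℝ (vectorSpan ℝ F)

/-- A `T`-equivariant Moser model of a neighbourhood of the fold: a diffeomorphism
`φ : Z × (-ε₀, ε₀) → 𝒰` with inverse `(p, t)` and `φ^* Ω = p^* (Ω|_Z) + d(t² p^* α)`, where `α` is a
`T`-invariant connection form of the null fibration.  The form `β` is `p^* α`. -/
structure Collar (X : ToricOrigami n M) where
  ε₀ : ℝ
  ε₀_pos : 0 < ε₀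
  /-- the neighbourhood of the fold -/
  𝒰 : Set M
  isOpen : IsOpen 𝒰
  φ : M → ℝ → M
  p : M → M
  t : M → ℝ
  continuousOn_φ : ContinuousOn (fun q : M × ℝ => φ q.1 q.2) (X.Z ×ˢ Ioo (-ε₀) ε₀)
  map_φ : ∀ z ∈ X.Z, ∀ s ∈ Ioo (-ε₀) ε₀, φ z s ∈ 𝒰 ∧ p (φ z s) = z ∧ t (φ z s) = s
  map_pt : ∀ x ∈ 𝒰, p x ∈ X.Z ∧ t x ∈ Ioo (-ε₀) ε₀ ∧ φ (p x) (t x) = x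
  φ_zero : ∀ z ∈ X.Z, φ z 0 = z
  smooth_p : ContMDiffOn (𝓡 (2 * n)) (𝓡 (2 * n)) ∞ p 𝒰
  smooth_t : ContMDiffOn (𝓡 (2 * n)) 𝓘(ℝ, ℝ) ∞ t 𝒰
  immersive : ∀ x ∈ 𝒰, ∀ u : TangentSpace (𝓡 (2 * n)) x,
    mfderiv (𝓡 (2 * n)) (𝓡 (2 * n)) p x u = 0 → differential n t x u = 0 → u = 0
  equivariant : ∀ x ∈ 𝒰, ∀ v, X.act v x ∈ 𝒰 ∧ p (X.act v x) = X.act v (p x) ∧ t (X.act v x) = t x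
  β : OneForm n M
  smooth_β : ContMDiffOn (𝓡 (2 * n)) ((𝓡 (2 * n)).prod 𝓘(ℝ, Model n →L[ℝ] ℝ)) ∞
    (fun x ↦ TotalSpace.mk' (Model n →L[ℝ] ℝ) (E := fun x : M => TangentSpace (𝓡 (2 * n)) x →L[ℝ] ℝ)
      x (β x)) 𝒰
  β_pullback : ∀ x ∈ 𝒰, ∀ u : TangentSpace (𝓡 (2 * n)) x,
    β x u = β (p x) (mfderiv (𝓡 (2 * n)) (𝓡 (2 * n)) p x u)
  β_vertical : ∀ z ∈ X.Z, β z (X.field (X.nullGen z) z) = 1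
  β_invariant : ∀ x ∈ 𝒰, ∀ v (u : TangentSpace (𝓡 (2 * n)) x), β (X.act v x) (X.push v x u) = β x u
  normal_form : ∀ x ∈ 𝒰, ∀ u w : TangentSpace (𝓡 (2 * n)) x,
    X.Ω x u w =
      X.Ω (p x) (mfderiv (𝓡 (2 * n)) (𝓡 (2 * n)) p x u) (mfderiv (𝓡 (2 * n)) (𝓡 (2 * n)) p x w) +
      (2 * t x * (differential n t x u * β x w - differential n t x w * β x u) +
        t x ^ 2 * extDerivOne β x u w)

/-- The open collar `Z × (-ε, ε)`. -/
def Collar.nhd {X : ToricOrigami n M} (K : Collar X) (ε : ℝ) : Set M := {x ∈ K.𝒰 | |K.t x| < ε}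

/-- The closed collar `Z × [-ε, ε]`. -/
def Collar.closedNhd {X : ToricOrigami n M} (K : Collar X) (ε : ℝ) : Set M :=
  {x ∈ K.𝒰 | |K.t x| ≤ ε}

/-- The subtori `T_F`: for every sheet `N` and face `F` of its polytope, `stab N F` is the Lie algebra
of the subtorus that is the stabilizer of all points of `N` over the relative interior of `F`. -/
structure FaceStabilizers (X : ToricOrigami n M) where
  stab : Set M → Set (Fin n → ℝ) → Submodule ℝ (Fin n → ℝ)
  rational : ∀ N F, X.IsSheet N → X.IsFace N F → IsRational (stab N F)
  finrank_eq : ∀ N F, X.IsSheet N → X.IsFace N F → Module.finrank ℝ (stab N F) + faceDim F = n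
  stab_top : ∀ N, X.IsSheet N → stab N (X.polytope N) = ⊥
  stab_eq : ∀ N F, X.IsSheet N → X.IsFace N F → ∀ x ∈ N, X.μ x ∈ intrinsicInterior ℝ F →
    ∀ w, X.act w x = x ↔ ∃ u ∈ stab N F, w - u ∈ lattice n

/-- The Lie algebra of `G_F`, the orthogonal complement of that of `T_F` for the rational metric `Q`. -/
def FaceStabilizers.perp {X : ToricOrigami n M} (S : FaceStabilizers X)
    (Q : Matrix (Fin n) (Fin n) ℚ) (N : Set M) (F : Set (Fin n → ℝ)) : Submodule ℝ (Fin n → ℝ) :=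
  (Matrix.toBilin' (Q.map (fun q : ℚ => (q : ℝ)))).orthogonal (S.stab N F)

/-- The part of the polytope of `N` outside the image of the closed collar. -/
def outerPolytope {X : ToricOrigami n M} (K : Collar X) (ε : ℝ) (N : Set M) : Set (Fin n → ℝ) :=
  X.polytope N \ X.μ '' (K.closedNhd ε ∩ closure N)

/-- The open covering of the polytopes outside the fold by small neighbourhoods `nbd N F` of what the
neighbourhoods of the lower dimensional faces leave of the faces `F`, and by the open polytopes.
Smallness means that the orbits of `G_F` over `nbd N F` have dimension `dim G_F`, and that the groups of
overlapping neighbourhoods are nested. -/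
structure FaceCover {X : ToricOrigami n M} (K : Collar X) (ε : ℝ) (S : FaceStabilizers X)
    (Q : Matrix (Fin n) (Fin n) ℚ) where
  nbd : Set M → Set (Fin n → ℝ) → Set (Fin n → ℝ)
  nbd_top : ∀ N, X.IsSheet N → nbd N (X.polytope N) = interior (X.polytope N)
  nbd_open : ∀ N F, X.IsSheet N → X.IsFace N F → F ≠ X.polytope N →
    ∃ O, IsOpen O ∧ nbd N F = O ∩ outerPolytope K ε N
  nbd_covers : ∀ N F, X.IsSheet N → X.IsFace N F → F ≠ X.polytope N →
    (outerPolytope K ε N \ ⋃ F' ∈ {F' | X.IsFace N F' ∧ faceDim F' < faceDim F}, nbd N F') ∩ F ⊆ nbd N F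
  nbd_disjoint : ∀ N F F', X.IsSheet N → X.IsFace N F → X.IsFace N F' → F ≠ F' →
    faceDim F = faceDim F' → Disjoint (nbd N F) (nbd N F')
  locallyFree : ∀ N F, X.IsSheet N → X.IsFace N F → F ≠ X.polytope N → ∀ x ∈ N, X.μ x ∈ nbd N F →
    ∀ v ∈ S.perp Q N F, X.field v x = 0 → v = 0
  nested : ∀ N F F', X.IsSheet N → X.IsFace N F → X.IsFace N F' → F ≠ X.polytope N →
    F' ≠ X.polytope N → (nbd N F ∩ nbd N F').Nonempty →
    S.perp Q N F ≤ S.perp Q N F' ∨ S.perp Q N F' ≤ S.perp Q N F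

namespace FaceCover

variable {X : ToricOrigami n M} {K : Collar X} {ε : ℝ} {S : FaceStabilizers X}
  {Q : Matrix (Fin n) (Fin n) ℚ}

/-- The open set `M_F`: the part of the sheet `N` over `nbd N F`. -/
def stratum (c : FaceCover K ε S Q) (N : Set M) (F : Set (Fin n → ℝ)) : Set M :=
  {x ∈ N | X.μ x ∈ c.nbd N F}

/-- The set `M_F°`: the part of `M_F` where the moment map of the `G_F`-action is not in the weight lattice of `G_F`. -/
def regularStratum (c : FaceCover K ε S Q) (N : Set M) (F : Set (Fin n → ℝ)) : Set M :=
  {x ∈ c.stratum N F | ¬ IsWeightOn (S.perp Q N F) (X.μ x)}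

/-- The crack of the sheet `N` at the face `F` (of codimension one). -/
def crack (_c : FaceCover K ε S Q) (N : Set M) (F : Set (Fin n → ℝ)) : Set M :=
  {x ∈ N | X.μ x ∈ X.μ '' ((K.closedNhd ε \ K.nhd (ε / 2)) ∩ N) ∩ F}

/-- The set `V`: the union of the collar and of the sets `M_F°`, without the fold and the cracks. -/
def domain (c : FaceCover K ε S Q) : Set M :=
  (K.nhd (ε / 2) ∪ ⋃ N ∈ {N | X.IsSheet N}, ⋃ F ∈ {F | X.IsFace N F}, c.regularStratum N F) \
    (X.Z ∪ ⋃ N ∈ {N | X.IsSheet N}, ⋃ F ∈ {F | X.IsFace N F ∧ faceDim F + 1 = n}, c.crack N F)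

/-- The index set of the covering: the components of the fold, and the pairs of a sheet and a face. -/
def Index (X : ToricOrigami n M) : Type _ :=
  {C : Set M // X.IsFoldComponent C} ⊕
    {P : Set M × Set (Fin n → ℝ) // X.IsSheet P.1 ∧ X.IsFace P.1 P.2}

/-- The members of the covering of `V`. -/
def piece (c : FaceCover K ε S Q) : Index X → Set M
  | .inl C => {x ∈ K.nhd (ε / 2) | K.p x ∈ C.1} ∩ c.domain
  | .inr P => c.regularStratum P.1.1 P.1.2 ∩ c.domain

/-- The Lie algebras of the tori that act on the members of the covering: the null circle of a
component of the fold, and the groups `G_F`. -/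
def algebra (_c : FaceCover K ε S Q) : Index X → Submodule ℝ (Fin n → ℝ)
  | .inl C => Submodule.span ℝ (X.nullGen '' C.1)
  | .inr P => S.perp Q P.1.1 P.1.2

end FaceCover

/-! ### Riemannian metrics -/

/-- Smooth Riemannian metrics on `M`. -/
abbrev Metric (n : ℕ) (M : Type*) [TopologicalSpace M] [ChartedSpace (Model n) M]
    [IsManifold (𝓡 (2 * n)) ∞ M] :=
  ContMDiffRiemannianMetric (𝓡 (2 * n)) ∞ (Model n) (fun x : M => TangentSpace (𝓡 (2 * n)) x)

/-- The metric is invariant under the torus action. -/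
def IsInvariantMetric (A : TorusAction n M) (g : Metric n M) : Prop :=
  ∀ v x (u w : TangentSpace (𝓡 (2 * n)) x),
    g.inner (A.act v x) (A.push v x u) (A.push v x w) = g.inner x u w

/-- `vol` is the Riemannian measure of `g`: it has density `√det g` in every chart. -/
def IsRiemannianVolume [MeasurableSpace M] (g : Metric n M) (vol : Measure M) : Prop :=
  ∀ (x₀ : M) (B : Set M), MeasurableSet B → B ⊆ (chartAt (Model n) x₀).source →
    vol B = ∫⁻ y in extChartAt (𝓡 (2 * n)) x₀ '' B, ENNReal.ofReal (Real.sqrt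
      (Matrix.det (Matrix.of fun i j : Fin (2 * n) =>
        chartCoeff g.inner x₀ (stdVec n i) (stdVec n j) y)))

/-! ### Equivariant Hermitian bundles -/

section Bundles

variable {F : Type*} [NormedAddCommGroup F] [NormedSpace ℂ F]
  {W : M → Type*} [∀ x, NormedAddCommGroup (W x)] [∀ x, InnerProductSpace ℂ (W x)]
  [TopologicalSpace (TotalSpace F W)] [FiberBundle F W] [VectorBundle ℝ F W]

/-- `s` is a smooth section. -/
def IsSmoothSection (n : ℕ) {M : Type*} [TopologicalSpace M] [ChartedSpace (Model n) M] (F : Type*) [NormedAddCommGroup F] [NormedSpace ℂ F]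
    {W : M → Type*} [∀ x, NormedAddCommGroup (W x)] [∀ x, InnerProductSpace ℂ (W x)]
    [TopologicalSpace (TotalSpace F W)] [FiberBundle F W] [VectorBundle ℝ F W]
    (s : ∀ x : M, W x) : Prop :=
  ContMDiff (𝓡 (2 * n)) ((𝓡 (2 * n)).prod 𝓘(ℝ, F)) ∞ (fun x => TotalSpace.mk' F x (s x))

/-- A smooth Hermitian structure with a smooth unitary lift of the torus action. -/
structure EquivariantHermitian (A : TorusAction n M) (F : Type*) [NormedAddCommGroup F]
    [NormedSpace ℂ F] (W : M → Type*) [∀ x, NormedAddCommGroup (W x)]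
    [∀ x, InnerProductSpace ℂ (W x)] [TopologicalSpace (TotalSpace F W)] [FiberBundle F W]
    [VectorBundle ℝ F W] where
  smooth_inner : ∀ s s' : ∀ x : M, W x, IsSmoothSection n F s → IsSmoothSection n F s' →
    ContMDiff (𝓡 (2 * n)) 𝓘(ℝ, ℂ) ∞ (fun x => inner ℂ (s x) (s' x))
  lift : ∀ (v : Fin n → ℝ) (x : M), W x ≃ₗᵢ[ℂ] W (A.act v x)
  lift_add : ∀ v w x (ξ : W x), TotalSpace.mk' F (A.act (v + w) x) (lift (v + w) x ξ) =
    TotalSpace.mk' F (A.act v (A.act w x)) (lift v (A.act w x) (lift w x ξ))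
  lift_lattice : ∀ v ∈ lattice n, ∀ x (ξ : W x),
    TotalSpace.mk' F (A.act v x) (lift v x ξ) = TotalSpace.mk' F x ξ
  smooth_lift : ContMDiff (𝓘(ℝ, Fin n → ℝ).prod ((𝓡 (2 * n)).prod 𝓘(ℝ, F)))
    ((𝓡 (2 * n)).prod 𝓘(ℝ, F)) ∞
    (fun q : (Fin n → ℝ) × TotalSpace F W =>
      TotalSpace.mk' F (A.act q.1 q.2.1) (lift q.1 q.2.1 q.2.2))

/-- The Lie derivative of a section along the fundamental vector field of `v`. -/
def EquivariantHermitian.lieDeriv {A : TorusAction n M} (R : EquivariantHermitian A F W)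
    (v : Fin n → ℝ) (s : ∀ x : M, W x) (x : M) : W x :=
  deriv (fun τ : ℝ => (R.lift (τ • v) x).symm (s (A.act (τ • v) x))) 0

/-- A `T`-equivariant `ℤ/2`-graded Hermitian Clifford module bundle over `(M, g)`. -/
structure CliffordBundle (A : TorusAction n M) (g : Metric n M) (F : Type*) [NormedAddCommGroup F]
    [NormedSpace ℂ F] (W : M → Type*) [∀ x, NormedAddCommGroup (W x)]
    [∀ x, InnerProductSpace ℂ (W x)] [TopologicalSpace (TotalSpace F W)] [FiberBundle F W]
    [VectorBundle ℝ F W] extends EquivariantHermitian A F W where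
  /-- Clifford multiplication -/
  c : ∀ x : M, TangentSpace (𝓡 (2 * n)) x →ₗ[ℝ] (W x →ₗ[ℂ] W x)
  c_sq : ∀ x u ξ, c x u (c x u ξ) = -((g.inner x u u : ℝ) : ℂ) • ξ
  c_skew : ∀ x u ξ η, inner ℂ (c x u ξ) η = -inner ℂ ξ (c x u η)
  c_smooth : ∀ (U : ∀ x : M, TangentSpace (𝓡 (2 * n)) x) (s : ∀ x : M, W x),
    ContMDiff (𝓡 (2 * n)) (𝓡 (2 * n)).tangent ∞ (fun x => (⟨x, U x⟩ : TangentBundle (𝓡 (2 * n)) M)) →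
    IsSmoothSection n F s → IsSmoothSection n F (fun x => c x (U x) (s x))
  c_equivariant : ∀ v x u ξ, lift v x (c x u ξ) = c (A.act v x) (A.push v x u) (lift v x ξ)
  /-- the grading operator -/
  grade : ∀ x : M, W x →ₗ[ℂ] W x
  grade_sq : ∀ x ξ, grade x (grade x ξ) = ξ
  grade_symm : ∀ x ξ η, inner ℂ (grade x ξ) η = inner ℂ ξ (grade x η)
  grade_smooth : ∀ s : ∀ x : M, W x, IsSmoothSection n F s → IsSmoothSection n F (fun x => grade x (s x))
  grade_c : ∀ x u ξ, grade x (c x u ξ) = -c x u (grade x ξ)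
  grade_equivariant : ∀ v x ξ, lift v x (grade x ξ) = grade (A.act v x) (lift v x ξ)

end Bundles

/-- A `T`-equivariant pre-quantizing line bundle: a `T`-equivariant Hermitian line bundle `L` with a
`T`-invariant Hermitian connection of curvature `-2π√-1 Ω`, the moment map being the one that is
determined by the lift of the action to `L`. -/
structure Prequantization (X : ToricOrigami n M) (L : M → Type*) [∀ x, NormedAddCommGroup (L x)]
    [∀ x, InnerProductSpace ℂ (L x)] [TopologicalSpace (TotalSpace ℂ L)] [FiberBundle ℂ L]
    [VectorBundle ℝ ℂ L] extends EquivariantHermitian X.toTorusAction ℂ L where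
  /-- the connection, `conn σ x u = ∇_u σ` -/
  conn : CovariantDerivative (𝓡 (2 * n)) ℂ L
  conn_smooth : CovariantDerivative.ContMDiffCovariantDerivative conn ∞
  conn_smul : ∀ (a : ℂ) (σ : ∀ x : M, L x), IsSmoothSection n ℂ σ → ∀ x u,
    conn (fun y => a • σ y) x u = a • conn σ x u
  conn_metric : ∀ σ σ' : ∀ x : M, L x, IsSmoothSection n ℂ σ → IsSmoothSection n ℂ σ' → ∀ x u,
    mfderiv (𝓡 (2 * n)) 𝓘(ℝ, ℂ) (fun y => inner ℂ (σ y) (σ' y)) x u =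
      inner ℂ (conn σ x u) (σ' x) + inner ℂ (σ x) (conn σ' x u)
  conn_invariant : ∀ v (σ σ' : ∀ x : M, L x), IsSmoothSection n ℂ σ → IsSmoothSection n ℂ σ' →
    (∀ x, σ' (X.act v x) = lift v x (σ x)) → ∀ x (u : TangentSpace (𝓡 (2 * n)) x),
    conn σ' (X.act v x) (X.push v x u) = lift v x (conn σ x u)
  curvature : ∀ (U V : ∀ x : M, TangentSpace (𝓡 (2 * n)) x) (σ : ∀ x : M, L x),
    ContMDiff (𝓡 (2 * n)) (𝓡 (2 * n)).tangent ∞ (fun x => (⟨x, U x⟩ : TangentBundle (𝓡 (2 * n)) M)) →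
    ContMDiff (𝓡 (2 * n)) (𝓡 (2 * n)).tangent ∞ (fun x => (⟨x, V x⟩ : TangentBundle (𝓡 (2 * n)) M)) →
    IsSmoothSection n ℂ σ → ∀ x,
    conn (fun y => conn σ y (V y)) x (U x) - conn (fun y => conn σ y (U y)) x (V x) -
        conn σ x (VectorField.mlieBracket (𝓡 (2 * n)) U V x) =
      (-(2 * Real.pi * Complex.I) * (X.Ω x (U x) (V x) : ℂ)) • σ x
  kostant : ∀ v (σ : ∀ x : M, L x), IsSmoothSection n ℂ σ → ∀ x,
    conn σ x (X.field v x) =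
      toEquivariantHermitian.lieDeriv v σ x + (2 * Real.pi * Complex.I * (X.μ x ⬝ᵥ v : ℝ)) • σ x

/-! ### The Dirac operators along the orbits -/

section Operators

variable {X : ToricOrigami n M} {g : Metric n M}
  {FW : Type*} [NormedAddCommGroup FW] [NormedSpace ℂ FW]
  {W : M → Type*} [∀ x, NormedAddCommGroup (W x)] [∀ x, InnerProductSpace ℂ (W x)]
  [TopologicalSpace (TotalSpace FW W)] [FiberBundle FW W] [VectorBundle ℝ FW W]
  {L : M → Type*} [∀ x, NormedAddCommGroup (L x)] [∀ x, InnerProductSpace ℂ (L x)]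
  [TopologicalSpace (TotalSpace ℂ L)] [FiberBundle ℂ L] [VectorBundle ℝ ℂ L]

/-- Smooth sections of `W ⊗ L`.  As `L` is a line bundle, these are locally of the form `w ⊗ l`. -/
def IsSmoothTensor (n : ℕ) {M : Type*} [TopologicalSpace M] [ChartedSpace (Model n) M] (FW : Type*) [NormedAddCommGroup FW] [NormedSpace ℂ FW]
    {W : M → Type*} [∀ x, NormedAddCommGroup (W x)] [∀ x, InnerProductSpace ℂ (W x)]
    [TopologicalSpace (TotalSpace FW W)] [FiberBundle FW W] [VectorBundle ℝ FW W]
    {L : M → Type*} [∀ x, NormedAddCommGroup (L x)] [∀ x, InnerProductSpace ℂ (L x)]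
    [TopologicalSpace (TotalSpace ℂ L)] [FiberBundle ℂ L] [VectorBundle ℝ ℂ L]
    (s : ∀ x : M, W x ⊗[ℂ] L x) : Prop :=
  ∀ x, ∃ (w : ∀ x : M, W x) (l : ∀ x : M, L x), IsSmoothSection n FW w ∧ IsSmoothSection n ℂ l ∧
    ∀ᶠ y in 𝓝 x, s y = w y ⊗ₜ[ℂ] l y

/-- Smooth sections of `W ⊗ L` with compact support contained in `B`. -/
def IsTestSection (n : ℕ) {M : Type*} [TopologicalSpace M] [ChartedSpace (Model n) M] (FW : Type*) [NormedAddCommGroup FW] [NormedSpace ℂ FW]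
    {W : M → Type*} [∀ x, NormedAddCommGroup (W x)] [∀ x, InnerProductSpace ℂ (W x)]
    [TopologicalSpace (TotalSpace FW W)] [FiberBundle FW W] [VectorBundle ℝ FW W]
    {L : M → Type*} [∀ x, NormedAddCommGroup (L x)] [∀ x, InnerProductSpace ℂ (L x)]
    [TopologicalSpace (TotalSpace ℂ L)] [FiberBundle ℂ L] [VectorBundle ℝ ℂ L]
    (B : Set M) (s : ∀ x : M, W x ⊗[ℂ] L x) : Prop :=
  IsSmoothTensor n FW s ∧ ∃ C : Set M, IsCompact C ∧ C ⊆ B ∧ ∀ x ∉ C, s x = 0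

/-- The lift of the torus action to `W ⊗ L`. -/
def tensorLift (R : CliffordBundle X.toTorusAction g FW W) (P : Prequantization X L)
    (v : Fin n → ℝ) (x : M) : (W x ⊗[ℂ] L x) ≃ₗ[ℂ] (W (X.act v x) ⊗[ℂ] L (X.act v x)) :=
  TensorProduct.congr (R.lift v x).toLinearEquiv (P.lift v x).toLinearEquiv

/-- Clifford multiplication on `W ⊗ L`. -/
def cliff (R : CliffordBundle X.toTorusAction g FW W) (L : M → Type*)
    [∀ x, NormedAddCommGroup (L x)] [∀ x, InnerProductSpace ℂ (L x)] (x : M)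
    (u : TangentSpace (𝓡 (2 * n)) x) : (W x ⊗[ℂ] L x) →ₗ[ℂ] (W x ⊗[ℂ] L x) :=
  (R.c x u).rTensor (L x)

/-- The grading operator of `W ⊗ L`. -/
def gradeTensor (R : CliffordBundle X.toTorusAction g FW W) (L : M → Type*)
    [∀ x, NormedAddCommGroup (L x)] [∀ x, InnerProductSpace ℂ (L x)] (x : M) :
    (W x ⊗[ℂ] L x) →ₗ[ℂ] (W x ⊗[ℂ] L x) :=
  (R.grade x).rTensor (L x)

open Classical in
/-- The difference `∇_v - ℒ_v` of the connection of `L` and the Lie derivative along the fundamental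
vector field of `v`; it is the multiplication by a number on the fibre at `x`. -/
def potential (P : Prequantization X L) (v : Fin n → ℝ) (x : M) : ℂ :=
  if h : ∃ k : ℂ, ∀ σ : ∀ x : M, L x, IsSmoothSection n ℂ σ →
      P.conn σ x (X.field v x) = P.lieDeriv v σ x + k • σ x
  then h.choose else 0

/-- The covariant derivative along the fundamental vector field of `v` for the tensor product of the
flat connection of `W` along the orbits given by the torus action, and of `∇` on `L`: as an operator
it is `ℒ_v ⊗ 1 + 1 ⊗ ∇_v = ℒ_v + 1 ⊗ (∇_v - ℒ_v)`. -/
def orbitDeriv (R : CliffordBundle X.toTorusAction g FW W) (P : Prequantization X L)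
    (v : Fin n → ℝ) (s : ∀ x : M, W x ⊗[ℂ] L x) (x : M) : W x ⊗[ℂ] L x :=
  deriv (fun τ : ℝ => (tensorLift R P (τ • v) x).symm (s (X.act (τ • v) x))) 0 + potential P v x • s x

/-- The Gram matrix of the fundamental vector fields of a basis of `𝔥`. -/
def gram (A : TorusAction n M) (g : Metric n M) (𝔥 : Submodule ℝ (Fin n → ℝ)) (x : M) :
    Matrix (Fin (Module.finrank ℝ 𝔥)) (Fin (Module.finrank ℝ 𝔥)) ℝ :=
  Matrix.of fun i j => g.inner x (A.field (Module.finBasis ℝ 𝔥 i) x) (A.field (Module.finBasis ℝ 𝔥 j) x)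

/-- The Dirac operator `∑ g^{ij} c(v_i) ∇_{v_j}` along the orbits of the subtorus with Lie algebra `𝔥`
on the sections of `W ⊗ L`, where the `v_i` are the fundamental vector fields of a basis of `𝔥` (the
operator does not depend on the basis).  For a circle it is `|v|⁻² c(v) ∇_v`. -/
def orbitDirac (R : CliffordBundle X.toTorusAction g FW W) (P : Prequantization X L)
    (𝔥 : Submodule ℝ (Fin n → ℝ)) (s : ∀ x : M, W x ⊗[ℂ] L x) (x : M) : W x ⊗[ℂ] L x :=
  ∑ i, ∑ j, (((gram X.toTorusAction g 𝔥 x)⁻¹ i j : ℝ) : ℂ) •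
    cliff R L x (X.field (Module.finBasis ℝ 𝔥 i) x)
      (orbitDeriv R P (Module.finBasis ℝ 𝔥 j : Fin n → ℝ) s x)

/-- Smooth sections of the pull-back of `W ⊗ L` to the subtorus `G` with Lie algebra `𝔥` under the
finite covering `G → G x` of the leaf through `x`.  They are written as functions of `v ∈ 𝔥`, and are
periodic for the integral lattice of `𝔥`. -/
def IsLeafSection (R : CliffordBundle X.toTorusAction g FW W) (P : Prequantization X L)
    (𝔥 : Submodule ℝ (Fin n → ℝ)) (x : M)
    (σ : ∀ v : 𝔥, W (X.act v x) ⊗[ℂ] L (X.act v x)) : Prop :=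
  ContDiff ℝ ∞ (fun v : 𝔥 => (tensorLift R P v x).symm (σ v)) ∧
  ∀ v a : 𝔥, (a : Fin n → ℝ) ∈ lattice n →
    (tensorLift R P ((v + a : 𝔥) : Fin n → ℝ) x).symm (σ (v + a)) = (tensorLift R P v x).symm (σ v)

/-- The pull-back of the Dirac operator along the orbits under the covering `G → G x`. -/
def leafDirac (R : CliffordBundle X.toTorusAction g FW W) (P : Prequantization X L)
    (𝔥 : Submodule ℝ (Fin n → ℝ)) (x : M)
    (σ : ∀ v : 𝔥, W (X.act v x) ⊗[ℂ] L (X.act v x)) (v : 𝔥) : W (X.act v x) ⊗[ℂ] L (X.act v x) :=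
  ∑ i, ∑ j, (((gram X.toTorusAction g 𝔥 (X.act v x))⁻¹ i j : ℝ) : ℂ) •
    cliff R L (X.act v x) (X.field (Module.finBasis ℝ 𝔥 i) (X.act v x))
      (tensorLift R P v x (deriv (fun τ : ℝ =>
          (tensorLift R P ((v + τ • Module.finBasis ℝ 𝔥 j : 𝔥) : Fin n → ℝ) x).symm
            (σ (v + τ • Module.finBasis ℝ 𝔥 j))) 0) +
        potential P (Module.finBasis ℝ 𝔥 j : Fin n → ℝ) (X.act v x) • σ v)

/-- The sets `B i`, foliated by the orbits of the subtori with Lie algebras `𝔥 i`, form a good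
compatible fibration on `V`. -/
structure IsGoodFibration (X : ToricOrigami n M) {ι : Type*} (V : Set M) (B : ι → Set M)
    (𝔥 : ι → Submodule ℝ (Fin n → ℝ)) : Prop where
  covers : ⋃ i, B i = V
  invariant : ∀ i, ∀ x ∈ B i, ∀ v, X.act v x ∈ B i
  rational : ∀ i, IsRational (𝔥 i)
  locallyFree : ∀ i, ∀ x ∈ B i, ∀ v ∈ 𝔥 i, X.field v x = 0 → v = 0
  nested : ∀ i j, (B i ∩ B j).Nonempty → 𝔥 i ≤ 𝔥 j ∨ 𝔥 j ≤ 𝔥 i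

/-- The Dirac operators along the orbits form a compatible system: they are of first order with the
Clifford multiplication along the leaves as symbol, of degree one, formally self-adjoint, restrict to
the leaves, and anti-commute with the Clifford multiplication by invariant normal vector fields. -/
structure IsCompatibleSystem [MeasurableSpace M] (R : CliffordBundle X.toTorusAction g FW W)
    (P : Prequantization X L) (vol : Measure M) {ι : Type*} (B : ι → Set M)
    (𝔥 : ι → Submodule ℝ (Fin n → ℝ)) : Prop where
  symbol : ∀ i, ∀ s : ∀ x : M, W x ⊗[ℂ] L x, IsSmoothTensor n FW s → ∀ f : M → ℝ,
    ContMDiff (𝓡 (2 * n)) 𝓘(ℝ, ℝ) ∞ f → ∀ x ∈ B i,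
    orbitDirac R P (𝔥 i) (fun y => (f y : ℂ) • s y) x = (f x : ℂ) • orbitDirac R P (𝔥 i) s x +
      ∑ a, ∑ b, ((((gram X.toTorusAction g (𝔥 i) x)⁻¹ a b *
          differential n f x (X.field (Module.finBasis ℝ (𝔥 i) b) x) : ℝ)) : ℂ) •
        cliff R L x (X.field (Module.finBasis ℝ (𝔥 i) a) x) (s x)
  odd : ∀ i, ∀ s : ∀ x : M, W x ⊗[ℂ] L x, IsSmoothTensor n FW s → ∀ x ∈ B i,
    orbitDirac R P (𝔥 i) (fun y => gradeTensor R L y (s y)) x =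
      -gradeTensor R L x (orbitDirac R P (𝔥 i) s x)
  selfAdjoint : ∀ i, ∀ s s' : ∀ x : M, W x ⊗[ℂ] L x, IsTestSection n FW (B i) s →
    IsTestSection n FW (B i) s' →
    ∫ x, inner ℂ (orbitDirac R P (𝔥 i) s x) (s' x) ∂vol =
      ∫ x, inner ℂ (s x) (orbitDirac R P (𝔥 i) s' x) ∂vol
  restricts : ∀ i, ∀ s : ∀ x : M, W x ⊗[ℂ] L x, IsSmoothTensor n FW s → ∀ x ∈ B i, ∀ v : 𝔥 i,
    leafDirac R P (𝔥 i) x (fun v => s (X.act v x)) v = orbitDirac R P (𝔥 i) s (X.act v x)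
  anticommutes : ∀ i, ∀ x ∈ B i, ∀ u : TangentSpace (𝓡 (2 * n)) x,
    (∀ v ∈ 𝔥 i, g.inner x u (X.field v x) = 0) →
    ∀ σ : ∀ v : 𝔥 i, W (X.act v x) ⊗[ℂ] L (X.act v x), IsLeafSection R P (𝔥 i) x σ → ∀ v : 𝔥 i,
    leafDirac R P (𝔥 i) x (fun v => cliff R L (X.act v x) (X.push v x u) (σ v)) v +
      cliff R L (X.act v x) (X.push v x u) (leafDirac R P (𝔥 i) x σ v) = 0

/-- Acyclicity: the operators have zero kernel on the finite coverings of all leaves, and the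
anti-commutators are non-negative operators on the overlaps. -/
structure IsAcyclic [MeasurableSpace M] (R : CliffordBundle X.toTorusAction g FW W)
    (P : Prequantization X L) (vol : Measure M) {ι : Type*} (B : ι → Set M)
    (𝔥 : ι → Submodule ℝ (Fin n → ℝ)) : Prop where
  kernel : ∀ i, ∀ x ∈ B i, ∀ σ : ∀ v : 𝔥 i, W (X.act v x) ⊗[ℂ] L (X.act v x),
    IsLeafSection R P (𝔥 i) x σ → (∀ v, leafDirac R P (𝔥 i) x σ v = 0) → ∀ v, σ v = 0
  nonneg : ∀ i j, ∀ s : ∀ x : M, W x ⊗[ℂ] L x, IsTestSection n FW (B i ∩ B j) s →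
    let I := ∫ x, inner ℂ (s x) (orbitDirac R P (𝔥 i) (orbitDirac R P (𝔥 j) s) x +
      orbitDirac R P (𝔥 j) (orbitDirac R P (𝔥 i) s) x) ∂vol
    0 ≤ I.re ∧ I.im = 0

end Operators

end Manifold

end Origami

end

noncomputable section

set_option linter.unusedSectionVars false

namespace Origami

/-! ### The torus action: fundamental vector fields and their Gram matrices. -/

section

variable {n : ℕ} {M : Type*} [TopologicalSpace M] [ChartedSpace (Model n) M]

section Action

namespace TorusAction

variable (A : TorusAction n M)

/-! Fix a point `x` and use the lift of the action to identify the fibres of `W ⊗ L` along the orbit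
of `x` with the fibre over `x`. The metric, the Clifford multiplication and the moment map are
invariant, so in this trivialization the Dirac operator of a subtorus becomes an operator with
constant coefficients on the Lie algebra, with values in one finite dimensional space: the sum of
`p⁻¹ i j • c i ∘ ∇_j`, where `∇_j = ∂_j + 2π√-1 ⟨μ(x), b_j⟩`, `p` is the Gram matrix and `c i c k +
c k c i = -2 p i k` (`leafDirac_eq`, `orbitDirac_act`). The `∇_j` commute, because the connection
form is constant. Symbol, parity and anti-commutation with normal vectors can be read off directly.

Self-adjointness is integration by parts. The torus preserves the Riemannian measure, so derivatives
along orbits integrate to zero and `∇_v` is skew; `c` is skew too and its coefficients are constant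
along orbits, so the two signs cancel (`integral_inner_orbitDirac`).

For nested algebras `𝔥 ≤ 𝔨` the Clifford relations turn the anti-commutator of the two operators
into twice the square of the operator of the smaller one (`constDirac_anticomm_of_le`). With
self-adjointness its quadratic form is `2 ∫ ‖D_𝔥 s‖²`, which is non-negative.

On a leaf the square of the operator is the Laplacian `-∑ p⁻¹ j l ∇_j ∇_l`. Integrating over a box
of periods shows that a periodic solution is parallel (`covDeriv_eq_zero_of_periodic`), hence equal
to `exp(-2π√-1 ⟨μ, v⟩) f(0)`. Periodicity then forces `f(0) = 0` unless `μ(x)` is a weight of the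
subtorus.

It remains to see that `μ` is never a weight. On the sets `M_F°` this is their definition. In the
collar, the normal form and Cartan's formula for the invariant form `β` give `d(⟨μ, v_Z⟩ + t²) = 0`,
so `⟨μ, v_Z⟩` at `x` is its value at `p x` minus `t²` (`Collar.moment_nullGen`). Its values on the
compact fold are locally constant, so they are bounded away from the integers below them, and small
`t ≠ 0` never yields an integer (`Collar.exists_forall_moment_ne_int`). This determines `ε₁`.

The groups of overlapping sets are nested because a collar meets only the sets over the open
polytopes, whose group is all of `T`; for the other overlaps nestedness is part of the choice of
neighbourhoods. -/

theorem zero_mem_lattice : (0 : Fin n → ℝ) ∈ lattice n := fun _ => ⟨0, by simp⟩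

theorem act_zero (x : M) : A.act 0 x = x := A.act_lattice 0 zero_mem_lattice x

theorem act_neg_act (v : Fin n → ℝ) (x : M) : A.act (-v) (A.act v x) = x := by
  rw [← A.act_add, neg_add_cancel, A.act_zero]

theorem act_act_neg (v : Fin n → ℝ) (x : M) : A.act v (A.act (-v) x) = x := by
  rw [← A.act_add, add_neg_cancel, A.act_zero]

theorem act_comm (v w : Fin n → ℝ) (x : M) : A.act v (A.act w x) = A.act w (A.act v x) := by
  rw [← A.act_add, add_comm, A.act_add]

theorem contMDiff_act (v : Fin n → ℝ) : ContMDiff (𝓡 (2 * n)) (𝓡 (2 * n)) ∞ (A.act v) :=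
  A.smooth.comp (contMDiff_const.prodMk contMDiff_id)

theorem contMDiff_orbit (x : M) :
    ContMDiff 𝓘(ℝ, Fin n → ℝ) (𝓡 (2 * n)) ∞ (fun v => A.act v x) :=
  A.smooth.comp (contMDiff_id.prodMk contMDiff_const)

theorem contMDiff_flow (v : Fin n → ℝ) :
    ContMDiff (𝓘(ℝ, ℝ).prod (𝓡 (2 * n))) (𝓡 (2 * n)) ∞ (fun q : ℝ × M => A.act (q.1 • v) q.2) :=
  A.smooth.comp (((contDiff_id.smul contDiff_const).contMDiff.comp contMDiff_fst).prodMk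
    contMDiff_snd)

theorem contMDiff_curve (v : Fin n → ℝ) (x : M) :
    ContMDiff 𝓘(ℝ, ℝ) (𝓡 (2 * n)) ∞ (fun s : ℝ => A.act (s • v) x) :=
  (A.contMDiff_flow v).comp (contMDiff_id.prodMk contMDiff_const)

theorem continuous_act (v : Fin n → ℝ) : Continuous (A.act v) := (A.contMDiff_act v).continuous

theorem mdifferentiableAt_act (v : Fin n → ℝ) (x : M) :
    MDifferentiableAt (𝓡 (2 * n)) (𝓡 (2 * n)) (A.act v) x :=
  (A.contMDiff_act v).mdifferentiable (by simp) x

theorem mdifferentiableAt_curve (v : Fin n → ℝ) (x : M) (s : ℝ) :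
    MDifferentiableAt 𝓘(ℝ, ℝ) (𝓡 (2 * n)) (fun s : ℝ => A.act (s • v) x) s :=
  (A.contMDiff_curve v x).mdifferentiable (by simp) s

/-- Chain rule along the ray through `v`. Writing all the fundamental vectors at `x` as values of
one differential, that of the orbit map at `0`, is what makes them linear in `v`. -/
theorem field_eq (v : Fin n → ℝ) (x : M) :
    A.field v x = (mfderiv 𝓘(ℝ, Fin n → ℝ) (𝓡 (2 * n)) (fun v => A.act v x) 0 v : Model n) := by
  have h1 : MDifferentiableAt 𝓘(ℝ, Fin n → ℝ) (𝓡 (2 * n)) (fun v => A.act v x) ((0 : ℝ) • v) :=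
    (A.contMDiff_orbit x).mdifferentiable (by simp) _
  have h2 : HasDerivAt (fun s : ℝ => s • v) v 0 := by
    simpa using (hasDerivAt_id (0 : ℝ)).smul_const v
  have h3 := (h1.hasMFDerivAt.comp (0 : ℝ) h2.hasFDerivAt.hasMFDerivAt).mfderiv
  unfold field
  change (mfderiv 𝓘(ℝ, ℝ) (𝓡 (2 * n)) ((fun v => A.act v x) ∘ fun s : ℝ => s • v) 0 (1 : ℝ) :
    Model n) = _
  rw [h3]
  have e : (0 : ℝ) • v = 0 := zero_smul _ _
  change (mfderiv 𝓘(ℝ, Fin n → ℝ) (𝓡 (2 * n)) (fun v => A.act v x) ((0 : ℝ) • v)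
    ((1 : ℝ) • v) : Model n) = _
  rw [one_smul, e]

theorem field_add (v w : Fin n → ℝ) (x : M) : A.field (v + w) x = A.field v x + A.field w x := by
  rw [field_eq, field_eq, field_eq]
  exact map_add (mfderiv 𝓘(ℝ, Fin n → ℝ) (𝓡 (2 * n)) (fun v => A.act v x) 0) v w

theorem field_smul (c : ℝ) (v : Fin n → ℝ) (x : M) : A.field (c • v) x = c • A.field v x := by
  rw [field_eq, field_eq]
  exact map_smul (mfderiv 𝓘(ℝ, Fin n → ℝ) (𝓡 (2 * n)) (fun v => A.act v x) 0) c v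

/-- The infinitesimal action at `x` as a linear map. -/
def fieldMap (x : M) : (Fin n → ℝ) →ₗ[ℝ] TangentSpace (𝓡 (2 * n)) x where
  toFun v := A.field v x
  map_add' v w := A.field_add v w x
  map_smul' c v := A.field_smul c v x

@[simp] theorem fieldMap_apply (x : M) (v : Fin n → ℝ) : A.fieldMap x v = A.field v x := rfl

theorem field_sum {ι : Type*} [Fintype ι] (c : ι → ℝ) (v : ι → Fin n → ℝ) (x : M) :
    A.field (∑ i, c i • v i) x = ∑ i, c i • A.field (v i) x := by
  rw [← A.fieldMap_apply, map_sum]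
  exact Finset.sum_congr rfl fun i _ => by rw [map_smul, A.fieldMap_apply]

/-- By the group law the curve after time `s` is the curve through the displaced point, so its
velocity at `s` is the fundamental vector there. -/
theorem hasMFDerivAt_curve (v : Fin n → ℝ) (x : M) (s : ℝ) :
    HasMFDerivAt 𝓘(ℝ, ℝ) (𝓡 (2 * n)) (fun s : ℝ => A.act (s • v) x) s
      ((1 : ℝ →L[ℝ] ℝ).smulRight (A.field v (A.act (s • v) x) : Model n)) := by
  refine (A.mdifferentiableAt_curve v x s).hasMFDerivAt.congr_mfderiv (Eq.symm ?_)
  have h0 : HasMFDerivAt 𝓘(ℝ, ℝ) (𝓡 (2 * n)) (fun r : ℝ => A.act (r • v) (A.act (s • v) x)) (s - s)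
      (mfderiv 𝓘(ℝ, ℝ) (𝓡 (2 * n)) (fun r : ℝ => A.act (r • v) (A.act (s • v) x)) (s - s)) :=
    (A.mdifferentiableAt_curve v _ _).hasMFDerivAt
  have h2 : HasDerivAt (fun r : ℝ => r - s) 1 s := (hasDerivAt_id s).sub_const s
  have h3 := HasMFDerivAt.comp (f := fun r : ℝ => r - s) s h0 h2.hasFDerivAt.hasMFDerivAt
  have e : ((fun r : ℝ => A.act (r • v) (A.act (s • v) x)) ∘ fun r : ℝ => r - s) =
      fun r : ℝ => A.act (r • v) x := by
    funext r
    simp only [Function.comp]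
    rw [← A.act_add, ← add_smul, sub_add_cancel]
  rw [e] at h3
  have h4 := h3.mfderiv
  rw [h4]
  refine ContinuousLinearMap.ext_ring (R₁ := ℝ) (M₁ := Model n) ?_
  have e0 : s - s = 0 := sub_self s
  change (1 : ℝ) • (A.field v (A.act (s • v) x) : Model n) = (mfderiv 𝓘(ℝ, ℝ) (𝓡 (2 * n))
    (fun r : ℝ => A.act (r • v) (A.act (s • v) x)) (s - s) ((1 : ℝ) • (1 : ℝ)) : Model n)
  rw [one_smul, one_smul, e0]
  rfl

/-- The torus is commutative, so every translation carries orbit curves of `w` to orbit curves of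
`w`. -/
theorem push_field (v w : Fin n → ℝ) (x : M) :
    A.push v x (A.field w x) = A.field w (A.act v x) := by
  have h1 := A.hasMFDerivAt_curve w x 0
  have e : A.act ((0 : ℝ) • w) x = x := by rw [zero_smul, A.act_zero]
  have h2 : HasMFDerivAt (𝓡 (2 * n)) (𝓡 (2 * n)) (A.act v) (A.act ((0 : ℝ) • w) x)
    (mfderiv (𝓡 (2 * n)) (𝓡 (2 * n)) (A.act v) (A.act ((0 : ℝ) • w) x)) :=
      (A.mdifferentiableAt_act v _).hasMFDerivAt
  have h3 := h2.comp (0 : ℝ) h1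
  have e2 : (A.act v ∘ fun s : ℝ => A.act (s • w) x) = fun s : ℝ => A.act (s • w) (A.act v x) := by
    funext s; exact A.act_comm v (s • w) x
  rw [e2] at h3
  unfold field
  rw [h3.mfderiv]
  unfold push
  change (mfderiv (𝓡 (2 * n)) (𝓡 (2 * n)) (A.act v) x : Model n →L[ℝ] Model n) (A.field w x) =
    (mfderiv (𝓡 (2 * n)) (𝓡 (2 * n)) (A.act v) (A.act ((0 : ℝ) • w) x) : Model n →L[ℝ] Model n)
      ((1 : ℝ) • (A.field w (A.act ((0 : ℝ) • w) x) : Model n))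
  rw [one_smul, e]

/-- A point at which the fundamental vector field of `v` vanishes is fixed by `v`. -/
theorem act_smul_eq_self [IsManifold (𝓡 (2 * n)) ∞ M] {v : Fin n → ℝ} {x : M} (h : A.field v x = 0) (s : ℝ) :
    A.act (s • v) x = x := by
  have hd : ∀ s : ℝ, HasMFDerivAt 𝓘(ℝ, ℝ) (𝓡 (2 * n)) (fun s : ℝ => A.act (s • v) x) s
      (0 : ℝ →L[ℝ] Model n) := by
    intro s
    have h1 := A.hasMFDerivAt_curve v x s
    -- A zero of the field propagates along the whole curve, since the field at a translated point
    -- is the push-forward of the field at `x`.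
    rw [← A.push_field, h, map_zero] at h1
    have e : (ContinuousLinearMap.smulRight (1 : ℝ →L[ℝ] ℝ) (0 : Model n)) = 0 := by
      ext; simp
    rw [← e]
    exact h1
  -- A curve with zero velocity is constant in each chart, hence locally constant, hence constant
  -- since `ℝ` is connected.
  have hloc : IsLocallyConstant (fun s : ℝ => A.act (s • v) x) := by
    rw [IsLocallyConstant.iff_eventually_eq]
    intro s₀
    set γ : ℝ → M := fun s : ℝ => A.act (s • v) x with hγ
    have hcont : Continuous γ := (A.contMDiff_curve v x).continuous
    have hsrc : ∀ᶠ s in 𝓝 s₀, γ s ∈ (extChartAt (𝓡 (2 * n)) (γ s₀)).source :=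
      hcont.continuousAt.eventually_mem (extChartAt_source_mem_nhds _)
    obtain ⟨δ, hδ, hball⟩ := Metric.eventually_nhds_iff_ball.1 hsrc
    have hdd : ∀ s ∈ Metric.ball s₀ δ,
        HasDerivAt (fun s => extChartAt (𝓡 (2 * n)) (γ s₀) (γ s)) 0 s := by
      intro s hs
      have : IsManifold (𝓡 (2 * n)) 1 M := IsManifold.of_le (n := ∞) (by simp)
      have h1 : MDifferentiableAt (𝓡 (2 * n)) 𝓘(ℝ, Model n) (extChartAt (𝓡 (2 * n)) (γ s₀)) (γ s) :=
        mdifferentiableAt_extChartAt (by simpa using hball s hs)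
      have h2 : HasFDerivAt (fun s => extChartAt (𝓡 (2 * n)) (γ s₀) (γ s))
          (0 : ℝ →L[ℝ] Model n) s := by
        refine ((h1.hasMFDerivAt.comp s (hd s)).hasFDerivAt).congr_fderiv ?_
        exact ContinuousLinearMap.comp_zero _
      simpa using h2.hasDerivAt
    filter_upwards [Metric.ball_mem_nhds s₀ hδ] with s hs
    have hconst := (convex_ball s₀ δ).is_const_of_fderivWithin_eq_zero (𝕜 := ℝ)
      (f := fun s => extChartAt (𝓡 (2 * n)) (γ s₀) (γ s))
      (fun s hs => (hdd s hs).differentiableAt.differentiableWithinAt) (by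
        intro s hs
        rw [fderivWithin_of_isOpen Metric.isOpen_ball hs, (hdd s hs).hasFDerivAt.fderiv]
        ext; simp) hs (Metric.mem_ball_self hδ)
    exact (extChartAt (𝓡 (2 * n)) (γ s₀)).injOn (hball s hs)
      (hball s₀ (Metric.mem_ball_self hδ)) hconst
  have h2 := hloc.apply_eq_of_isPreconnected isPreconnected_univ (mem_univ s) (mem_univ 0)
  simpa [A.act_zero] using h2

theorem hasDerivAt_comp_curve {E : Type*} [NormedAddCommGroup E] [NormedSpace ℝ E] {f : M → E}
    {x : M} (hf : MDifferentiableAt (𝓡 (2 * n)) 𝓘(ℝ, E) f x) (v : Fin n → ℝ) :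
    HasDerivAt (fun s : ℝ => f (A.act (s • v) x))
      (mfderiv (𝓡 (2 * n)) 𝓘(ℝ, E) f x (A.field v x) : E) 0 := by
  have e : A.act ((0 : ℝ) • v) x = x := by rw [zero_smul, A.act_zero]
  have h1 := A.hasMFDerivAt_curve v x 0
  have hf' : HasMFDerivAt (𝓡 (2 * n)) 𝓘(ℝ, E) f (A.act ((0 : ℝ) • v) x)
    (mfderiv (𝓡 (2 * n)) 𝓘(ℝ, E) f (A.act ((0 : ℝ) • v) x)) := by rw [e]; exact hf.hasMFDerivAt
  have h2 : HasFDerivAt (fun s : ℝ => f (A.act (s • v) x))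
      ((1 : ℝ →L[ℝ] ℝ).smulRight (mfderiv (𝓡 (2 * n)) 𝓘(ℝ, E) f x (A.field v x) : E)) 0 := by
    refine (hf'.comp (0 : ℝ) h1).hasFDerivAt.congr_fderiv ?_
    refine ContinuousLinearMap.ext_ring (R₁ := ℝ) (M₁ := E) ?_
    change (mfderiv (𝓡 (2 * n)) 𝓘(ℝ, E) f (A.act ((0 : ℝ) • v) x) : Model n →L[ℝ] E)
      ((1 : ℝ) • (A.field v (A.act ((0 : ℝ) • v) x) : Model n)) =
        (1 : ℝ) • (mfderiv (𝓡 (2 * n)) 𝓘(ℝ, E) f x : Model n →L[ℝ] E) (A.field v x)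
    rw [one_smul, one_smul, e]
  exact h2.hasDerivAt.congr_deriv (one_smul ℝ _)

/-- The field is the tangent map of the flow applied to the pair of `∂/∂s` at time `0` and the zero
section of `M`. -/
theorem contMDiff_field [IsManifold (𝓡 (2 * n)) ∞ M] (v : Fin n → ℝ) :
    ContMDiff (𝓡 (2 * n)) (𝓡 (2 * n)).tangent ∞
      (fun x => (⟨x, A.field v x⟩ : TangentBundle (𝓡 (2 * n)) M)) := by
  have h1 := (A.contMDiff_flow v).contMDiff_tangentMap (m := ∞) (by simp)
  have h2 : ContMDiff (𝓡 (2 * n)) (𝓘(ℝ, ℝ).prod (𝓡 (2 * n))).tangent ∞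
      (fun x : M => (equivTangentBundleProd 𝓘(ℝ, ℝ) ℝ (𝓡 (2 * n)) M).symm
        ((⟨0, (1 : ℝ)⟩ : TangentBundle 𝓘(ℝ, ℝ) ℝ), zeroSection (Model n) (TangentSpace (𝓡 (2 * n))) x)) :=
    (contMDiff_equivTangentBundleProd_symm).comp
      (contMDiff_const.prodMk (contMDiff_zeroSection ℝ (TangentSpace (𝓡 (2 * n)))))
  have h3 := h1.comp h2
  convert h3 using 1
  funext x
  have e : A.act ((0 : ℝ) • v) x = x := by rw [zero_smul, A.act_zero]
  have hF : MDifferentiableAt (𝓘(ℝ, ℝ).prod (𝓡 (2 * n))) (𝓡 (2 * n))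
      (fun q : ℝ × M => A.act (q.1 • v) q.2) ((0 : ℝ), x) :=
    (A.contMDiff_flow v).mdifferentiable (by simp) _
  have hi : HasMFDerivAt 𝓘(ℝ, ℝ) (𝓘(ℝ, ℝ).prod (𝓡 (2 * n))) (fun s : ℝ => (s, x)) 0
      ((ContinuousLinearMap.id ℝ ℝ).prod (0 : ℝ →L[ℝ] Model n)) :=
    (hasMFDerivAt_id (0 : ℝ)).prodMk (hasMFDerivAt_const x (0 : ℝ))
  have hc := (hF.hasMFDerivAt.comp (0 : ℝ) hi).mfderiv
  refine TotalSpace.ext e.symm (heq_of_eq ?_)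
  change (mfderiv 𝓘(ℝ, ℝ) (𝓡 (2 * n)) ((fun q : ℝ × M => A.act (q.1 • v) q.2) ∘
    fun s : ℝ => (s, x)) 0 (1 : ℝ) : Model n) = _
  rw [hc]
  rfl

end TorusAction

section Gram

variable [IsManifold (𝓡 (2 * n)) ∞ M] {A : TorusAction n M} {g : Metric n M}

theorem inner_field_act (hg : IsInvariantMetric A g) (u v w : Fin n → ℝ) (x : M) :
    g.inner (A.act u x) (A.field v (A.act u x)) (A.field w (A.act u x)) =
      g.inner x (A.field v x) (A.field w x) := by
  rw [← A.push_field, ← A.push_field, hg]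

theorem gram_act (hg : IsInvariantMetric A g) (𝔥 : Submodule ℝ (Fin n → ℝ)) (u : Fin n → ℝ) (x : M) :
    gram A g 𝔥 (A.act u x) = gram A g 𝔥 x := by
  ext i j
  exact inner_field_act hg u _ _ x

theorem gram_symm (𝔥 : Submodule ℝ (Fin n → ℝ)) (x : M) (i j) :
    gram A g 𝔥 x i j = gram A g 𝔥 x j i := g.symm x _ _

theorem inner_sum_sum {ι κ : Type*} [Fintype ι] [Fintype κ] (x : M) (a : ι → ℝ) (b : κ → ℝ)
    (u : ι → TangentSpace (𝓡 (2 * n)) x) (w : κ → TangentSpace (𝓡 (2 * n)) x) :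
    g.inner x (∑ i, a i • u i) (∑ j, b j • w j) = ∑ i, ∑ j, a i * b j * g.inner x (u i) (w j) := by
  rw [map_sum, Finset.sum_comm]
  refine Finset.sum_congr rfl fun j _ => ?_
  rw [map_smul, map_sum, sum_apply, Finset.smul_sum]
  refine Finset.sum_congr rfl fun i _ => ?_
  rw [map_smul, smul_apply, smul_eq_mul, smul_eq_mul]
  ring

/-- The quadratic form at `c` is the squared length of the fundamental vector of `∑ c i • b i`,
which is non-zero when the orbit is locally free. -/
theorem gram_posDef {𝔥 : Submodule ℝ (Fin n → ℝ)} {x : M}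
    (h : ∀ v ∈ 𝔥, A.field v x = 0 → v = 0) : (gram A g 𝔥 x).PosDef := by
  refine Matrix.PosDef.of_dotProduct_mulVec_pos ?_ ?_
  · ext i j
    simp [gram_symm 𝔥 x i j]
  · intro c hc
    set v : 𝔥 := ∑ i, c i • Module.finBasis ℝ 𝔥 i with hv
    have hv0 : v ≠ 0 := by
      intro h0
      apply hc
      funext i
      have := Fintype.linearIndependent_iff.1 (Module.finBasis ℝ 𝔥).linearIndependent c h0 i
      simpa using this
    have hf : A.field (v : Fin n → ℝ) x ≠ 0 := by
      intro h0
      exact hv0 (Subtype.ext (h v v.2 h0))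
    have hp := g.pos x _ hf
    have e : A.field (v : Fin n → ℝ) x = ∑ i, c i • A.field (Module.finBasis ℝ 𝔥 i) x := by
      rw [hv, Submodule.coe_sum]
      exact A.field_sum c (fun i => (Module.finBasis ℝ 𝔥 i : Fin n → ℝ)) x
    rw [e] at hp
    refine lt_of_lt_of_eq hp ?_
    rw [inner_sum_sum]
    simp only [dotProduct, Matrix.mulVec, gram, Matrix.of_apply, Pi.star_apply, star_trivial,
      Finset.mul_sum]
    refine Finset.sum_congr rfl fun i _ => Finset.sum_congr rfl fun j _ => ?_
    ring

end Gram

end Action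

end

/-! ### Smooth sections, the lift of the action and Lie derivatives. -/

section

variable {n : ℕ} {M : Type*} [TopologicalSpace M] [ChartedSpace (Model n) M]

section Sections

variable {F : Type*} [NormedAddCommGroup F] [NormedSpace ℂ F]
  {W : M → Type*} [∀ x, NormedAddCommGroup (W x)] [∀ x, InnerProductSpace ℂ (W x)]
  [TopologicalSpace (TotalSpace F W)] [FiberBundle F W] [VectorBundle ℝ F W]

theorem finiteDimensional_fiber [FiniteDimensional ℂ F] [VectorBundle ℂ F W] (x : M) :
    FiniteDimensional ℂ (W x) :=
  ((trivializationAt F W x).continuousLinearEquivAt ℂ x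
    (mem_baseSet_trivializationAt F W x)).symm.toLinearEquiv.finiteDimensional

theorem finrank_fiber [VectorBundle ℂ F W] (x : M) :
    Module.finrank ℂ (W x) = Module.finrank ℂ F :=
  ((trivializationAt F W x).continuousLinearEquivAt ℂ x
    (mem_baseSet_trivializationAt F W x)).toLinearEquiv.finrank_eq

variable [IsManifold (𝓡 (2 * n)) ∞ M] [ContMDiffVectorBundle ∞ F W (𝓡 (2 * n))]

theorem IsSmoothSection.add {s s' : ∀ x : M, W x} (hs : IsSmoothSection n F s)
    (hs' : IsSmoothSection n F s') : IsSmoothSection n F (fun x => s x + s' x) :=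
  ContMDiff.add_section hs hs'

theorem IsSmoothSection.sum {ι : Type*} (J : Finset ι) {s : ι → ∀ x : M, W x}
    (hs : ∀ i ∈ J, IsSmoothSection n F (s i)) : IsSmoothSection n F (fun x => ∑ i ∈ J, s i x) :=
  ContMDiff.sum_section hs

theorem contMDiffAt_smul_section [VectorBundle ℂ F W] {f : M → ℂ} {s : ∀ x : M, W x} {x₀ : M}
    (hf : ContMDiffAt (𝓡 (2 * n)) 𝓘(ℝ, ℂ) ∞ f x₀)
    (hs : ContMDiffAt (𝓡 (2 * n)) ((𝓡 (2 * n)).prod 𝓘(ℝ, F)) ∞ (fun x => TotalSpace.mk' F x (s x)) x₀) :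
    ContMDiffAt (𝓡 (2 * n)) ((𝓡 (2 * n)).prod 𝓘(ℝ, F)) ∞
      (fun x => TotalSpace.mk' F x (f x • s x)) x₀ := by
  rw [contMDiffAt_section] at hs ⊢
  have h1 : ContMDiffAt (𝓡 (2 * n)) 𝓘(ℝ, F) ∞
      (fun x => f x • (trivializationAt F W x₀ ⟨x, s x⟩).2) x₀ := by
    have hB : ContDiff ℝ ∞ (fun q : ℂ × F => q.1 • q.2) := contDiff_smul
    exact hB.contMDiff.contMDiffAt.comp x₀ (hf.prodMk_space hs)
  refine h1.congr_of_eventuallyEq ?_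
  filter_upwards [(trivializationAt F W x₀).open_baseSet.mem_nhds
    (mem_baseSet_trivializationAt F W x₀)] with x hx
  exact ((trivializationAt F W x₀).linear ℂ hx).2 _ _

theorem IsSmoothSection.smul [VectorBundle ℂ F W] {f : M → ℂ}
    (hf : ContMDiff (𝓡 (2 * n)) 𝓘(ℝ, ℂ) ∞ f) {s : ∀ x : M, W x}
    (hs : IsSmoothSection n F s) : IsSmoothSection n F (fun x => f x • s x) :=
  fun x => contMDiffAt_smul_section (hf x) (hs x)

/-- A section that is smooth near a point agrees near that point with a smooth section. -/
theorem exists_isSmoothSection_eventuallyEq [T2Space M] {s : ∀ x : M, W x} {x₀ : M}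
    (hs : ∀ᶠ x in 𝓝 x₀, ContMDiffAt (𝓡 (2 * n)) ((𝓡 (2 * n)).prod 𝓘(ℝ, F)) ∞
      (fun x => TotalSpace.mk' F x (s x)) x) :
    ∃ s' : ∀ x : M, W x, IsSmoothSection n F s' ∧ ∀ᶠ x in 𝓝 x₀, s' x = s x := by
  obtain ⟨U, hU, hUo, hxU⟩ := eventually_nhds_iff.1 hs
  obtain ⟨f, -, hf⟩ := (SmoothBumpFunction.nhds_basis_tsupport (I := 𝓡 (2 * n)) x₀).mem_iff.1
    (hUo.mem_nhds hxU)
  refine ⟨fun x => f x • s x, ?_, ?_⟩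
  · exact ContMDiffOn.smul_section_of_tsupport f.contMDiff.contMDiffOn hUo hf
      (fun x hx => (hU x hx).contMDiffWithinAt)
  · filter_upwards [f.eventuallyEq_one] with x hx
    rw [hx]; exact one_smul ℝ _

theorem exists_isSmoothSection_apply [T2Space M] (x₀ : M) (ξ : W x₀) :
    ∃ s : ∀ x : M, W x, IsSmoothSection n F s ∧ s x₀ = ξ := by
  obtain ⟨U, hU, hs⟩ := FiberBundle.exists_contMDiffOn_extend (k := ∞) (𝓡 (2 * n)) F ξ
  obtain ⟨s', hs', h⟩ := exists_isSmoothSection_eventuallyEq (F := F) (x₀ := x₀)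
    (s := FiberBundle.extend F ξ) (by
      filter_upwards [eventually_eventually_nhds.2 hU] with x hx
      exact hs.contMDiffAt hx)
  refine ⟨s', hs', ?_⟩
  rw [h.self_of_nhds]
  simp

/-- A smooth function near a point agrees near that point with a smooth function. -/
theorem exists_contMDiff_eventuallyEq [T2Space M] {E : Type*} [NormedAddCommGroup E]
    [NormedSpace ℝ E] {h : M → E} {x₀ : M}
    (hh : ∀ᶠ x in 𝓝 x₀, ContMDiffAt (𝓡 (2 * n)) 𝓘(ℝ, E) ∞ h x) :
    ∃ h' : M → E, ContMDiff (𝓡 (2 * n)) 𝓘(ℝ, E) ∞ h' ∧ ∀ᶠ x in 𝓝 x₀, h' x = h x := by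
  obtain ⟨U, hU, hUo, hxU⟩ := eventually_nhds_iff.1 hh
  obtain ⟨f, -, hf⟩ := (SmoothBumpFunction.nhds_basis_tsupport (I := 𝓡 (2 * n)) x₀).mem_iff.1
    (hUo.mem_nhds hxU)
  refine ⟨fun x => f x • h x, ?_, ?_⟩
  · refine contMDiff_of_tsupport fun x hx => ?_
    have hx' : x ∈ tsupport f := closure_mono (fun y hy => by
      simp only [Function.mem_support] at hy ⊢
      intro h0; apply hy; simp [h0]) hx
    exact f.contMDiffAt.smul (hU x (hf hx'))
  · filter_upwards [f.eventuallyEq_one] with x hx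
    rw [hx]; exact one_smul ℝ _

end Sections

section Lift

variable {F : Type*} [NormedAddCommGroup F] [NormedSpace ℂ F]
  {W : M → Type*} [∀ x, NormedAddCommGroup (W x)] [∀ x, InnerProductSpace ℂ (W x)]
  [TopologicalSpace (TotalSpace F W)] [FiberBundle F W] [VectorBundle ℝ F W]
  {A : TorusAction n M} (R : EquivariantHermitian A F W)

namespace EquivariantHermitian

theorem heq_lift_add (v w : Fin n → ℝ) (x : M) (ξ : W x) :
    HEq (R.lift (v + w) x ξ) (R.lift v (A.act w x) (R.lift w x ξ)) := by
  exact (TotalSpace.ext_iff.1 (R.lift_add v w x ξ)).2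

/-- The two fibres lie over points that are equal only propositionally; comparing elements of the
total space avoids a transport. -/
theorem mk_lift_neg (v : Fin n → ℝ) (x : M) (ξ : W x) :
    TotalSpace.mk' F (A.act (-v) (A.act v x)) (R.lift (-v) (A.act v x) (R.lift v x ξ)) =
      TotalSpace.mk' F x ξ := by
  rw [← R.lift_add]
  exact R.lift_lattice _ (by rw [neg_add_cancel]; exact TorusAction.zero_mem_lattice) x ξ

/-- The section `s` along the orbit of `x`, transported back to `x`. -/
def orbitMap (s : ∀ x : M, W x) (x : M) (v : Fin n → ℝ) : W x := (R.lift v x).symm (s (A.act v x))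

variable [IsManifold (𝓡 (2 * n)) ∞ M] [ContMDiffVectorBundle ∞ F W (𝓡 (2 * n))]

/-- Smoothness is part of the data for `lift` only, but the inverse of `lift v` is `lift (-v)` on
the fibre over the translated point, so it is inherited. -/
theorem contMDiff_mk_orbitMap {s : ∀ x : M, W x} (hs : IsSmoothSection n F s) :
    ContMDiff (𝓘(ℝ, Fin n → ℝ).prod (𝓡 (2 * n))) ((𝓡 (2 * n)).prod 𝓘(ℝ, F)) ∞
      (fun q : (Fin n → ℝ) × M => TotalSpace.mk' F q.2 (R.orbitMap s q.2 q.1)) := by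
  have h1 : ContMDiff (𝓘(ℝ, Fin n → ℝ).prod (𝓡 (2 * n))) ((𝓡 (2 * n)).prod 𝓘(ℝ, F)) ∞
      (fun q : (Fin n → ℝ) × M => TotalSpace.mk' F (A.act q.1 q.2) (s (A.act q.1 q.2))) :=
    ContMDiff.comp hs A.smooth
  have h2 : ContMDiff (𝓘(ℝ, Fin n → ℝ).prod (𝓡 (2 * n))) 𝓘(ℝ, Fin n → ℝ) ∞
      (fun q : (Fin n → ℝ) × M => -q.1) := contDiff_neg.contMDiff.comp contMDiff_fst
  have h3 := R.smooth_lift.comp (h2.prodMk h1)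
  convert h3 using 1
  funext q
  have h4 := R.mk_lift_neg q.1 q.2 (R.orbitMap s q.2 q.1)
  rw [← h4]
  simp [orbitMap, Function.comp]

theorem contDiff_orbitMap {s : ∀ x : M, W x} (hs : IsSmoothSection n F s) (x : M) :
    ContDiff ℝ ∞ (R.orbitMap s x) := by
  have h1 : ContMDiff 𝓘(ℝ, Fin n → ℝ) ((𝓡 (2 * n)).prod 𝓘(ℝ, F)) ∞
      (fun v => TotalSpace.mk' F x (R.orbitMap s x v)) :=
    (R.contMDiff_mk_orbitMap hs).comp (contMDiff_id.prodMk contMDiff_const)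
  rw [contDiff_iff_contDiffAt]
  intro v
  have h2 := ((contMDiffAt_totalSpace).1 (h1 v)).2.contDiffAt
  set e := (trivializationAt F W x).continuousLinearEquivAt ℝ x (mem_baseSet_trivializationAt F W x)
    with he
  have h3 := e.symm.contDiff.contDiffAt.comp v h2
  convert h3 using 1
  funext w
  simp only [Function.comp]
  rw [eq_comm, e.symm_apply_eq]
  rfl

/-- In a trivialization this is the partial derivative in `τ`, at `τ = 0`, of a function that is
jointly smooth in the point and `τ`; the trivialization is linear on fibres and so commutes with
that derivative. -/
theorem contMDiff_lieDeriv {s : ∀ x : M, W x} (hs : IsSmoothSection n F s) (v : Fin n → ℝ) :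
    IsSmoothSection n F (R.lieDeriv v s) := by
  intro x₀
  rw [contMDiffAt_section]
  set e := trivializationAt F W x₀ with he
  have hx₀ : x₀ ∈ e.baseSet := mem_baseSet_trivializationAt F W x₀
  have h1 : ContMDiffAt ((𝓡 (2 * n)).prod 𝓘(ℝ, ℝ)) ((𝓡 (2 * n)).prod 𝓘(ℝ, F)) ∞
      (fun q : M × ℝ => TotalSpace.mk' F q.1 (R.orbitMap s q.1 (q.2 • v))) (x₀, 0) :=
    ((R.contMDiff_mk_orbitMap hs).comp (((contDiff_id.smul contDiff_const).contMDiff.comp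
      contMDiff_snd).prodMk contMDiff_fst)) _
  have h2 := (contMDiffAt_totalSpace.1 h1).2
  have h3 := ContMDiffAt.mfderiv (m := ∞) (n := ∞) (J := 𝓡 (2 * n)) (I := 𝓘(ℝ, ℝ)) (I' := 𝓘(ℝ, F))
    (fun (x : M) (τ : ℝ) => (e (TotalSpace.mk' F x (R.orbitMap s x (τ • v)))).2) (fun _ => (0 : ℝ))
    h2 contMDiffAt_const (by simp)
  erw [inTangentCoordinates_model_space (I := 𝓘(ℝ, ℝ)) (I' := 𝓘(ℝ, F))] at h3
  have h4 := h3.clm_apply (contMDiffAt_const (c := (1 : ℝ)))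
  refine h4.congr_of_eventuallyEq ?_
  filter_upwards [e.open_baseSet.mem_nhds hx₀] with x hx
  set E := e.continuousLinearEquivAt ℝ x hx with hE
  have h5 : DifferentiableAt ℝ (fun τ : ℝ => R.orbitMap s x (τ • v)) 0 :=
    ((R.contDiff_orbitMap hs x).differentiable (by simp) _).comp 0
      ((differentiableAt_id).smul_const v)
  have h6 := (E.toContinuousLinearMap.hasFDerivAt.comp_hasDerivAt (0 : ℝ) h5.hasDerivAt)
  rw [mfderiv_eq_fderiv]
  exact h6.deriv.symm

end EquivariantHermitian

end Lift

end

/-! ### The Dirac operators in the trivialization along an orbit. -/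

section

variable {n : ℕ} {M : Type*} [TopologicalSpace M] [ChartedSpace (Model n) M]

/-- An invertible linear map commutes with `deriv` even where `h` is not differentiable, both sides
being zero there. Hence the formulas along orbits below hold for arbitrary sections. -/
theorem deriv_isometryEquiv_comp {E E' : Type*} [NormedAddCommGroup E] [NormedSpace ℂ E]
    [NormedAddCommGroup E'] [NormedSpace ℂ E'] (e : E ≃ₗᵢ[ℂ] E') (h : ℝ → E) (t : ℝ) :
    deriv (fun τ => e (h τ)) t = e (deriv h t) := by
  let e' : E ≃L[ℝ] E' :=
    { e.toLinearEquiv.restrictScalars ℝ with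
      continuous_toFun := e.continuous
      continuous_invFun := e.symm.continuous }
  have := e'.comp_fderiv (f := h) (x := t)
  rw [← fderiv_apply_one_eq_deriv, ← fderiv_apply_one_eq_deriv]
  exact congrArg (fun l => l 1) this

/-- The differential operator `∑ G i j c i (∂_j + m j)` with constant coefficients, where `∂_j` is the
derivative in the direction of `b j`. -/
def constDirac {ι V E : Type*} [Fintype ι] [AddCommGroup V] [Module ℝ V] [NormedAddCommGroup E]
    [NormedSpace ℂ E] (G : Matrix ι ι ℝ) (c : ι → E →ₗ[ℂ] E) (m : ι → ℂ) (b : ι → V) (f : V → E)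
    (v : V) : E :=
  ∑ i, ∑ j, (G i j : ℂ) • c i (lineDeriv ℝ f v (b j) + m j • f v)

section Tensor

variable [IsManifold (𝓡 (2 * n)) ∞ M] {X : ToricOrigami n M} {g : Metric n M}
  {FW : Type*} [NormedAddCommGroup FW] [NormedSpace ℂ FW]
  {W : M → Type*} [∀ x, NormedAddCommGroup (W x)] [∀ x, InnerProductSpace ℂ (W x)]
  [TopologicalSpace (TotalSpace FW W)] [FiberBundle FW W] [VectorBundle ℝ FW W]
  {L : M → Type*} [∀ x, NormedAddCommGroup (L x)] [∀ x, InnerProductSpace ℂ (L x)]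
  [TopologicalSpace (TotalSpace ℂ L)] [FiberBundle ℂ L] [VectorBundle ℝ ℂ L]
  (R : CliffordBundle X.toTorusAction g FW W) (P : Prequantization X L)

theorem inner_tensorLift (v : Fin n → ℝ) (x : M) (ξ η : W x ⊗[ℂ] L x) :
    inner ℂ (tensorLift R P v x ξ) (tensorLift R P v x η) = inner ℂ ξ η :=
  (TensorProduct.congrIsometry (R.lift v x) (P.lift v x)).inner_map_map ξ η

theorem deriv_tensorLift {x : M} (v : Fin n → ℝ) (h : ℝ → W x ⊗[ℂ] L x) (t : ℝ) :
    deriv (fun τ => tensorLift R P v x (h τ)) t = tensorLift R P v x (deriv h t) :=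
  deriv_isometryEquiv_comp (TensorProduct.congrIsometry (R.lift v x) (P.lift v x)) h t

/-- The cocycle identities of the lifts relate fibres over propositionally equal points. They pass
to `W ⊗ L` as heterogeneous equalities, by identifying the points first. -/
theorem heq_tensorMap_of_heq
    {x y z : M} (e : y = z) (a : W x →ₗ[ℂ] W y) (a' : W x →ₗ[ℂ] W z)
    (b : L x →ₗ[ℂ] L y) (b' : L x →ₗ[ℂ] L z) (ha : ∀ ξ, HEq (a ξ) (a' ξ)) (hb : ∀ ξ, HEq (b ξ) (b' ξ))
    (ζ : W x ⊗[ℂ] L x) : HEq (TensorProduct.map a b ζ) (TensorProduct.map a' b' ζ) := by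
  subst e
  have h1 : a = a' := LinearMap.ext fun ξ => eq_of_heq (ha ξ)
  have h2 : b = b' := LinearMap.ext fun ξ => eq_of_heq (hb ξ)
  rw [h1, h2]

theorem heq_tensorLift_add (v w : Fin n → ℝ) (x : M) (ζ : W x ⊗[ℂ] L x) :
    HEq (tensorLift R P (v + w) x ζ) (tensorLift R P v (X.act w x) (tensorLift R P w x ζ)) := by
  have h := heq_tensorMap_of_heq (W := W) (L := L) (X.act_add v w x)
    ((R.lift (v + w) x).toLinearEquiv : W x →ₗ[ℂ] _)
    (((R.lift v (X.act w x)).toLinearEquiv : W (X.act w x) →ₗ[ℂ] W (X.act v (X.act w x))) ∘ₗ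
      ((R.lift w x).toLinearEquiv : W x →ₗ[ℂ] W (X.act w x)))
    ((P.lift (v + w) x).toLinearEquiv : L x →ₗ[ℂ] _)
    (((P.lift v (X.act w x)).toLinearEquiv : L (X.act w x) →ₗ[ℂ] L (X.act v (X.act w x))) ∘ₗ
      ((P.lift w x).toLinearEquiv : L x →ₗ[ℂ] L (X.act w x)))
    (fun ξ => R.heq_lift_add v w x ξ) (fun ξ => P.heq_lift_add v w x ξ) ζ
  rw [TensorProduct.map_comp] at h
  exact h

theorem heq_tensorLift_zero (x : M) (ζ : W x ⊗[ℂ] L x) :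
    HEq (tensorLift R P 0 x ζ) ζ := by
  have h := heq_tensorMap_of_heq (W := W) (L := L) (X.act_zero x)
    ((R.lift 0 x).toLinearEquiv : W x →ₗ[ℂ] _) LinearMap.id
    ((P.lift 0 x).toLinearEquiv : L x →ₗ[ℂ] _) LinearMap.id
    (fun ξ => (TotalSpace.ext_iff.1 (R.lift_lattice 0 TorusAction.zero_mem_lattice x ξ)).2)
    (fun ξ => (TotalSpace.ext_iff.1 (P.lift_lattice 0 TorusAction.zero_mem_lattice x ξ)).2) ζ
  rw [TensorProduct.map_id] at h
  exact h

/-- The section `s` of `W ⊗ L` along the orbit of `x`, transported back to `x`. -/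
def tensorOrbit (s : ∀ x : M, W x ⊗[ℂ] L x) (x : M) (v : Fin n → ℝ) : W x ⊗[ℂ] L x :=
  (tensorLift R P v x).symm (s (X.act v x))

theorem tensorLift_tensorOrbit (s : ∀ x : M, W x ⊗[ℂ] L x) (x : M) (v : Fin n → ℝ) :
    tensorLift R P v x (tensorOrbit R P s x v) = s (X.act v x) :=
  (tensorLift R P v x).apply_symm_apply _

theorem tensorOrbit_zero (s : ∀ x : M, W x ⊗[ℂ] L x) (x : M) : tensorOrbit R P s x 0 = s x := by
  have h := heq_tensorLift_zero R P x (tensorOrbit R P s x 0)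
  rw [tensorLift_tensorOrbit] at h
  have e : HEq (s (X.act 0 x)) (s x) := by rw [X.act_zero]
  exact eq_of_heq (h.symm.trans e)

/-- Changing the base point within an orbit translates the trivialized section and applies a fixed
isometry of fibres; an operator with constant coefficients does not notice either change. -/
theorem tensorOrbit_act (s : ∀ x : M, W x ⊗[ℂ] L x) (x : M) (v w : Fin n → ℝ) :
    tensorOrbit R P s (X.act w x) v = tensorLift R P w x (tensorOrbit R P s x (v + w)) := by
  have h := heq_tensorLift_add R P v w x (tensorOrbit R P s x (v + w))
  rw [tensorLift_tensorOrbit] at h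
  have e : HEq (s (X.act (v + w) x)) (s (X.act v (X.act w x))) := by rw [X.act_add]
  have h2 := eq_of_heq (e.symm.trans h)
  rw [tensorOrbit, h2, LinearEquiv.symm_apply_apply]

theorem tensorLift_cliff (v : Fin n → ℝ) (x : M) (u : TangentSpace (𝓡 (2 * n)) x)
    (ξ : W x ⊗[ℂ] L x) :
    tensorLift R P v x (cliff R L x u ξ) =
      cliff R L (X.act v x) (X.push v x u) (tensorLift R P v x ξ) := by
  induction ξ with
  | zero => simp
  | add a b ha hb => simp only [map_add, ha, hb]
  | tmul a b =>
    simp only [tensorLift, cliff, TensorProduct.congr_tmul, LinearMap.rTensor_tmul]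
    congr 1
    exact R.c_equivariant v x u a

theorem tensorLift_gradeTensor (v : Fin n → ℝ) (x : M) (ξ : W x ⊗[ℂ] L x) :
    tensorLift R P v x (gradeTensor R L x ξ) =
      gradeTensor R L (X.act v x) (tensorLift R P v x ξ) := by
  induction ξ with
  | zero => simp
  | add a b ha hb => simp only [map_add, ha, hb]
  | tmul a b =>
    simp only [tensorLift, gradeTensor, TensorProduct.congr_tmul, LinearMap.rTensor_tmul]
    congr 1
    exact R.grade_equivariant v x a

theorem gradeTensor_cliff (x : M) (u : TangentSpace (𝓡 (2 * n)) x) (ξ : W x ⊗[ℂ] L x) :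
    gradeTensor R L x (cliff R L x u ξ) = -cliff R L x u (gradeTensor R L x ξ) := by
  induction ξ with
  | zero => simp
  | add a b ha hb => simp only [map_add, ha, hb, neg_add]
  | tmul a b =>
    simp only [cliff, gradeTensor, LinearMap.rTensor_tmul, R.grade_c, TensorProduct.neg_tmul]

/-- Polarization of the Clifford relation. -/
theorem c_anticomm (x : M) (u w : TangentSpace (𝓡 (2 * n)) x) (ξ : W x) :
    R.c x u (R.c x w ξ) + R.c x w (R.c x u ξ) = (-(2 * (g.inner x u w : ℝ)) : ℂ) • ξ := by
  have h := R.c_sq x (u + w) ξ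
  have hu := R.c_sq x u ξ
  have hw := R.c_sq x w ξ
  have hs := g.symm x u w
  simp only [map_add, LinearMap.add_apply, add_apply] at h
  rw [hu, hw, ← hs] at h
  have : R.c x u (R.c x w ξ) + R.c x w (R.c x u ξ) =
      (-((g.inner x u u : ℝ) : ℂ) • ξ + R.c x w (R.c x u ξ) +
        (R.c x u (R.c x w ξ) + -((g.inner x w w : ℝ) : ℂ) • ξ)) +
        ((g.inner x u u : ℝ) : ℂ) • ξ + ((g.inner x w w : ℝ) : ℂ) • ξ := by
    simp only [neg_smul]; abel
  rw [this, h]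
  push_cast
  module

theorem cliff_anticomm (x : M) (u w : TangentSpace (𝓡 (2 * n)) x) (ξ : W x ⊗[ℂ] L x) :
    cliff R L x u (cliff R L x w ξ) + cliff R L x w (cliff R L x u ξ) =
      (-(2 * (g.inner x u w : ℝ)) : ℂ) • ξ := by
  induction ξ with
  | zero => simp
  | add a b ha hb =>
    simp only [map_add, smul_add] at ha hb ⊢
    rw [← ha, ← hb]; abel
  | tmul a b =>
    simp only [cliff, LinearMap.rTensor_tmul]
    rw [← TensorProduct.add_tmul, c_anticomm, TensorProduct.smul_tmul']

theorem inner_cliff (x : M) (u : TangentSpace (𝓡 (2 * n)) x) (ξ η : W x ⊗[ℂ] L x) :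
    inner ℂ (cliff R L x u ξ) η = -inner ℂ ξ (cliff R L x u η) := by
  induction ξ with
  | zero => simp
  | add a b ha hb => simp only [map_add, inner_add_left, ha, hb]; ring
  | tmul a b =>
    induction η with
    | zero => simp
    | add c d hc hd => simp only [map_add, inner_add_right, hc, hd]; ring
    | tmul c d =>
      simp only [cliff, LinearMap.rTensor_tmul, TensorProduct.inner_tmul, R.c_skew]
      ring

/-- The Dirac operator along the orbits, in the trivialization along the orbit of `x`: a differential
operator with constant coefficients on a vector space in which the `b i` correspond to the basis of
`𝔥`. -/
def modelDirac (𝔥 : Submodule ℝ (Fin n → ℝ)) (x : M) {V : Type*} [AddCommGroup V] [Module ℝ V]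
    (b : Fin (Module.finrank ℝ 𝔥) → V) (f : V → W x ⊗[ℂ] L x) (v : V) : W x ⊗[ℂ] L x :=
  constDirac (gram X.toTorusAction g 𝔥 x)⁻¹
    (fun i => cliff R L x (X.field (Module.finBasis ℝ 𝔥 i) x))
    (fun j => 2 * Real.pi * Complex.I * (X.μ x ⬝ᵥ (Module.finBasis ℝ 𝔥 j : Fin n → ℝ) : ℝ)) b f v

section Potential

variable [T2Space M] [VectorBundle ℂ ℂ L] [ContMDiffVectorBundle ∞ ℂ L (𝓡 (2 * n))]

theorem exists_isSmoothSection_ne_zero (L : M → Type*) [∀ x, NormedAddCommGroup (L x)]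
    [∀ x, InnerProductSpace ℂ (L x)] [TopologicalSpace (TotalSpace ℂ L)] [FiberBundle ℂ L]
    [VectorBundle ℝ ℂ L] [VectorBundle ℂ ℂ L] [ContMDiffVectorBundle ∞ ℂ L (𝓡 (2 * n))] (x : M) :
    ∃ l : ∀ x : M, L x, IsSmoothSection n ℂ l ∧ l x ≠ 0 := by
  have h1 : Module.finrank ℂ (L x) = 1 := by
    rw [finrank_fiber (F := ℂ) (W := L)]; simp
  have : Nontrivial (L x) := Module.nontrivial_of_finrank_pos (R := ℂ) (by omega)
  obtain ⟨ξ, hξ⟩ := exists_ne (0 : L x)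
  obtain ⟨l, hl, e⟩ := exists_isSmoothSection_apply (n := n) (F := ℂ) x ξ
  exact ⟨l, hl, by rwa [e]⟩

/-- Kostant's condition provides a scalar, and a section that does not vanish at `x` shows that no
other scalar works, so the choice in the definition is immaterial. -/
theorem potential_eq (v : Fin n → ℝ) (x : M) :
    potential P v x = 2 * Real.pi * Complex.I * (X.μ x ⬝ᵥ v : ℝ) := by
  have h : ∃ k : ℂ, ∀ σ : ∀ x : M, L x, IsSmoothSection n ℂ σ →
      P.conn σ x (X.field v x) = P.lieDeriv v σ x + k • σ x :=
    ⟨_, fun σ hσ => P.kostant v σ hσ x⟩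
  obtain ⟨l, hl, hx⟩ := exists_isSmoothSection_ne_zero (n := n) L x
  rw [potential, dif_pos h]
  have h1 := h.choose_spec l hl
  rw [P.kostant v l hl x] at h1
  exact (smul_left_injective ℂ hx (add_left_cancel h1)).symm

theorem tensorLift_cliff_field (v w : Fin n → ℝ) (x : M) (ξ : W x ⊗[ℂ] L x) :
    cliff R L (X.act v x) (X.field w (X.act v x)) (tensorLift R P v x ξ) =
      tensorLift R P v x (cliff R L x (X.field w x) ξ) := by
  rw [tensorLift_cliff, X.push_field]

/-- Metric, Clifford multiplication and moment map are invariant, so transporting back to `x`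
freezes all coefficients at their values at `x`. -/
theorem leafDirac_eq (hg : IsInvariantMetric X.toTorusAction g)
    (𝔥 : Submodule ℝ (Fin n → ℝ)) (x : M)
    (σ : ∀ v : 𝔥, W (X.act v x) ⊗[ℂ] L (X.act v x)) (v : 𝔥) :
    leafDirac R P 𝔥 x σ v = tensorLift R P v x (modelDirac R 𝔥 x (Module.finBasis ℝ 𝔥)
      (fun v : 𝔥 => (tensorLift R P v x).symm (σ v)) v) := by
  unfold leafDirac modelDirac constDirac
  simp only [map_sum, map_smul, gram_act hg, potential_eq, X.moment_invariant,
    ← tensorLift_cliff_field R P, map_add, LinearEquiv.apply_symm_apply]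
  rfl

theorem orbitDirac_act (hg : IsInvariantMetric X.toTorusAction g)
    (𝔥 : Submodule ℝ (Fin n → ℝ)) (x : M) (s : ∀ x : M, W x ⊗[ℂ] L x)
    (v : Fin n → ℝ) :
    orbitDirac R P 𝔥 s (X.act v x) = tensorLift R P v x (modelDirac R 𝔥 x
      (fun i => (Module.finBasis ℝ 𝔥 i : Fin n → ℝ)) (tensorOrbit R P s x) v) := by
  unfold orbitDirac modelDirac constDirac orbitDeriv
  simp only [map_sum, map_smul, gram_act hg, potential_eq, X.moment_invariant,
    ← tensorLift_cliff_field R P, map_add, tensorLift_tensorOrbit]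
  refine Finset.sum_congr rfl fun i _ => Finset.sum_congr rfl fun j _ => ?_
  -- The derivative at the translated point becomes the derivative at `v` of the function attached
  -- to `x`, by `tensorOrbit_act`.
  have h := deriv_tensorLift R P v
    (fun τ : ℝ => tensorOrbit R P s x (v + τ • (Module.finBasis ℝ 𝔥 j : Fin n → ℝ))) 0
  congr 3
  refine Eq.trans ?_ h
  congr 1
  funext τ
  rw [add_comm v]
  exact tensorOrbit_act R P s x _ v

/-- The trivialized section is a function on all of `ℝⁿ`, not only on `𝔥`; thus the operators of
different subtori act on the same function, and their compositions are computed with constant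
coefficients. -/
theorem tensorOrbit_orbitDirac (hg : IsInvariantMetric X.toTorusAction g)
    (𝔥 : Submodule ℝ (Fin n → ℝ)) (x : M) (s : ∀ x : M, W x ⊗[ℂ] L x) :
    tensorOrbit R P (orbitDirac R P 𝔥 s) x = modelDirac R 𝔥 x
      (fun i => (Module.finBasis ℝ 𝔥 i : Fin n → ℝ)) (tensorOrbit R P s x) := by
  funext v
  rw [tensorOrbit, orbitDirac_act R P hg, LinearEquiv.symm_apply_apply]

theorem orbitDirac_eq (hg : IsInvariantMetric X.toTorusAction g)
    (𝔥 : Submodule ℝ (Fin n → ℝ)) (x : M) (s : ∀ x : M, W x ⊗[ℂ] L x) :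
    orbitDirac R P 𝔥 s x = modelDirac R 𝔥 x
      (fun i => (Module.finBasis ℝ 𝔥 i : Fin n → ℝ)) (tensorOrbit R P s x) 0 := by
  rw [← tensorOrbit_zero R P (orbitDirac R P 𝔥 s), tensorOrbit_orbitDirac R P hg]

theorem leafDirac_restrict (hg : IsInvariantMetric X.toTorusAction g)
    (𝔥 : Submodule ℝ (Fin n → ℝ)) (x : M) (s : ∀ x : M, W x ⊗[ℂ] L x) (v : 𝔥) :
    leafDirac R P 𝔥 x (fun v => s (X.act v x)) v = orbitDirac R P 𝔥 s (X.act v x) := by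
  rw [leafDirac_eq R P hg, orbitDirac_act R P hg]
  rfl

end Potential

end Tensor

end

/-! ### Algebra of Dirac operators with constant coefficients. -/

section

section ConstDirac

variable {ι κ V E : Type*} [Fintype ι] [Fintype κ] [NormedAddCommGroup V] [NormedSpace ℝ V]
  [NormedAddCommGroup E] [NormedSpace ℂ E]

/-- A complex linear map on a finite dimensional space as a real continuous linear map. -/
def realCLM [FiniteDimensional ℂ E] (T : E →ₗ[ℂ] E) : E →L[ℝ] E :=
  (LinearMap.toContinuousLinearMap T).restrictScalars ℝ

@[simp] theorem realCLM_apply [FiniteDimensional ℂ E] (T : E →ₗ[ℂ] E) (ξ : E) :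
    realCLM T ξ = T ξ := rfl

/-- The covariant derivative with constant connection form `m` in the direction of `w`. -/
def covDeriv (m : V →ₗ[ℝ] ℂ) (w : V) (f : V → E) (v : V) : E := fderiv ℝ f v w + m w • f v

theorem constDirac_eq {G : Matrix ι ι ℝ} {c : ι → E →ₗ[ℂ] E} (m : V →ₗ[ℝ] ℂ) {b : ι → V} {f : V → E}
    {v : V} (hf : DifferentiableAt ℝ f v) :
    constDirac G c (fun j => m (b j)) b f v = ∑ i, ∑ j, (G i j : ℂ) • c i (covDeriv m (b j) f v) := by
  simp only [constDirac, covDeriv, hf.lineDeriv_eq_fderiv]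

theorem contDiff_covDeriv (m : V →ₗ[ℝ] ℂ) (w : V) {f : V → E} (hf : ContDiff ℝ ∞ f) :
    ContDiff ℝ ∞ (covDeriv m w f) :=
  ((hf.fderiv_right (m := ∞) (by simp)).clm_apply contDiff_const).add (contDiff_const.smul hf)

/-- The connection is flat along the orbit: `m` is constant and second derivatives are symmetric. -/
theorem covDeriv_comm (m : V →ₗ[ℝ] ℂ) (w w' : V) {f : V → E} (hf : ContDiff ℝ ∞ f) (v : V) :
    covDeriv m w (covDeriv m w' f) v = covDeriv m w' (covDeriv m w f) v := by
  have hf1 : DifferentiableAt ℝ f v := hf.differentiable (by simp) v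
  have hf2 : DifferentiableAt ℝ (fderiv ℝ f) v :=
    (hf.fderiv_right (m := ∞) (by simp)).differentiable (by simp) v
  have hd : ∀ w : V, HasFDerivAt (covDeriv m w f)
      (((fderiv ℝ (fderiv ℝ f) v).flip w) + m w • fderiv ℝ f v) v := by
    intro w
    have h1 := hf2.hasFDerivAt.clm_apply (hasFDerivAt_const w v)
    have h2 := hf1.hasFDerivAt.const_smul (m w)
    refine (h1.add h2).congr_fderiv ?_
    ext u
    simp
  have hs : IsSymmSndFDerivAt ℝ f v :=
    (hf.contDiffAt (x := v)).isSymmSndFDerivAt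
      (by rw [minSmoothness_of_isRCLikeNormedField]; exact WithTop.coe_le_coe.2 (le_top (a := (2 : ℕ∞))))
  simp only [covDeriv] at *
  rw [(hd w').fderiv, (hd w).fderiv]
  simp only [add_apply, ContinuousLinearMap.flip_apply, smul_apply]
  rw [hs.eq w w']
  simp only [smul_add, smul_smul, mul_comm (m w') (m w)]
  abel

theorem covDeriv_sum_smul_clm [FiniteDimensional ℂ E] (m : V →ₗ[ℝ] ℂ) (w : V) (G : Matrix ι κ ℝ)
    (c : ι → E →ₗ[ℂ] E) (f : κ → V → E) (v : V) (hf : ∀ j, DifferentiableAt ℝ (f j) v) :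
    covDeriv m w (fun v => ∑ i, ∑ j, (G i j : ℂ) • c i (f j v)) v =
      ∑ i, ∑ j, (G i j : ℂ) • c i (covDeriv m w (f j) v) := by
  have h : HasFDerivAt (fun v => ∑ i, ∑ j, (G i j : ℂ) • c i (f j v))
      (∑ i, ∑ j, (G i j : ℂ) • (realCLM (c i)).comp (fderiv ℝ (f j) v)) v :=
    HasFDerivAt.fun_sum fun i _ => HasFDerivAt.fun_sum fun j _ =>
      ((realCLM (c i)).hasFDerivAt.comp v (hf j).hasFDerivAt).const_smul (G i j : ℂ)
  simp only [covDeriv, h.fderiv, sum_apply, smul_apply, ContinuousLinearMap.comp_apply, realCLM_apply,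
    map_add, smul_add, Finset.sum_add_distrib, Finset.smul_sum, map_smul]
  congr 1
  refine Finset.sum_congr rfl fun i _ => Finset.sum_congr rfl fun j _ => ?_
  rw [smul_comm]

theorem contDiff_constDirac [FiniteDimensional ℂ E] (G : Matrix ι ι ℝ) (c : ι → E →ₗ[ℂ] E)
    (m : V →ₗ[ℝ] ℂ) (b : ι → V) {f : V → E} (hf : ContDiff ℝ ∞ f) :
    ContDiff ℝ ∞ (constDirac G c (fun j => m (b j)) b f) := by
  have : constDirac G c (fun j => m (b j)) b f =
      fun v => ∑ i, ∑ j, (G i j : ℂ) • realCLM (c i) (covDeriv m (b j) f v) := by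
    funext v
    exact constDirac_eq m (hf.differentiable (by simp) v)
  rw [this]
  exact ContDiff.sum fun i _ => ContDiff.sum fun j _ => contDiff_const.smul
    ((realCLM (c i)).contDiff.comp (contDiff_covDeriv m (b j) hf))

/-- Composition of two operators with constant coefficients. -/
theorem constDirac_constDirac [FiniteDimensional ℂ E] (G : Matrix ι ι ℝ) (c : ι → E →ₗ[ℂ] E)
    (H : Matrix κ κ ℝ) (d : κ → E →ₗ[ℂ] E) (m : V →ₗ[ℝ] ℂ) (b : ι → V) (a : κ → V) {f : V → E}
    (hf : ContDiff ℝ ∞ f) (v : V) :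
    constDirac G c (fun j => m (b j)) b (constDirac H d (fun j => m (a j)) a f) v =
      ∑ i, ∑ j, ∑ k, ∑ l, ((G i j : ℂ) * (H k l : ℂ)) •
        c i (d k (covDeriv m (b j) (covDeriv m (a l) f) v)) := by
  have hD := contDiff_constDirac H d m a hf
  rw [constDirac_eq m (hD.differentiable (by simp) v)]
  refine Finset.sum_congr rfl fun i _ => Finset.sum_congr rfl fun j _ => ?_
  have e : constDirac H d (fun j => m (a j)) a f =
      fun v => ∑ k, ∑ l, (H k l : ℂ) • d k (covDeriv m (a l) f v) := by
    funext v
    exact constDirac_eq m (hf.differentiable (by simp) v)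
  rw [e, covDeriv_sum_smul_clm m (b j) H d _ v
    (fun l => (contDiff_covDeriv m (a l) hf).differentiable (by simp) v)]
  simp only [map_sum, map_smul, Finset.smul_sum, smul_smul]

/-- The anti-commutator of two operators whose symbols anti-commute up to scalars. -/
theorem constDirac_anticomm [FiniteDimensional ℂ E] (G : Matrix ι ι ℝ) (c : ι → E →ₗ[ℂ] E)
    (H : Matrix κ κ ℝ) (d : κ → E →ₗ[ℂ] E) (m : V →ₗ[ℝ] ℂ) (b : ι → V) (a : κ → V)
    (p : Matrix ι κ ℝ) (hp : ∀ i k ξ, c i (d k ξ) + d k (c i ξ) = (-(2 * (p i k : ℝ)) : ℂ) • ξ)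
    {f : V → E} (hf : ContDiff ℝ ∞ f) (v : V) :
    constDirac G c (fun j => m (b j)) b (constDirac H d (fun j => m (a j)) a f) v +
      constDirac H d (fun j => m (a j)) a (constDirac G c (fun j => m (b j)) b f) v =
    (-2 : ℂ) • ∑ j, ∑ l, ((G.transpose * p * H) j l : ℂ) •
      covDeriv m (b j) (covDeriv m (a l) f) v := by
  rw [constDirac_constDirac G c H d m b a hf, constDirac_constDirac H d G c m a b hf]
  -- The covariant derivatives of the second composition are put in the order of the first, so that
  -- only the symbols are left to anti-commute.
  have e2 : (∑ k, ∑ l, ∑ i, ∑ j, ((H k l : ℂ) * (G i j : ℂ)) •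
        d k (c i (covDeriv m (a l) (covDeriv m (b j) f) v))) =
      ∑ i, ∑ j, ∑ k, ∑ l, ((G i j : ℂ) * (H k l : ℂ)) •
        d k (c i (covDeriv m (b j) (covDeriv m (a l) f) v)) := by
    rw [Finset.sum_congr rfl fun k _ => Finset.sum_comm, Finset.sum_comm]
    refine Finset.sum_congr rfl fun i _ => ?_
    rw [Finset.sum_congr rfl fun k _ => Finset.sum_comm, Finset.sum_comm]
    refine Finset.sum_congr rfl fun j _ => Finset.sum_congr rfl fun k _ =>
      Finset.sum_congr rfl fun l _ => ?_
    rw [covDeriv_comm m _ _ hf, mul_comm]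
  rw [e2]
  simp only [← Finset.sum_add_distrib, ← smul_add, hp]
  have e3 : ∀ j l, ((G.transpose * p * H) j l : ℂ) = ∑ k, ∑ i, (G i j : ℂ) * (p i k : ℂ) * (H k l : ℂ) := by
    intro j l
    simp only [Matrix.mul_apply, Matrix.transpose_apply]
    push_cast
    simp only [Finset.sum_mul]
  simp only [e3, Finset.smul_sum, Finset.sum_smul, smul_smul]
  rw [Finset.sum_comm]
  refine Finset.sum_congr rfl fun j _ => ?_
  rw [Finset.sum_comm, Finset.sum_congr rfl fun k _ => Finset.sum_comm, Finset.sum_comm]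
  refine Finset.sum_congr rfl fun l _ => Finset.sum_congr rfl fun k _ =>
    Finset.sum_congr rfl fun i _ => ?_
  congr 1
  ring

/-- The square of an operator whose symbol satisfies the Clifford relations of the inverse matrix of
its coefficients. -/
theorem constDirac_sq [DecidableEq ι] [FiniteDimensional ℂ E] {p : Matrix ι ι ℝ} (hdet : IsUnit p.det)
    (hsymm : p.transpose = p) (c : ι → E →ₗ[ℂ] E) (m : V →ₗ[ℝ] ℂ) (b : ι → V)
    (hp : ∀ i k ξ, c i (c k ξ) + c k (c i ξ) = (-(2 * (p i k : ℝ)) : ℂ) • ξ)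
    {f : V → E} (hf : ContDiff ℝ ∞ f) (v : V) :
    constDirac p⁻¹ c (fun j => m (b j)) b (constDirac p⁻¹ c (fun j => m (b j)) b f) v =
      -∑ j, ∑ l, (p⁻¹ j l : ℂ) • covDeriv m (b j) (covDeriv m (b l) f) v := by
  have h := constDirac_anticomm p⁻¹ c p⁻¹ c m b b p hp hf v
  -- The coefficient matrix of the anti-commutator collapses; the two equal compositions give a
  -- factor `2` that cancels against the `2` of the Clifford relation.
  have e : p⁻¹.transpose * p * p⁻¹ = p⁻¹ := by
    rw [Matrix.transpose_nonsing_inv, hsymm, Matrix.nonsing_inv_mul _ hdet, one_mul]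
  rw [e, ← two_smul ℂ] at h
  have h2 : (2 : ℂ) ≠ 0 := two_ne_zero
  rw [neg_smul, ← smul_neg] at h
  exact smul_right_injective E h2 h

theorem covDeriv_sum (m : V →ₗ[ℝ] ℂ) (B : κ → ℝ) (a : κ → V) (f : V → E) (v : V) :
    covDeriv m (∑ l, B l • a l) f v = ∑ l, (B l : ℂ) • covDeriv m (a l) f v := by
  simp only [covDeriv, map_sum, map_smul, smul_add, Finset.sum_add_distrib, Finset.sum_smul]
  congr 1
  refine Finset.sum_congr rfl fun l _ => ?_
  rw [smul_smul]; rfl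

/-- If the directions of the first operator are combinations of those of the second one, then the
anti-commutator of the two operators is twice the square of the first one. -/
theorem constDirac_anticomm_of_le [DecidableEq ι] [DecidableEq κ] [FiniteDimensional ℂ E]
    {p : Matrix ι ι ℝ} (hdet : IsUnit p.det) (hsymm : p.transpose = p) {q : Matrix κ κ ℝ}
    (hdet' : IsUnit q.det) (c : ι → E →ₗ[ℂ] E) (d : κ → E →ₗ[ℂ] E) (m : V →ₗ[ℝ] ℂ) (b : ι → V)
    (a : κ → V) (B : Matrix ι κ ℝ) (hb : ∀ i, b i = ∑ l, B i l • a l)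
    (hp : ∀ i k ξ, c i (c k ξ) + c k (c i ξ) = (-(2 * (p i k : ℝ)) : ℂ) • ξ)
    (hq : ∀ i k ξ, c i (d k ξ) + d k (c i ξ) = (-(2 * ((B * q) i k : ℝ)) : ℂ) • ξ)
    {f : V → E} (hf : ContDiff ℝ ∞ f) (v : V) :
    constDirac p⁻¹ c (fun j => m (b j)) b (constDirac q⁻¹ d (fun j => m (a j)) a f) v +
      constDirac q⁻¹ d (fun j => m (a j)) a (constDirac p⁻¹ c (fun j => m (b j)) b f) v =
    (2 : ℂ) • constDirac p⁻¹ c (fun j => m (b j)) b (constDirac p⁻¹ c (fun j => m (b j)) b f) v := by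
  rw [constDirac_anticomm p⁻¹ c q⁻¹ d m b a (B * q) hq hf v, constDirac_sq hdet hsymm c m b hp hf,
    smul_neg, ← neg_smul]
  congr 1
  -- The Gram matrix `q` of the larger torus cancels, and `∑ (p⁻¹ * B) j l • a l = ∑ p⁻¹ j i • b i`:
  -- only the Laplacian of the smaller torus survives.
  have e : p⁻¹.transpose * (B * q) * q⁻¹ = p⁻¹ * B := by
    rw [Matrix.transpose_nonsing_inv, hsymm, ← Matrix.mul_assoc, Matrix.mul_nonsing_inv_cancel_right _ _ hdet']
  rw [e]
  refine Finset.sum_congr rfl fun j _ => ?_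
  have h1 : ∀ i, covDeriv m (b j) (covDeriv m (b i) f) v =
      ∑ l, (B i l : ℂ) • covDeriv m (b j) (covDeriv m (a l) f) v := by
    intro i
    rw [covDeriv_comm m _ _ hf, hb i, covDeriv_sum]
    exact Finset.sum_congr rfl fun l _ => by rw [covDeriv_comm m _ _ hf]
  simp only [h1, Finset.smul_sum, smul_smul]
  rw [Finset.sum_comm]
  refine Finset.sum_congr rfl fun l _ => ?_
  rw [← Finset.sum_smul]
  congr 1
  simp only [Matrix.mul_apply]
  push_cast
  rfl

/-- A constant `T` commutes with the derivatives, so the sign comes from the symbol alone. It serves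
for the grading and for the Clifford multiplication by normal vectors. -/
theorem constDirac_comp_anticomm [FiniteDimensional ℂ E] (G : Matrix ι ι ℝ) (c : ι → E →ₗ[ℂ] E)
    (m : ι → ℂ) (b : ι → V) (T : E →ₗ[ℂ] E) (hT : ∀ i ξ, T (c i ξ) = -c i (T ξ)) {f : V → E} {v : V}
    (hf : DifferentiableAt ℝ f v) :
    constDirac G c m b (fun v => T (f v)) v = -T (constDirac G c m b f v) := by
  have h : HasFDerivAt (fun v => T (f v)) ((realCLM T).comp (fderiv ℝ f v)) v :=
    (realCLM T).hasFDerivAt.comp v hf.hasFDerivAt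
  simp only [constDirac, hf.lineDeriv_eq_fderiv, h.differentiableAt.lineDeriv_eq_fderiv, h.fderiv,
    ContinuousLinearMap.comp_apply, realCLM_apply, map_sum, map_smul, hT, ← Finset.sum_neg_distrib,
    smul_neg, map_add]
  refine Finset.sum_congr rfl fun i _ => Finset.sum_congr rfl fun j _ => ?_
  rw [← neg_add, smul_neg, neg_neg]

theorem constDirac_smul (G : Matrix ι ι ℝ) (c : ι → E →ₗ[ℂ] E) (m : ι → ℂ) (b : ι → V)
    {φ : V → ℝ} {f : V → E} {v : V} (hφ : DifferentiableAt ℝ φ v) (hf : DifferentiableAt ℝ f v) :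
    constDirac G c m b (fun v => (φ v : ℂ) • f v) v = (φ v : ℂ) • constDirac G c m b f v +
      ∑ i, ∑ j, ((G i j * fderiv ℝ φ v (b j) : ℝ) : ℂ) • c i (f v) := by
  have h : HasFDerivAt (fun v => φ v • f v) _ v := hφ.hasFDerivAt.smul hf.hasFDerivAt
  have h' : HasFDerivAt (fun v => (φ v : ℂ) • f v) _ v := h
  simp only [constDirac, hf.lineDeriv_eq_fderiv, h'.differentiableAt.lineDeriv_eq_fderiv, h'.fderiv,
    Finset.smul_sum, ← Finset.sum_add_distrib]
  refine Finset.sum_congr rfl fun i _ => Finset.sum_congr rfl fun j _ => ?_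
  have e : (φ v • fderiv ℝ f v + (fderiv ℝ φ v).smulRight (f v)) (b j) =
      (φ v : ℂ) • fderiv ℝ f v (b j) + ((fderiv ℝ φ v (b j) : ℝ) : ℂ) • f v := rfl
  rw [e]
  simp only [map_add, map_smul, smul_add, smul_smul]
  push_cast
  rw [mul_comm (φ v : ℂ) (G i j : ℂ), mul_comm (m j)]
  module

end ConstDirac

end

/-! ### Symbol, parity and anti-commutation with normal vectors. -/

section

theorem isBoundedBilinearMap_tmul (E F : Type*) [NormedAddCommGroup E] [InnerProductSpace ℂ E]
    [NormedAddCommGroup F] [InnerProductSpace ℂ F] :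
    IsBoundedBilinearMap ℝ (fun q : E × F => q.1 ⊗ₜ[ℂ] q.2) where
  add_left a b c := TensorProduct.add_tmul a b c
  smul_left r a b := (TensorProduct.smul_tmul' (r : ℂ) a b).symm
  add_right a b c := TensorProduct.tmul_add a b c
  smul_right r a b := TensorProduct.tmul_smul (r : ℂ) a b
  bound := ⟨1, one_pos, fun a b => by rw [TensorProduct.norm_tmul, one_mul]⟩

variable {n : ℕ} {M : Type*} [TopologicalSpace M] [ChartedSpace (Model n) M]
  [IsManifold (𝓡 (2 * n)) ∞ M] {X : ToricOrigami n M} {g : Metric n M}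

/-- The connection form of `L` along the orbit of `x`. -/
def momentForm (X : ToricOrigami n M) (x : M) : (Fin n → ℝ) →ₗ[ℝ] ℂ where
  toFun v := 2 * Real.pi * Complex.I * (X.μ x ⬝ᵥ v : ℝ)
  map_add' v w := by rw [dotProduct_add]; push_cast; ring
  map_smul' c v := by rw [dotProduct_smul, smul_eq_mul, RingHom.id_apply, Complex.real_smul]; push_cast; ring

@[simp] theorem momentForm_apply (x : M) (v : Fin n → ℝ) :
    momentForm X x v = 2 * Real.pi * Complex.I * (X.μ x ⬝ᵥ v : ℝ) := rfl

theorem finiteDimensional_tensor (FW : Type*) [NormedAddCommGroup FW] [NormedSpace ℂ FW]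
    [FiniteDimensional ℂ FW] {W : M → Type*} [∀ x, NormedAddCommGroup (W x)]
    [∀ x, InnerProductSpace ℂ (W x)] [TopologicalSpace (TotalSpace FW W)] [FiberBundle FW W]
    [VectorBundle ℝ FW W] [VectorBundle ℂ FW W] {L : M → Type*} [∀ x, NormedAddCommGroup (L x)]
    [∀ x, InnerProductSpace ℂ (L x)] [TopologicalSpace (TotalSpace ℂ L)] [FiberBundle ℂ L]
    [VectorBundle ℝ ℂ L] [VectorBundle ℂ ℂ L] (x : M) : FiniteDimensional ℂ (W x ⊗[ℂ] L x) := by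
  have := finiteDimensional_fiber (F := FW) (W := W) x
  have := finiteDimensional_fiber (F := ℂ) (W := L) x
  infer_instance

variable {FW : Type*} [NormedAddCommGroup FW] [NormedSpace ℂ FW] [FiniteDimensional ℂ FW]
  {W : M → Type*} [∀ x, NormedAddCommGroup (W x)] [∀ x, InnerProductSpace ℂ (W x)]
  [TopologicalSpace (TotalSpace FW W)] [FiberBundle FW W] [VectorBundle ℝ FW W]
  [VectorBundle ℂ FW W] [ContMDiffVectorBundle ∞ FW W (𝓡 (2 * n))]
  {L : M → Type*} [∀ x, NormedAddCommGroup (L x)] [∀ x, InnerProductSpace ℂ (L x)]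
  [TopologicalSpace (TotalSpace ℂ L)] [FiberBundle ℂ L] [VectorBundle ℝ ℂ L]
  [VectorBundle ℂ ℂ L] [ContMDiffVectorBundle ∞ ℂ L (𝓡 (2 * n))]
  (R : CliffordBundle X.toTorusAction g FW W) (P : Prequantization X L)

theorem tensorLift_symm_tmul (v : Fin n → ℝ) (x : M) (a : W (X.act v x)) (b : L (X.act v x)) :
    (tensorLift R P v x).symm (a ⊗ₜ[ℂ] b) = (R.lift v x).symm a ⊗ₜ[ℂ] (P.lift v x).symm b := by
  rw [LinearEquiv.symm_apply_eq]
  simp [tensorLift]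

theorem contDiff_tensorOrbit {s : ∀ x : M, W x ⊗[ℂ] L x} (hs : IsSmoothTensor n FW s) (x : M) :
    ContDiff ℝ ∞ (tensorOrbit R P s x) := by
  rw [contDiff_iff_contDiffAt]
  intro v
  obtain ⟨w, l, hw, hl, h⟩ := hs (X.act v x)
  have h1 : ContDiff ℝ ∞ (fun v => (R.orbitMap w x v) ⊗ₜ[ℂ] (P.orbitMap l x v)) :=
    (isBoundedBilinearMap_tmul (W x) (L x)).contDiff.comp
      ((R.contDiff_orbitMap hw x).prodMk (P.contDiff_orbitMap hl x))
  refine h1.contDiffAt.congr_of_eventuallyEq ?_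
  have hc : ContinuousAt (fun v => X.act v x) v := (X.contMDiff_orbit x).continuous.continuousAt
  filter_upwards [hc.eventually h] with u hu
  rw [tensorOrbit, hu, tensorLift_symm_tmul]
  rfl

variable [T2Space M]

theorem orbitDirac_smul (hg : IsInvariantMetric X.toTorusAction g)
    (𝔥 : Submodule ℝ (Fin n → ℝ)) {s : ∀ x : M, W x ⊗[ℂ] L x}
    (hs : IsSmoothTensor n FW s) {f : M → ℝ} (hf : ContMDiff (𝓡 (2 * n)) 𝓘(ℝ, ℝ) ∞ f) (x : M) :
    orbitDirac R P 𝔥 (fun y => (f y : ℂ) • s y) x = (f x : ℂ) • orbitDirac R P 𝔥 s x +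
      ∑ a, ∑ b, ((((gram X.toTorusAction g 𝔥 x)⁻¹ a b *
          differential n f x (X.field (Module.finBasis ℝ 𝔥 b) x) : ℝ)) : ℂ) •
        cliff R L x (X.field (Module.finBasis ℝ 𝔥 a) x) (s x) := by
  rw [orbitDirac_eq R P hg, orbitDirac_eq R P hg]
  have e : tensorOrbit R P (fun y => (f y : ℂ) • s y) x =
      fun v => ((f (X.act v x) : ℝ) : ℂ) • tensorOrbit R P s x v := by
    funext v
    simp only [tensorOrbit, map_smul]
  have hφ : ContDiff ℝ ∞ (fun v => f (X.act v x)) := (hf.comp (X.contMDiff_orbit x)).contDiff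
  rw [e, modelDirac, constDirac_smul _ _ _ _ (hφ.differentiable (by simp) _)
    ((contDiff_tensorOrbit R P hs x).differentiable (by simp) _), X.act_zero, tensorOrbit_zero]
  congr 1
  refine Finset.sum_congr rfl fun i _ => Finset.sum_congr rfl fun j _ => ?_
  congr 3
  have h1 := X.hasDerivAt_comp_curve (hf.mdifferentiable (by simp) x) (Module.finBasis ℝ 𝔥 j)
  have h2 := ((hφ.differentiable (by simp) (0 : Fin n → ℝ)).hasFDerivAt.hasLineDerivAt
    (Module.finBasis ℝ 𝔥 j : Fin n → ℝ))
  unfold HasLineDerivAt at h2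
  simp only [zero_add] at h2
  exact h2.unique h1

theorem orbitDirac_gradeTensor (hg : IsInvariantMetric X.toTorusAction g)
    (𝔥 : Submodule ℝ (Fin n → ℝ)) {s : ∀ x : M, W x ⊗[ℂ] L x}
    (hs : IsSmoothTensor n FW s) (x : M) :
    orbitDirac R P 𝔥 (fun y => gradeTensor R L y (s y)) x =
      -gradeTensor R L x (orbitDirac R P 𝔥 s x) := by
  have := finiteDimensional_tensor FW (W := W) (L := L) x
  rw [orbitDirac_eq R P hg, orbitDirac_eq R P hg]
  have e : tensorOrbit R P (fun y => gradeTensor R L y (s y)) x =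
      fun v => gradeTensor R L x (tensorOrbit R P s x v) := by
    funext v
    rw [tensorOrbit, LinearEquiv.symm_apply_eq, tensorLift_gradeTensor, tensorLift_tensorOrbit]
  rw [e, modelDirac, constDirac_comp_anticomm _ _ _ _ (gradeTensor R L x)
    (fun i ξ => gradeTensor_cliff R x _ ξ)
    ((contDiff_tensorOrbit R P hs x).differentiable (by simp) _)]
  rfl

/-- The invariant extension of `u` becomes the constant `u` in the trivialization, and Clifford
multiplications by orthogonal vectors anti-commute. -/
theorem leafDirac_cliff_anticomm (hg : IsInvariantMetric X.toTorusAction g)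
    (𝔥 : Submodule ℝ (Fin n → ℝ)) (x : M)
    (u : TangentSpace (𝓡 (2 * n)) x) (hu : ∀ v ∈ 𝔥, g.inner x u (X.field v x) = 0)
    (σ : ∀ v : 𝔥, W (X.act v x) ⊗[ℂ] L (X.act v x)) (hσ : IsLeafSection R P 𝔥 x σ) (v : 𝔥) :
    leafDirac R P 𝔥 x (fun v => cliff R L (X.act v x) (X.push v x u) (σ v)) v +
      cliff R L (X.act v x) (X.push v x u) (leafDirac R P 𝔥 x σ v) = 0 := by
  have := finiteDimensional_tensor FW (W := W) (L := L) x
  rw [leafDirac_eq R P hg, leafDirac_eq R P hg]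
  have e : (fun v : 𝔥 => (tensorLift R P v x).symm (cliff R L (X.act v x) (X.push v x u) (σ v))) =
      fun v : 𝔥 => cliff R L x u ((tensorLift R P v x).symm (σ v)) := by
    funext v
    rw [LinearEquiv.symm_apply_eq, tensorLift_cliff, LinearEquiv.apply_symm_apply]
  rw [e, modelDirac, constDirac_comp_anticomm _ _ _ _ (cliff R L x u) ?_
    (hσ.1.differentiable (by simp) _), ← tensorLift_cliff, map_neg]
  · exact neg_add_cancel _
  · intro i ξ
    have h := cliff_anticomm (L := L) R x u (X.field (Module.finBasis ℝ 𝔥 i) x) ξ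
    rw [hu _ (Module.finBasis ℝ 𝔥 i).2] at h
    simp only [Complex.ofReal_zero, mul_zero, neg_zero, zero_smul] at h
    exact eq_neg_of_add_eq_zero_left h

end

/-! ### Charts and the invariance of the Riemannian measure. -/

section

variable {n : ℕ} {M : Type*} [TopologicalSpace M] [ChartedSpace (Model n) M]
  [IsManifold (𝓡 (2 * n)) ∞ M]

section Charts

theorem isOpen_chartTarget (x₀ : M) : IsOpen (extChartAt (𝓡 (2 * n)) x₀).target :=
  isOpen_extChartAt_target x₀

theorem contMDiffAt_chart_symm {x₀ : M} {y : Model n} (hy : y ∈ (extChartAt (𝓡 (2 * n)) x₀).target) :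
    ContMDiffAt 𝓘(ℝ, Model n) (𝓡 (2 * n)) ∞ (extChartAt (𝓡 (2 * n)) x₀).symm y :=
  (contMDiffOn_extChartAt_symm x₀).contMDiffAt ((isOpen_chartTarget (n := n) x₀).mem_nhds hy)

theorem mdifferentiableAt_chart_symm {x₀ : M} {y : Model n}
    (hy : y ∈ (extChartAt (𝓡 (2 * n)) x₀).target) :
    MDifferentiableAt 𝓘(ℝ, Model n) (𝓡 (2 * n)) (extChartAt (𝓡 (2 * n)) x₀).symm y :=
  (contMDiffAt_chart_symm hy).mdifferentiableAt (by simp)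

theorem contMDiffAt_chart {x₀ x : M} (hx : x ∈ (extChartAt (𝓡 (2 * n)) x₀).source) :
    ContMDiffAt (𝓡 (2 * n)) 𝓘(ℝ, Model n) ∞ (extChartAt (𝓡 (2 * n)) x₀) x :=
  contMDiffAt_extChartAt' (by simpa using hx)

theorem mdifferentiableAt_chart {x₀ x : M} (hx : x ∈ (extChartAt (𝓡 (2 * n)) x₀).source) :
    MDifferentiableAt (𝓡 (2 * n)) 𝓘(ℝ, Model n) (extChartAt (𝓡 (2 * n)) x₀) x :=
  (contMDiffAt_chart hx).mdifferentiableAt (by simp)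

theorem contMDiffAt_chartVec {x₀ : M} {y : Model n} (hy : y ∈ (extChartAt (𝓡 (2 * n)) x₀).target)
    (u : Model n) :
    ContMDiffAt 𝓘(ℝ, Model n) (𝓡 (2 * n)).tangent ∞
      (fun y => (⟨(extChartAt (𝓡 (2 * n)) x₀).symm y, chartVec x₀ y u⟩ :
        TangentBundle (𝓡 (2 * n)) M)) y := by
  have hU := (isOpen_chartTarget (n := n) x₀).uniqueMDiffOn (I := 𝓘(ℝ, Model n))
  have h1 := (contMDiffOn_extChartAt_symm (I := 𝓡 (2 * n)) (n := ∞) x₀).contMDiffOn_tangentMapWithin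
    (m := ∞) (by simp) hU
  have h2 : ContMDiff 𝓘(ℝ, Model n) 𝓘(ℝ, Model n).tangent ∞
      (fun y : Model n => (⟨y, u⟩ : TangentBundle 𝓘(ℝ, Model n) (Model n))) :=
    contMDiff_vectorSpace_iff_contDiff.2 contDiff_const
  have h3 : ContMDiffOn 𝓘(ℝ, Model n) (𝓡 (2 * n)).tangent ∞
      (tangentMapWithin 𝓘(ℝ, Model n) (𝓡 (2 * n)) (extChartAt (𝓡 (2 * n)) x₀).symm
        (extChartAt (𝓡 (2 * n)) x₀).target ∘
        fun y : Model n => (⟨y, u⟩ : TangentBundle 𝓘(ℝ, Model n) (Model n)))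
      (extChartAt (𝓡 (2 * n)) x₀).target :=
    h1.comp h2.contMDiffOn (fun y hy => hy)
  refine (h3.contMDiffAt ((isOpen_chartTarget (n := n) x₀).mem_nhds hy)).congr_of_eventuallyEq ?_
  filter_upwards [(isOpen_chartTarget (n := n) x₀).mem_nhds hy] with z hz
  simp only [Function.comp, tangentMapWithin, chartVec]
  rw [mfderivWithin_of_isOpen (isOpen_chartTarget (n := n) x₀) hz]

theorem contDiffAt_chartCoeff {Ω : TwoTensor n M} (hΩ : ContMDiff (𝓡 (2 * n))
    ((𝓡 (2 * n)).prod 𝓘(ℝ, Model n →L[ℝ] Model n →L[ℝ] ℝ)) ∞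
    (fun x ↦ TotalSpace.mk' (Model n →L[ℝ] Model n →L[ℝ] ℝ) x (Ω x)))
    {x₀ : M} {y : Model n} (hy : y ∈ (extChartAt (𝓡 (2 * n)) x₀).target) (u w : Model n) :
    ContDiffAt ℝ ∞ (chartCoeff Ω x₀ u w) y := by
  have : ContMDiffAt 𝓘(ℝ, Model n) ((𝓡 (2 * n)).prod 𝓘(ℝ, ℝ)) ∞
      (fun y ↦ TotalSpace.mk' ℝ (E := Bundle.Trivial M ℝ) ((extChartAt (𝓡 (2 * n)) x₀).symm y)
        (Ω ((extChartAt (𝓡 (2 * n)) x₀).symm y) (chartVec x₀ y u) (chartVec x₀ y w))) y := by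
    apply ContMDiffAt.clm_bundle_apply₂ (F₁ := Model n) (F₂ := Model n)
      (E₁ := fun x : M => TangentSpace (𝓡 (2 * n)) x) (E₂ := fun x : M => TangentSpace (𝓡 (2 * n)) x)
    · exact hΩ.contMDiffAt.comp y (contMDiffAt_chart_symm hy)
    · exact contMDiffAt_chartVec hy u
    · exact contMDiffAt_chartVec hy w
  simp only [contMDiffAt_totalSpace] at this
  exact this.2.contDiffAt

end Charts

section Volume

variable [MeasurableSpace M] [BorelSpace M]
  {g : Metric n M} {vol : Measure M}

/-- In the standard basis the new matrix is `Aᵀ B A`, with `A` the matrix of `T`. -/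
theorem det_of_comp (B : Model n →L[ℝ] Model n →L[ℝ] ℝ) (T : Model n →L[ℝ] Model n) :
    (Matrix.of fun i j : Fin (2 * n) => B (T (stdVec n i)) (T (stdVec n j))).det =
      T.det ^ 2 * (Matrix.of fun i j : Fin (2 * n) => B (stdVec n i) (stdVec n j)).det := by
  set b := (EuclideanSpace.basisFun (Fin (2 * n)) ℝ).toBasis with hb
  set A := LinearMap.toMatrix b b T.toLinearMap with hA
  have hT : ∀ i, T (stdVec n i) = ∑ k, A k i • stdVec n k := by
    intro i
    have h := b.sum_repr (T (stdVec n i))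
    rw [← h]
    refine Finset.sum_congr rfl fun k _ => ?_
    have e : b k = stdVec n k := by simp [hb]
    rw [e, hA, LinearMap.toMatrix_apply]
    have e' : b i = stdVec n i := by simp [hb]
    rw [e']
    rfl
  have hdet : T.det = A.det := by
    rw [hA, LinearMap.det_toMatrix]
  have e : (Matrix.of fun i j : Fin (2 * n) => B (T (stdVec n i)) (T (stdVec n j))) =
      A.transpose * (Matrix.of fun i j : Fin (2 * n) => B (stdVec n i) (stdVec n j)) * A := by
    ext i j
    simp only [Matrix.of_apply, Matrix.mul_apply, Matrix.transpose_apply]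
    rw [hT i, hT j]
    simp only [map_sum, map_smul, sum_apply, smul_apply, smul_eq_mul]
    refine Finset.sum_congr rfl fun k _ => ?_
    rw [Finset.mul_sum, Finset.sum_mul]
    refine Finset.sum_congr rfl fun l _ => ?_
    ring
  rw [e, Matrix.det_mul, Matrix.det_mul, Matrix.det_transpose, hdet]
  ring

/-- The density of the Riemannian measure in the chart at `x₀`. -/
def volDensity (g : Metric n M) (x₀ : M) (y : Model n) : ℝ :=
  Real.sqrt (Matrix.det (Matrix.of fun i j : Fin (2 * n) =>
    chartCoeff g.inner x₀ (stdVec n i) (stdVec n j) y))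

theorem continuousAt_volDensity {x₀ : M} {y : Model n}
    (hy : y ∈ (extChartAt (𝓡 (2 * n)) x₀).target) : ContinuousAt (volDensity g x₀) y := by
  refine Real.continuous_sqrt.continuousAt.comp ?_
  have h : ContinuousAt (fun y => (Matrix.of fun i j : Fin (2 * n) =>
      chartCoeff g.inner x₀ (stdVec n i) (stdVec n j) y)) y :=
    continuousAt_pi.2 fun i => continuousAt_pi.2 fun j =>
      (contDiffAt_chartCoeff g.contMDiff hy _ _).continuousAt
  have hd : Continuous (fun A : Matrix (Fin (2 * n)) (Fin (2 * n)) ℝ => A.det) :=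
    continuous_id.matrix_det
  exact ContinuousAt.comp (g := fun A : Matrix (Fin (2 * n)) (Fin (2 * n)) ℝ => A.det)
    hd.continuousAt h

/-- The density is continuous, so it is bounded on a small ball in each chart; the measure is
locally finite and `M` is compact. -/
theorem isFiniteMeasure_of_isRiemannianVolume [CompactSpace M] (hvol : IsRiemannianVolume g vol) :
    IsFiniteMeasure vol := by
  have : IsLocallyFiniteMeasure vol := by
    refine ⟨fun x₀ => ?_⟩
    set ψ := extChartAt (𝓡 (2 * n)) x₀ with hψ
    have hy₀ : ψ x₀ ∈ ψ.target := mem_extChartAt_target x₀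
    have h1 : ∀ᶠ y in 𝓝 (ψ x₀), volDensity g x₀ y < volDensity g x₀ (ψ x₀) + 1 :=
      (continuousAt_volDensity hy₀).eventually (gt_mem_nhds (by linarith))
    obtain ⟨r, hr, hball⟩ := Metric.eventually_nhds_iff_ball.1
      (h1.and ((isOpen_chartTarget (n := n) x₀).mem_nhds hy₀))
    set B := ψ.source ∩ ψ ⁻¹' Metric.ball (ψ x₀) r with hB
    have hBo : IsOpen B := by
      exact (continuousOn_extChartAt x₀).isOpen_inter_preimage (isOpen_extChartAt_source x₀)
        Metric.isOpen_ball
    refine ⟨B, hBo.mem_nhds ⟨mem_extChartAt_source x₀, Metric.mem_ball_self hr⟩, ?_⟩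
    rw [hvol x₀ B hBo.measurableSet (by rw [← extChartAt_source (𝓡 (2 * n))]; exact inter_subset_left)]
    have himg : ψ '' B ⊆ Metric.ball (ψ x₀) r := by
      rintro _ ⟨x, hx, rfl⟩; exact hx.2
    calc _ ≤ ∫⁻ y in Metric.ball (ψ x₀) r, ENNReal.ofReal (volDensity g x₀ y) :=
          lintegral_mono_set himg
      _ ≤ ∫⁻ y in Metric.ball (ψ x₀) r, ENNReal.ofReal (volDensity g x₀ (ψ x₀) + 1) := by
          refine setLIntegral_mono measurable_const fun y hy => ?_
          exact ENNReal.ofReal_le_ofReal (hball y hy).1.le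
      _ < ⊤ := by
          rw [setLIntegral_const]
          exact ENNReal.mul_lt_top ENNReal.ofReal_lt_top measure_ball_lt_top
  infer_instance

theorem measurableSet_chart_image {x₀ : M} {B : Set M} (hB : MeasurableSet B)
    (hBs : B ⊆ (extChartAt (𝓡 (2 * n)) x₀).source) :
    MeasurableSet (extChartAt (𝓡 (2 * n)) x₀ '' B) := by
  have e : extChartAt (𝓡 (2 * n)) x₀ '' B =
      (extChartAt (𝓡 (2 * n)) x₀).target ∩ (extChartAt (𝓡 (2 * n)) x₀).symm ⁻¹' B := by
    rw [← (extChartAt (𝓡 (2 * n)) x₀).image_source_inter_eq', inter_eq_self_of_subset_right hBs]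
  rw [e]
  have hc : Continuous ((extChartAt (𝓡 (2 * n)) x₀).target.domRestrict (extChartAt (𝓡 (2 * n)) x₀).symm) :=
    continuousOn_iff_continuous_domRestrict.1 (continuousOn_extChartAt_symm x₀)
  have h := (MeasurableEmbedding.subtype_coe
    (isOpen_chartTarget (n := n) x₀).measurableSet).measurableSet_image.2 (hc.measurable hB)
  convert h using 1
  ext y
  constructor
  · rintro ⟨h1, h2⟩; exact ⟨⟨y, h1⟩, h2, rfl⟩
  · rintro ⟨z, h2, rfl⟩; exact ⟨z.2, h2⟩

variable {A : TorusAction n M}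

/-- Change of variables for the translation `T` written in two charts: invariance of `g` says that
the density at `y` is `|det DT|` times the density at `T y`, which is exactly the Jacobian factor.
-/
theorem vol_image_act_of_subset (hg : IsInvariantMetric A g) (hvol : IsRiemannianVolume g vol)
    (v : Fin n → ℝ) {x₀ x₁ : M} {B : Set M} (hB : MeasurableSet B)
    (hB₀ : B ⊆ (extChartAt (𝓡 (2 * n)) x₀).source)
    (hB₁ : ∀ x ∈ B, A.act v x ∈ (extChartAt (𝓡 (2 * n)) x₁).source) :
    vol (A.act v '' B) = vol B := by
  set ψ₀ := extChartAt (𝓡 (2 * n)) x₀ with hψ₀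
  set ψ₁ := extChartAt (𝓡 (2 * n)) x₁ with hψ₁
  have hcomp : ∀ x, A.act (-v) (A.act v x) = x := A.act_neg_act v
  have himg : A.act v '' B = A.act (-v) ⁻¹' B := by
    ext x
    constructor
    · rintro ⟨y, hy, rfl⟩; rw [mem_preimage, hcomp]; exact hy
    · intro hx; exact ⟨_, hx, A.act_act_neg v x⟩
  have hBm : MeasurableSet (A.act v '' B) := by
    rw [himg]; exact (A.continuous_act (-v)).measurable hB
  have hsub₁ : A.act v '' B ⊆ ψ₁.source := by rintro _ ⟨x, hx, rfl⟩; exact hB₁ x hx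
  rw [hvol x₁ _ hBm (by rw [← extChartAt_source (𝓡 (2 * n))]; exact hsub₁),
    hvol x₀ B hB (by rw [← extChartAt_source (𝓡 (2 * n))]; exact hB₀)]
  set T : Model n → Model n := fun y => ψ₁ (A.act v (ψ₀.symm y)) with hT
  have hTimg : ψ₁ '' (A.act v '' B) = T '' (ψ₀ '' B) := by
    rw [image_image, image_image]
    refine image_congr fun x hx => ?_
    simp only [hT]
    rw [ψ₀.left_inv (hB₀ hx)]
  have hS : ∀ y ∈ ψ₀ '' B, y ∈ ψ₀.target ∧ A.act v (ψ₀.symm y) ∈ ψ₁.source := by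
    rintro _ ⟨x, hx, rfl⟩
    refine ⟨ψ₀.map_source (hB₀ hx), ?_⟩
    rw [ψ₀.left_inv (hB₀ hx)]; exact hB₁ x hx
  have hTd : ∀ y ∈ ψ₀ '' B, HasFDerivAt T (fderiv ℝ T y) y := by
    intro y hy
    have h1 : MDifferentiableAt 𝓘(ℝ, Model n) 𝓘(ℝ, Model n) T y :=
      (mdifferentiableAt_chart (hS y hy).2).comp y
        ((A.mdifferentiableAt_act v _).comp y (mdifferentiableAt_chart_symm (hS y hy).1))
    exact h1.differentiableAt.hasFDerivAt
  have hinj : InjOn T (ψ₀ '' B) := by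
    intro y hy z hz h
    have h1 := ψ₁.injOn (hS y hy).2 (hS z hz).2 h
    have h2 := congrArg (A.act (-v)) h1
    rw [hcomp, hcomp] at h2
    exact ψ₀.symm.injOn (hS y hy).1 (hS z hz).1 h2
  rw [hTimg, lintegral_image_eq_lintegral_abs_det_fderiv_mul volume
    (measurableSet_chart_image hB hB₀) (fun y hy => (hTd y hy).hasFDerivWithinAt) hinj]
  refine setLIntegral_congr_fun (measurableSet_chart_image hB hB₀) fun y hy => ?_
  have hTy : ψ₁.symm (T y) = A.act v (ψ₀.symm y) := ψ₁.left_inv (hS y hy).2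
  have hTt : T y ∈ ψ₁.target := ψ₁.map_source (hS y hy).2
  -- Both sides differentiate the same map from the first chart to `M`, factored through the second
  -- chart or through the first one.
  have hrel : ∀ u : Model n, (chartVec x₁ (T y) (fderiv ℝ T y u) : Model n) =
      A.push v (ψ₀.symm y) (chartVec x₀ y u) := by
    intro u
    have h1 : HasMFDerivAt 𝓘(ℝ, Model n) (𝓡 (2 * n)) (ψ₁.symm ∘ T) y
        ((mfderiv 𝓘(ℝ, Model n) (𝓡 (2 * n)) ψ₁.symm (T y)).comp (fderiv ℝ T y)) :=
      (mdifferentiableAt_chart_symm hTt).hasMFDerivAt.comp y (hTd y hy).hasMFDerivAt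
    have h2 : HasMFDerivAt 𝓘(ℝ, Model n) (𝓡 (2 * n)) (A.act v ∘ ψ₀.symm) y
        ((mfderiv (𝓡 (2 * n)) (𝓡 (2 * n)) (A.act v) (ψ₀.symm y)).comp
          (mfderiv 𝓘(ℝ, Model n) (𝓡 (2 * n)) ψ₀.symm y)) :=
      (A.mdifferentiableAt_act v _).hasMFDerivAt.comp y
        (mdifferentiableAt_chart_symm (hS y hy).1).hasMFDerivAt
    have hev : ψ₁.symm ∘ T =ᶠ[𝓝 y] A.act v ∘ ψ₀.symm := by
      have hc : ContinuousAt (A.act v ∘ ψ₀.symm) y :=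
        (A.continuous_act v).continuousAt.comp
          (contMDiffAt_chart_symm (hS y hy).1).continuousAt
      filter_upwards [hc.eventually ((isOpen_extChartAt_source x₁).mem_nhds (hS y hy).2)] with z hz
      exact ψ₁.left_inv hz
    have h3 := h1.congr_of_eventuallyEq hev.symm
    have h4 := hasMFDerivAt_unique h2 h3
    have h5 := congrArg (fun l : Model n →L[ℝ] Model n => l u) h4
    exact h5.symm
  have hdet : (Matrix.of fun i j : Fin (2 * n) =>
        chartCoeff g.inner x₀ (stdVec n i) (stdVec n j) y).det =
      (fderiv ℝ T y).det ^ 2 * (Matrix.of fun i j : Fin (2 * n) =>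
        chartCoeff g.inner x₁ (stdVec n i) (stdVec n j) (T y)).det := by
    set D : Model n →L[ℝ] Model n := mfderiv 𝓘(ℝ, Model n) (𝓡 (2 * n)) ψ₁.symm (T y) with hD
    set C : Model n →L[ℝ] Model n →L[ℝ] ℝ := g.inner (ψ₁.symm (T y)) with hC
    have hcongr : ∀ z z' : M, z = z' → ∀ a b : Model n,
        (g.inner z : Model n →L[ℝ] Model n →L[ℝ] ℝ) a b =
          (g.inner z' : Model n →L[ℝ] Model n →L[ℝ] ℝ) a b := by
      rintro z _ rfl a b; rfl
    have key := det_of_comp (C.bilinearComp D D) (fderiv ℝ T y)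
    refine Eq.trans ?_ key
    congr 1
    ext i j
    refine (hg v (ψ₀.symm y) (chartVec x₀ y (stdVec n i)) (chartVec x₀ y (stdVec n j))).symm.trans ?_
    refine (hcongr _ _ hTy.symm _ _).trans ?_
    rw [← hrel, ← hrel]
    rfl
  have hd := congrArg Real.sqrt hdet
  rw [Real.sqrt_mul (sq_nonneg _), Real.sqrt_sq_eq_abs] at hd
  simp only [hd]
  rw [ENNReal.ofReal_mul (abs_nonneg _)]

/-- By compactness it suffices to compare the measures on finitely many open sets that lie in a
chart together with their translate by `-v`; there the preimage under `v` is the image under `-v`.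
-/
theorem measurePreserving_act [CompactSpace M] (hg : IsInvariantMetric A g)
    (hvol : IsRiemannianVolume g vol) (v : Fin n → ℝ) : MeasurePreserving (A.act v) vol vol := by
  have hm : ∀ v, Measurable (A.act v) := fun v => (A.continuous_act v).measurable
  refine ⟨hm v, ?_⟩
  have hU : ∀ x₀ : M, (extChartAt (𝓡 (2 * n)) x₀).source ∩
      A.act (-v) ⁻¹' (extChartAt (𝓡 (2 * n)) (A.act (-v) x₀)).source ∈ 𝓝 x₀ := fun x₀ =>
    Filter.inter_mem (extChartAt_source_mem_nhds x₀)
      ((A.continuous_act (-v)).continuousAt.preimage_mem_nhds (extChartAt_source_mem_nhds _))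
  obtain ⟨t, ht⟩ := isCompact_univ.elim_nhds_subcover _ (fun x₀ _ => hU x₀)
  rw [Measure.ext_iff_of_biUnion_eq_univ t.countable_toSet (univ_subset_iff.1 ht.2)]
  intro x₀ _
  have hUm : MeasurableSet ((extChartAt (𝓡 (2 * n)) x₀).source ∩
      A.act (-v) ⁻¹' (extChartAt (𝓡 (2 * n)) (A.act (-v) x₀)).source) :=
    (isOpen_extChartAt_source x₀).measurableSet.inter
      (hm (-v) (isOpen_extChartAt_source _).measurableSet)
  ext B hB
  rw [Measure.restrict_apply hB, Measure.restrict_apply hB, Measure.map_apply (hm v) (hB.inter hUm)]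
  rw [← vol_image_act_of_subset hg hvol (-v) (x₀ := x₀) (x₁ := A.act (-v) x₀) (hB.inter hUm)
    (fun x hx => hx.2.1) (fun x hx => hx.2.2)]
  congr 1
  ext x
  constructor
  · intro hx; exact ⟨_, hx, A.act_neg_act v x⟩
  · rintro ⟨y, hy, rfl⟩
    rw [mem_preimage, A.act_act_neg]; exact hy

/-- The integral of the derivative of a function along a fundamental vector field vanishes. -/
theorem integral_lieDeriv_eq_zero [CompactSpace M] [T2Space M] (hg : IsInvariantMetric A g)
    (hvol : IsRiemannianVolume g vol) (v : Fin n → ℝ) {h F : M → ℂ} (hh : Continuous h)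
    (hF : Continuous F) (hd : ∀ x, HasDerivAt (fun τ : ℝ => h (A.act (τ • v) x)) (F x) 0) :
    ∫ x, F x ∂vol = 0 := by
  have := isFiniteMeasure_of_isRiemannianVolume hvol
  obtain ⟨C, hC⟩ := isCompact_univ.exists_bound_of_continuousOn hF.continuousOn
  have h_integrable : ∀ {f : M → ℂ}, Continuous f → Integrable f vol := by
    intro f hf
    exact (hf.continuousOn.integrableOn_compact isCompact_univ).integrable_of_forall_notMem_eq_zero
      (fun x hx => (hx (mem_univ x)).elim)
  have hd' : ∀ (x : M) (τ : ℝ), HasDerivAt (fun τ : ℝ => h (A.act (τ • v) x))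
      (F (A.act (τ • v) x)) τ := by
    intro x τ
    have h1 := hd (A.act (τ • v) x)
    have h2 : HasDerivAt (fun r : ℝ => r - τ) 1 τ := (hasDerivAt_id τ).sub_const τ
    have h1' : HasDerivAt (fun r : ℝ => h (A.act (r • v) (A.act (τ • v) x)))
      (F (A.act (τ • v) x)) (τ - τ) := by rw [sub_self]; exact h1
    have h3 := HasDerivAt.scomp (h := fun r : ℝ => r - τ) τ h1' h2
    rw [one_smul] at h3
    refine h3.congr_of_eventuallyEq (Filter.Eventually.of_forall fun r => ?_)
    simp only [Function.comp]
    rw [← A.act_add, ← add_smul, sub_add_cancel]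
  have key := (hasDerivAt_integral_of_dominated_loc_of_deriv_le (μ := vol) (𝕜 := ℝ)
    (F := fun (τ : ℝ) (x : M) => h (A.act (τ • v) x)) (F' := fun (τ : ℝ) x => F (A.act (τ • v) x))
    (x₀ := 0) (s := univ) (bound := fun _ => C) Filter.univ_mem
    (Filter.Eventually.of_forall fun τ =>
      (h_integrable (hh.comp (A.continuous_act (τ • v)))).aestronglyMeasurable)
    (h_integrable (hh.comp (A.continuous_act _)))
    (h_integrable (hF.comp (A.continuous_act _))).aestronglyMeasurable
    (Filter.Eventually.of_forall fun x τ _ => hC _ (mem_univ _))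
    (integrable_const C)
    (Filter.Eventually.of_forall fun x τ _ => hd' x τ)).2
  -- Invariance of the measure makes the integral independent of `τ`, while differentiating under
  -- the integral sign gives the integral of `F`.
  have hconst : (fun τ : ℝ => ∫ x, h (A.act (τ • v) x) ∂vol) = fun _ => ∫ x, h x ∂vol := by
    funext τ
    have hmp := measurePreserving_act hg hvol (τ • v)
    have he : MeasurableEmbedding (A.act (τ • v)) :=
      Homeomorph.measurableEmbedding
        { toFun := A.act (τ • v), invFun := A.act (-(τ • v)), left_inv := A.act_neg_act _,
          right_inv := A.act_act_neg _, continuous_toFun := A.continuous_act _,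
          continuous_invFun := A.continuous_act _ }
    exact hmp.integral_comp he h
  rw [hconst] at key
  have h0 := key.unique (hasDerivAt_const _ _)
  simpa [A.act_zero] using h0

end Volume

end

/-! ### Smoothness of sections of `W ⊗ L` under the operators. -/

section

section MatrixSmooth

variable {ι : Type*} [Fintype ι] [DecidableEq ι]

theorem contDiff_det {V : Type*} [NormedAddCommGroup V] [NormedSpace ℝ V] {A : V → Matrix ι ι ℝ}
    (hA : ∀ i j, ContDiff ℝ ∞ (fun v => A v i j)) : ContDiff ℝ ∞ (fun v => (A v).det) := by
  simp only [Matrix.det_apply']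
  refine ContDiff.sum fun σ _ => ?_
  exact contDiff_const.mul (contDiff_prod fun i _ => hA _ _)

/-- Cramer's rule. -/
theorem contDiffAt_matrix_inv (A : ι → ι → ℝ) (hA : (Matrix.of A).det ≠ 0) (i j : ι) :
    ContDiffAt ℝ ∞ (fun A : ι → ι → ℝ => (Matrix.of A)⁻¹ i j) A := by
  have h1 : ContDiff ℝ ∞ (fun A : ι → ι → ℝ => (Matrix.of A).det) :=
    contDiff_det fun i j => contDiff_apply_apply ℝ ℝ i j
  have h2 : ContDiff ℝ ∞ (fun A : ι → ι → ℝ => (Matrix.of A).adjugate i j) := by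
    simp only [Matrix.adjugate_apply]
    refine contDiff_det fun a b => ?_
    by_cases h : a = j
    · subst h; simp only [Matrix.updateRow_self]; exact contDiff_const
    · simp only [Matrix.updateRow_ne h]; exact contDiff_apply_apply ℝ ℝ a b
  have h3 : (fun A : ι → ι → ℝ => (Matrix.of A)⁻¹ i j) =
      fun A : ι → ι → ℝ => ((Matrix.of A).det)⁻¹ * (Matrix.of A).adjugate i j := by
    funext A
    rw [Matrix.inv_def, Matrix.smul_apply, smul_eq_mul, Ring.inverse_eq_inv']
  rw [h3]
  exact (h1.contDiffAt.inv hA).mul h2.contDiffAt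

end MatrixSmooth

variable {n : ℕ} {M : Type*} [TopologicalSpace M] [ChartedSpace (Model n) M]
  [IsManifold (𝓡 (2 * n)) ∞ M] {X : ToricOrigami n M} {g : Metric n M}

theorem contMDiff_inner_field (A : TorusAction n M) (g : Metric n M) (v w : Fin n → ℝ) :
    ContMDiff (𝓡 (2 * n)) 𝓘(ℝ, ℝ) ∞ (fun x => g.inner x (A.field v x) (A.field w x)) := by
  intro x
  have : ContMDiffAt (𝓡 (2 * n)) ((𝓡 (2 * n)).prod 𝓘(ℝ, ℝ)) ∞
      (fun y ↦ TotalSpace.mk' ℝ (E := Bundle.Trivial M ℝ) y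
        (g.inner y (A.field v y) (A.field w y))) x := by
    apply ContMDiffAt.clm_bundle_apply₂ (F₁ := Model n) (F₂ := Model n)
      (E₁ := fun x : M => TangentSpace (𝓡 (2 * n)) x) (E₂ := fun x : M => TangentSpace (𝓡 (2 * n)) x)
    · exact g.contMDiff.contMDiffAt
    · exact A.contMDiff_field v x
    · exact A.contMDiff_field w x
  simp only [contMDiffAt_totalSpace] at this
  exact this.2

theorem contMDiff_gram (A : TorusAction n M) (g : Metric n M) (𝔥 : Submodule ℝ (Fin n → ℝ)) :
    ContMDiff (𝓡 (2 * n)) 𝓘(ℝ, Fin (Module.finrank ℝ 𝔥) → Fin (Module.finrank ℝ 𝔥) → ℝ) ∞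
      (fun x i j => gram A g 𝔥 x i j) :=
  contMDiff_pi_space.2 fun _ => contMDiff_pi_space.2 fun _ => contMDiff_inner_field A g _ _

/-- Non-degeneracy of the Gram matrix is an open condition. A whole neighbourhood is needed, since
the coefficient is cut off to a global smooth function later. -/
theorem eventually_contMDiffAt_gram_inv {A : TorusAction n M} {𝔥 : Submodule ℝ (Fin n → ℝ)} {x : M}
    (h : ∀ v ∈ 𝔥, A.field v x = 0 → v = 0) (i j) :
    ∀ᶠ y in 𝓝 x, ContMDiffAt (𝓡 (2 * n)) 𝓘(ℝ, ℂ) ∞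
      (fun y => (((gram A g 𝔥 y)⁻¹ i j : ℝ) : ℂ)) y := by
  have hdet : (gram A g 𝔥 x).det ≠ 0 := (gram_posDef h).det_pos.ne'
  have hc : Continuous (fun y => (gram A g 𝔥 y).det) :=
    Continuous.matrix_det (contMDiff_gram A g 𝔥).continuous
  filter_upwards [hc.continuousAt.eventually_ne hdet] with y hy
  have h1 : ContMDiffAt (𝓡 (2 * n)) 𝓘(ℝ, ℝ) ∞ (fun y => (gram A g 𝔥 y)⁻¹ i j) y :=
    ContMDiffAt.comp (I' := 𝓘(ℝ, Fin (Module.finrank ℝ 𝔥) → Fin (Module.finrank ℝ 𝔥) → ℝ))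
      (g := fun A : Fin (Module.finrank ℝ 𝔥) → Fin (Module.finrank ℝ 𝔥) → ℝ => (Matrix.of A)⁻¹ i j)
      y (contDiffAt_matrix_inv _ hy i j).contMDiffAt (contMDiff_gram A g 𝔥 y)
  exact Complex.ofRealCLM.contDiff.contMDiff.contMDiffAt.comp y h1

variable {FW : Type*} [NormedAddCommGroup FW] [NormedSpace ℂ FW] [FiniteDimensional ℂ FW]
  {W : M → Type*} [∀ x, NormedAddCommGroup (W x)] [∀ x, InnerProductSpace ℂ (W x)]
  [TopologicalSpace (TotalSpace FW W)] [FiberBundle FW W] [VectorBundle ℝ FW W]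
  [VectorBundle ℂ FW W] [ContMDiffVectorBundle ∞ FW W (𝓡 (2 * n))]
  {L : M → Type*} [∀ x, NormedAddCommGroup (L x)] [∀ x, InnerProductSpace ℂ (L x)]
  [TopologicalSpace (TotalSpace ℂ L)] [FiberBundle ℂ L] [VectorBundle ℝ ℂ L]
  [VectorBundle ℂ ℂ L] [ContMDiffVectorBundle ∞ ℂ L (𝓡 (2 * n))]
  (R : CliffordBundle X.toTorusAction g FW W) (P : Prequantization X L)

/-- `s` is a smooth section of `W ⊗ L` near `x`. -/
def IsSmoothTensorAt (n : ℕ) {M : Type*} [TopologicalSpace M] [ChartedSpace (Model n) M] (FW : Type*)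
    [NormedAddCommGroup FW] [NormedSpace ℂ FW]
    {W : M → Type*} [∀ x, NormedAddCommGroup (W x)] [∀ x, InnerProductSpace ℂ (W x)]
    [TopologicalSpace (TotalSpace FW W)] [FiberBundle FW W] [VectorBundle ℝ FW W]
    {L : M → Type*} [∀ x, NormedAddCommGroup (L x)] [∀ x, InnerProductSpace ℂ (L x)]
    [TopologicalSpace (TotalSpace ℂ L)] [FiberBundle ℂ L] [VectorBundle ℝ ℂ L]
    (s : ∀ x : M, W x ⊗[ℂ] L x) (x : M) : Prop :=
  ∃ (w : ∀ x : M, W x) (l : ∀ x : M, L x), IsSmoothSection n FW w ∧ IsSmoothSection n ℂ l ∧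
    ∀ᶠ y in 𝓝 x, s y = w y ⊗ₜ[ℂ] l y

theorem IsSmoothTensorAt.congr {s s' : ∀ x : M, W x ⊗[ℂ] L x} {x : M}
    (hs : IsSmoothTensorAt n FW s x) (h : ∀ᶠ y in 𝓝 x, s' y = s y) : IsSmoothTensorAt n FW s' x := by
  obtain ⟨w, l, hw, hl, e⟩ := hs
  exact ⟨w, l, hw, hl, by filter_upwards [e, h] with y h1 h2; rw [h2, h1]⟩

theorem isSmoothTensorAt_zero (x : M) :
    IsSmoothTensorAt n FW (fun x => (0 : W x ⊗[ℂ] L x)) x :=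
  ⟨fun _ => 0, fun _ => 0, contMDiff_zeroSection ℝ W, contMDiff_zeroSection ℝ L,
    Filter.Eventually.of_forall fun y => by simp⟩

theorem IsSmoothTensorAt.cliff {s : ∀ x : M, W x ⊗[ℂ] L x} {x : M} (hs : IsSmoothTensorAt n FW s x)
    (v : Fin n → ℝ) :
    IsSmoothTensorAt n FW (fun y => cliff R L y (X.field v y) (s y)) x := by
  obtain ⟨w, l, hw, hl, h⟩ := hs
  refine ⟨_, l, R.c_smooth _ w (X.contMDiff_field v) hw, hl, ?_⟩
  filter_upwards [h] with y hy
  rw [hy]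
  rfl

theorem exists_smul_eq_of_ne_zero (x : M) {l₀ : L x} (h : l₀ ≠ 0) (l : L x) :
    l = (inner ℂ l₀ l / inner ℂ l₀ l₀) • l₀ := by
  have h1 : Module.finrank ℂ (L x) = 1 := by
    rw [finrank_fiber (F := ℂ) (W := L)]; simp
  obtain ⟨c, hc⟩ := exists_smul_eq_of_finrank_eq_one h1 h l
  have h0 : inner ℂ l₀ l₀ ≠ 0 := inner_self_ne_zero.2 h
  rw [← hc, inner_smul_right, mul_div_assoc, div_self h0, mul_one]

variable [T2Space M]

/-- The quotient of two smooth sections of `L` near a point where the second one does not vanish. -/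
theorem exists_contMDiff_quotient {l l₀ : ∀ x : M, L x} (P : EquivariantHermitian X.toTorusAction ℂ L)
    (hl : IsSmoothSection n ℂ l)
    (hl₀ : IsSmoothSection n ℂ l₀) {x : M} (hx : l₀ x ≠ 0) :
    ∃ k : M → ℂ, ContMDiff (𝓡 (2 * n)) 𝓘(ℝ, ℂ) ∞ k ∧ ∀ᶠ y in 𝓝 x, l y = k y • l₀ y := by
  have h1 := P.smooth_inner l₀ l hl₀ hl
  have h2 := P.smooth_inner l₀ l₀ hl₀ hl₀
  have h0 : ∀ᶠ y in 𝓝 x, inner ℂ (l₀ y) (l₀ y) ≠ 0 :=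
    h2.continuous.continuousAt.eventually_ne (inner_self_ne_zero.2 hx)
  obtain ⟨k, hk, hke⟩ := exists_contMDiff_eventuallyEq (n := n) (x₀ := x)
    (h := fun y => inner ℂ (l₀ y) (l y) / inner ℂ (l₀ y) (l₀ y)) (by
      filter_upwards [h0] with y hy
      have hd : ContDiffAt ℝ ∞ (fun q : ℂ × ℂ => q.1 / q.2)
          (inner ℂ (l₀ y) (l y), inner ℂ (l₀ y) (l₀ y)) := by
        simp only [div_eq_mul_inv]
        exact contDiffAt_fst.mul (contDiffAt_snd.inv hy)
      exact hd.contMDiffAt.comp y ((h1 y).prodMk_space (h2 y)))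
  refine ⟨k, hk, ?_⟩
  filter_upwards [hke, h0] with y h1 h2
  rw [h1]
  exact exists_smul_eq_of_ne_zero y (inner_self_ne_zero.1 h2) _

/-- `L` has rank one, so near `x` any section of it is a smooth multiple of `l₀`, and the multiple
can be moved to the first factor. A common second factor is what makes sums of pure tensors pure
again. -/
theorem IsSmoothTensorAt.exists_tmul (P : EquivariantHermitian X.toTorusAction ℂ L)
    {s : ∀ x : M, W x ⊗[ℂ] L x} {x : M} (hs : IsSmoothTensorAt n FW s x)
    {l₀ : ∀ x : M, L x} (hl₀ : IsSmoothSection n ℂ l₀) (hx : l₀ x ≠ 0) :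
    ∃ w : ∀ x : M, W x, IsSmoothSection n FW w ∧ ∀ᶠ y in 𝓝 x, s y = w y ⊗ₜ[ℂ] l₀ y := by
  obtain ⟨w, l, hw, hl, h⟩ := hs
  obtain ⟨k, hk, hke⟩ := exists_contMDiff_quotient P hl hl₀ hx
  refine ⟨fun y => k y • w y, hw.smul hk, ?_⟩
  filter_upwards [h, hke] with y h1 h2
  rw [h1, h2, TensorProduct.tmul_smul, TensorProduct.smul_tmul']

theorem IsSmoothTensorAt.add (P : EquivariantHermitian X.toTorusAction ℂ L)
    {s s' : ∀ x : M, W x ⊗[ℂ] L x} {x : M} (hs : IsSmoothTensorAt n FW s x)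
    (hs' : IsSmoothTensorAt n FW s' x) : IsSmoothTensorAt n FW (fun y => s y + s' y) x := by
  obtain ⟨l₀, hl₀, hx⟩ := exists_isSmoothSection_ne_zero (n := n) L x
  obtain ⟨w, hw, h⟩ := hs.exists_tmul P hl₀ hx
  obtain ⟨w', hw', h'⟩ := hs'.exists_tmul P hl₀ hx
  refine ⟨_, l₀, hw.add hw', hl₀, ?_⟩
  filter_upwards [h, h'] with y h1 h2
  rw [h1, h2, TensorProduct.add_tmul]

theorem IsSmoothTensorAt.sum (P : EquivariantHermitian X.toTorusAction ℂ L) {ι : Type*} (J : Finset ι)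
    {s : ι → ∀ x : M, W x ⊗[ℂ] L x} {x : M} (hs : ∀ i ∈ J, IsSmoothTensorAt n FW (s i) x) :
    IsSmoothTensorAt n FW (fun y => ∑ i ∈ J, s i y) x := by
  classical
  induction J using Finset.induction_on with
  | empty => simpa using isSmoothTensorAt_zero x
  | insert a J ha ih =>
    simp only [Finset.sum_insert ha]
    exact (hs a (Finset.mem_insert_self a J)).add P
      (ih fun i hi => hs i (Finset.mem_insert_of_mem hi))

theorem IsSmoothTensorAt.smul {s : ∀ x : M, W x ⊗[ℂ] L x} {x : M} (hs : IsSmoothTensorAt n FW s x)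
    {k : M → ℂ} (hk : ∀ᶠ y in 𝓝 x, ContMDiffAt (𝓡 (2 * n)) 𝓘(ℝ, ℂ) ∞ k y) :
    IsSmoothTensorAt n FW (fun y => k y • s y) x := by
  obtain ⟨w, l, hw, hl, h⟩ := hs
  obtain ⟨k', hk', e⟩ := exists_contMDiff_eventuallyEq hk
  refine ⟨_, l, hw.smul hk', hl, ?_⟩
  filter_upwards [h, e] with y h1 h2
  rw [h1, h2, TensorProduct.smul_tmul']

theorem contMDiff_potential (v : Fin n → ℝ) :
    ContMDiff (𝓡 (2 * n)) 𝓘(ℝ, ℂ) ∞ (potential P v) := by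
  have : potential P v = fun x => momentForm X x v := by
    funext x; exact potential_eq P v x
  rw [this]
  have h1 : ContDiff ℝ ∞ (fun ξ : Fin n → ℝ => (2 * Real.pi * Complex.I * (ξ ⬝ᵥ v : ℝ) : ℂ)) := by
    have h0 : ContDiff ℝ ∞ (fun ξ : Fin n → ℝ => ξ ⬝ᵥ v) := by
      simp only [dotProduct]
      exact ContDiff.sum fun i _ => (contDiff_apply ℝ ℝ i).mul contDiff_const
    exact contDiff_const.mul (Complex.ofRealCLM.contDiff.comp h0)
  exact h1.contMDiff.comp X.smooth_moment

theorem hasDerivAt_comp_smul {F' : Type*} [NormedAddCommGroup F'] [NormedSpace ℝ F']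
    {f : (Fin n → ℝ) → F'} (hf : ContDiff ℝ ∞ f) (v : Fin n → ℝ) :
    HasDerivAt (fun τ : ℝ => f (τ • v)) (deriv (fun τ : ℝ => f (τ • v)) 0) 0 :=
  ((hf.differentiable (by simp) _).comp 0 ((differentiableAt_id).smul_const v)).hasDerivAt

theorem EquivariantHermitian.orbitMap_zero {F : Type*} [NormedAddCommGroup F] [NormedSpace ℂ F]
    {W : M → Type*} [∀ x, NormedAddCommGroup (W x)] [∀ x, InnerProductSpace ℂ (W x)]
    [TopologicalSpace (TotalSpace F W)] [FiberBundle F W] [VectorBundle ℝ F W]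
    {A : TorusAction n M} (R : EquivariantHermitian A F W) (s : ∀ x : M, W x) (x : M) :
    R.orbitMap s x 0 = s x := by
  have h := (TotalSpace.ext_iff.1 (R.lift_lattice 0 TorusAction.zero_mem_lattice x
    (R.orbitMap s x 0))).2
  have e : HEq (s (A.act 0 x)) (s x) := by rw [A.act_zero]
  rw [orbitMap] at h ⊢
  have h' : HEq (s (A.act 0 x)) ((R.lift 0 x).symm (s (A.act 0 x))) := by
    simpa using h
  exact eq_of_heq (h'.symm.trans e)

/-- Leibniz rule for the bilinear map `⊗` along the orbit curve; it exhibits the derivative as a sum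
of smooth pure tensors. -/
theorem orbitDeriv_eq_of_eventually {s : ∀ x : M, W x ⊗[ℂ] L x} {w : ∀ x : M, W x} {l : ∀ x : M, L x}
    (hw : IsSmoothSection n FW w) (hl : IsSmoothSection n ℂ l) {x : M}
    (h : ∀ᶠ y in 𝓝 x, s y = w y ⊗ₜ[ℂ] l y) (v : Fin n → ℝ) :
    orbitDeriv R P v s x = R.lieDeriv v w x ⊗ₜ[ℂ] l x + w x ⊗ₜ[ℂ] P.lieDeriv v l x +
      potential P v x • s x := by
  have h1 := hasDerivAt_comp_smul (R.contDiff_orbitMap hw x) v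
  have h2 := hasDerivAt_comp_smul (P.contDiff_orbitMap hl x) v
  have h3 := ((isBoundedBilinearMap_tmul (W x) (L x)).hasFDerivAt
    (R.orbitMap w x ((0 : ℝ) • v), P.orbitMap l x ((0 : ℝ) • v))).comp_hasDerivAt (0 : ℝ)
      (h1.prodMk h2)
  have hc : ContinuousAt (fun τ : ℝ => X.act (τ • v) x) 0 :=
    (X.contMDiff_curve v x).continuous.continuousAt
  have h' : ∀ᶠ y in 𝓝 (X.act ((0 : ℝ) • v) x), s y = w y ⊗ₜ[ℂ] l y := by
    rw [zero_smul, X.act_zero]; exact h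
  have h4 := h3.congr_of_eventuallyEq (f₁ := fun τ : ℝ => tensorOrbit R P s x (τ • v)) (by
    filter_upwards [hc.eventually h'] with τ hτ
    rw [tensorOrbit, hτ, tensorLift_symm_tmul]
    rfl)
  have h5 := h4.deriv
  have e1 : R.orbitMap w x ((0 : ℝ) • v) = w x := by
    rw [zero_smul]; exact R.orbitMap_zero w x
  have e2 : P.orbitMap l x ((0 : ℝ) • v) = l x := by
    rw [zero_smul]; exact P.orbitMap_zero l x
  rw [orbitDeriv]
  congr 1
  refine h5.trans ?_
  rw [e1, e2]
  change w x ⊗ₜ[ℂ] P.lieDeriv v l x + R.lieDeriv v w x ⊗ₜ[ℂ] l x = _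
  exact add_comm _ _

theorem IsSmoothTensorAt.orbitDeriv {s : ∀ x : M, W x ⊗[ℂ] L x} {x : M}
    (hs : IsSmoothTensorAt n FW s x) (v : Fin n → ℝ) :
    IsSmoothTensorAt n FW (orbitDeriv R P v s) x := by
  have hs0 := hs
  obtain ⟨w, l, hw, hl, h⟩ := hs
  have h1 : IsSmoothTensorAt n FW (fun y => R.lieDeriv v w y ⊗ₜ[ℂ] l y) x :=
    ⟨_, l, R.contMDiff_lieDeriv hw v, hl, Filter.Eventually.of_forall fun _ => rfl⟩
  have h2 : IsSmoothTensorAt n FW (fun y => w y ⊗ₜ[ℂ] P.lieDeriv v l y) x :=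
    ⟨w, _, hw, P.contMDiff_lieDeriv hl v, Filter.Eventually.of_forall fun _ => rfl⟩
  have h3 := hs0.smul (k := potential P v)
    (Filter.Eventually.of_forall fun y => contMDiff_potential P v y)
  refine ((h1.add P.toEquivariantHermitian h2).add P.toEquivariantHermitian h3).congr ?_
  filter_upwards [h.eventually_nhds] with y hy
  exact orbitDeriv_eq_of_eventually R P hw hl hy v

theorem IsSmoothTensorAt.orbitDirac {𝔥 : Submodule ℝ (Fin n → ℝ)} {s : ∀ x : M, W x ⊗[ℂ] L x} {x : M}
    (hs : IsSmoothTensorAt n FW s x) (hx : ∀ v ∈ 𝔥, X.field v x = 0 → v = 0) :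
    IsSmoothTensorAt n FW (orbitDirac R P 𝔥 s) x :=
  IsSmoothTensorAt.sum P.toEquivariantHermitian _ fun i _ =>
    IsSmoothTensorAt.sum P.toEquivariantHermitian _ fun j _ =>
      ((hs.orbitDeriv R P _).cliff R _).smul (eventually_contMDiffAt_gram_inv hx i j)

theorem continuousAt_inner_tensor (R : EquivariantHermitian X.toTorusAction FW W)
    (P : EquivariantHermitian X.toTorusAction ℂ L)
    {s s' : ∀ x : M, W x ⊗[ℂ] L x} {x : M} (hs : IsSmoothTensorAt n FW s x)
    (hs' : IsSmoothTensorAt n FW s' x) : ContinuousAt (fun y => inner ℂ (s y) (s' y)) x := by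
  obtain ⟨w, l, hw, hl, h⟩ := hs
  obtain ⟨w', l', hw', hl', h'⟩ := hs'
  have h1 : ContinuousAt (fun y => inner ℂ (w y) (w' y) * inner ℂ (l y) (l' y)) x :=
    ((R.smooth_inner w w' hw hw').continuous.mul (P.smooth_inner l l' hl hl').continuous).continuousAt
  refine h1.congr ?_
  filter_upwards [h, h'] with y e e'
  rw [e, e', TensorProduct.inner_tmul]

theorem continuous_inner_tensor (R : EquivariantHermitian X.toTorusAction FW W)
    (P : EquivariantHermitian X.toTorusAction ℂ L)
    {s s' : ∀ x : M, W x ⊗[ℂ] L x} (hs : IsSmoothTensor n FW s) (hs' : IsSmoothTensor n FW s') :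
    Continuous (fun y => inner ℂ (s y) (s' y)) :=
  continuous_iff_continuousAt.2 fun x => continuousAt_inner_tensor R P (hs x) (hs' x)

end

/-! ### Integration by parts, self-adjointness and the anti-commutators. -/

section

section Saturation

variable {n : ℕ} {M : Type*} [TopologicalSpace M] [ChartedSpace (Model n) M]

/-- The union of the orbits through the points of `C`. -/
def TorusAction.saturation (A : TorusAction n M) (C : Set M) : Set M := {x | ∃ v, A.act v x ∈ C}

theorem TorusAction.isCompact_saturation (A : TorusAction n M) {C : Set M} (hC : IsCompact C) :
    IsCompact (A.saturation C) := by
  have e : A.saturation C = (fun q : (Fin n → ℝ) × M => A.act q.1 q.2) '' (Icc 0 1 ×ˢ C) := by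
    ext x
    constructor
    · rintro ⟨v, hv⟩
      -- The translation by `-v` agrees with the one by its fractional part, which lies in the
      -- compact cube.
      refine ⟨(fun i => Int.fract (-v i), A.act v x), ⟨⟨fun i => Int.fract_nonneg _,
        fun i => (Int.fract_lt_one _).le⟩, hv⟩, ?_⟩
      have e1 : (fun i => Int.fract (-v i)) + v = fun i => -((⌊-v i⌋ : ℤ) : ℝ) := by
        funext i
        simp only [Pi.add_apply, Int.fract]
        ring
      change A.act (fun i => Int.fract (-v i)) (A.act v x) = x
      rw [← A.act_add, e1]
      exact A.act_lattice _ (fun i => ⟨-⌊-v i⌋, by push_cast; rfl⟩) x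
    · rintro ⟨⟨v, y⟩, ⟨-, hy⟩, rfl⟩
      exact ⟨-v, by rw [A.act_neg_act]; exact hy⟩
  rw [e]
  exact (isCompact_Icc.prod hC).image A.smooth.continuous

end Saturation

variable {n : ℕ} {M : Type*} [TopologicalSpace M] [ChartedSpace (Model n) M]
  [IsManifold (𝓡 (2 * n)) ∞ M] {X : ToricOrigami n M} {g : Metric n M}
  {FW : Type*} [NormedAddCommGroup FW] [NormedSpace ℂ FW] [FiniteDimensional ℂ FW]
  {W : M → Type*} [∀ x, NormedAddCommGroup (W x)] [∀ x, InnerProductSpace ℂ (W x)]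
  [TopologicalSpace (TotalSpace FW W)] [FiberBundle FW W] [VectorBundle ℝ FW W]
  [VectorBundle ℂ FW W] [ContMDiffVectorBundle ∞ FW W (𝓡 (2 * n))]
  {L : M → Type*} [∀ x, NormedAddCommGroup (L x)] [∀ x, InnerProductSpace ℂ (L x)]
  [TopologicalSpace (TotalSpace ℂ L)] [FiberBundle ℂ L] [VectorBundle ℝ ℂ L]
  [VectorBundle ℂ ℂ L] [ContMDiffVectorBundle ∞ ℂ L (𝓡 (2 * n))]
  (R : CliffordBundle X.toTorusAction g FW W) (P : Prequantization X L)
  [T2Space M]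

theorem isSmoothTensorAt_of_eventually_zero {s : ∀ x : M, W x ⊗[ℂ] L x} {x : M}
    (h : ∀ᶠ y in 𝓝 x, s y = 0) : IsSmoothTensorAt n FW s x :=
  (isSmoothTensorAt_zero x).congr h

/-- The operator differentiates along orbits only, so it vanishes on every orbit along which `s`
vanishes. -/
theorem orbitDirac_eq_zero (hg : IsInvariantMetric X.toTorusAction g) (𝔥 : Submodule ℝ (Fin n → ℝ))
    {s : ∀ x : M, W x ⊗[ℂ] L x} {C : Set M} (hC : ∀ x ∉ C, s x = 0) {x : M}
    (hx : x ∉ X.saturation C) : orbitDirac R P 𝔥 s x = 0 := by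
  have h0 : tensorOrbit R P s x = fun _ => 0 := by
    funext v
    rw [tensorOrbit, hC _ fun h => hx ⟨v, h⟩, map_zero]
  rw [orbitDirac_eq R P hg, h0]
  simp [modelDirac, constDirac, lineDeriv]

/-- The new support lies in the saturation of the old one, which is compact and contained in the
invariant set `B`. Off the saturation the result is locally zero, so a degenerate Gram matrix there
does no harm. -/
theorem isTestSection_orbitDirac (hg : IsInvariantMetric X.toTorusAction g)
    {𝔥 : Submodule ℝ (Fin n → ℝ)} {B : Set M} (hB : ∀ x ∈ B, ∀ v, X.act v x ∈ B)
    (hfree : ∀ x ∈ B, ∀ v ∈ 𝔥, X.field v x = 0 → v = 0) {s : ∀ x : M, W x ⊗[ℂ] L x}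
    (hs : IsTestSection n FW B s) : IsTestSection n FW B (orbitDirac R P 𝔥 s) := by
  obtain ⟨hs, C, hC, hCB, h0⟩ := hs
  have hK := X.isCompact_saturation hC
  have hKB : X.saturation C ⊆ B := by
    rintro x ⟨v, hv⟩
    have := hB _ (hCB hv) (-v)
    rwa [X.act_neg_act] at this
  refine ⟨fun x => ?_, _, hK, hKB, fun x hx => orbitDirac_eq_zero R P hg 𝔥 h0 hx⟩
  by_cases hx : x ∈ X.saturation C
  · exact IsSmoothTensorAt.orbitDirac R P (hs x) (hfree x (hKB hx))
  · refine isSmoothTensorAt_of_eventually_zero ?_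
    filter_upwards [hK.isClosed.isOpen_compl.mem_nhds hx] with y hy
    exact orbitDirac_eq_zero R P hg 𝔥 h0 hy

theorem orbitDeriv_eq_covDeriv {s : ∀ x : M, W x ⊗[ℂ] L x} (hs : IsSmoothTensor n FW s)
    (v : Fin n → ℝ) (x : M) :
    orbitDeriv R P v s x = covDeriv (momentForm X x) v (tensorOrbit R P s x) 0 := by
  have h := ((contDiff_tensorOrbit R P hs x).differentiable (by simp) 0).hasFDerivAt.hasLineDerivAt v
  unfold HasLineDerivAt at h
  simp only [zero_add] at h
  have h' := h.deriv
  rw [covDeriv, tensorOrbit_zero, momentForm_apply, ← potential_eq P v x]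
  unfold orbitDeriv
  exact congrArg (· + potential P v x • s x) h'

section Integration

variable [CompactSpace M] [MeasurableSpace M] [BorelSpace M] {vol : Measure M}

theorem integrable_inner_tensor (R : CliffordBundle X.toTorusAction g FW W) (P : Prequantization X L)
    (hvol : IsRiemannianVolume g vol)
    {s s' : ∀ x : M, W x ⊗[ℂ] L x} (hs : IsSmoothTensor n FW s) (hs' : IsSmoothTensor n FW s') :
    Integrable (fun x => inner ℂ (s x) (s' x)) vol := by
  have := isFiniteMeasure_of_isRiemannianVolume hvol
  have hc := continuous_inner_tensor R.toEquivariantHermitian P.toEquivariantHermitian hs hs'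
  obtain ⟨C, hC⟩ := isCompact_univ.exists_bound_of_continuousOn hc.continuousOn
  exact Integrable.of_bound hc.measurable.aestronglyMeasurable C
    (Filter.Eventually.of_forall fun x => hC x (mem_univ x))

theorem inner_tensorOrbit (s s' : ∀ x : M, W x ⊗[ℂ] L x) (x : M) (v : Fin n → ℝ) :
    inner ℂ (tensorOrbit R P s x v) (tensorOrbit R P s' x v) =
      inner ℂ (s (X.act v x)) (s' (X.act v x)) := by
  rw [← inner_tensorLift R P v, tensorLift_tensorOrbit, tensorLift_tensorOrbit]

/-- The connection is metric: `m v` is purely imaginary, so its two contributions cancel. -/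
theorem hasDerivAt_inner_of_tensor {E : Type*} [NormedAddCommGroup E] [InnerProductSpace ℂ E]
    {f f' : (Fin n → ℝ) → E} (hf : ContDiff ℝ ∞ f) (hf' : ContDiff ℝ ∞ f') (m : (Fin n → ℝ) →ₗ[ℝ] ℂ)
    (v : Fin n → ℝ) (hm : (m v).re = 0) :
    HasDerivAt (fun τ : ℝ => inner ℂ (f (τ • v)) (f' (τ • v)))
      (inner ℂ (covDeriv m v f 0) (f' 0) + inner ℂ (f 0) (covDeriv m v f' 0)) 0 := by
  have h : ∀ {f : (Fin n → ℝ) → E}, ContDiff ℝ ∞ f →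
      HasDerivAt (fun τ : ℝ => f (τ • v)) (fderiv ℝ f 0 v) 0 := by
    intro f hf
    have := (hf.differentiable (by simp) 0).hasFDerivAt.hasLineDerivAt v
    unfold HasLineDerivAt at this
    simpa only [zero_add] using this
  have h1 := (h hf).inner ℂ (h hf')
  refine h1.congr_deriv ?_
  have hc : (starRingEnd ℂ) (m v) = -m v := by
    apply Complex.ext <;> simp [hm]
  simp only [zero_smul, covDeriv, inner_add_left, inner_add_right, inner_smul_left, inner_smul_right,
    hc]
  ring

theorem inner_sum_sum_smul_of_skew {ι E : Type*} [Fintype ι] [NormedAddCommGroup E]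
    [InnerProductSpace ℂ E] (G : Matrix ι ι ℝ) (c : ι → E →ₗ[ℂ] E)
    (hc : ∀ i ξ η, inner ℂ (c i ξ) η = -inner ℂ ξ (c i η)) (a : ι → E) (η : E) :
    inner ℂ (∑ i, ∑ j, (G i j : ℂ) • c i (a j)) η =
      ∑ j, -inner ℂ (a j) (∑ i, (G i j : ℂ) • c i η) := by
  rw [Finset.sum_comm, sum_inner]
  refine Finset.sum_congr rfl fun j _ => ?_
  rw [sum_inner, inner_sum, ← Finset.sum_neg_distrib]
  refine Finset.sum_congr rfl fun i _ => ?_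
  rw [inner_smul_left, hc, inner_smul_right, Complex.conj_ofReal, mul_neg]

/-- `∇_v` is skew, because the sum of the two integrands is the derivative of `⟨s, s'⟩` along the
orbits. -/
theorem integral_orbitDeriv (hg : IsInvariantMetric X.toTorusAction g)
    (hvol : IsRiemannianVolume g vol) {s s' : ∀ x : M, W x ⊗[ℂ] L x} (hs : IsSmoothTensor n FW s)
    (hs' : IsSmoothTensor n FW s') (v : Fin n → ℝ) :
    ∫ x, inner ℂ (s x) (orbitDeriv R P v s' x) ∂vol =
      -∫ x, inner ℂ (orbitDeriv R P v s x) (s' x) ∂vol := by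
  have hd : IsSmoothTensor n FW (orbitDeriv R P v s) := fun x =>
    IsSmoothTensorAt.orbitDeriv R P (hs x) v
  have hd' : IsSmoothTensor n FW (orbitDeriv R P v s') := fun x =>
    IsSmoothTensorAt.orbitDeriv R P (hs' x) v
  have h := integral_lieDeriv_eq_zero hg hvol v
    (h := fun x => inner ℂ (s x) (s' x))
    (F := fun x => inner ℂ (orbitDeriv R P v s x) (s' x) + inner ℂ (s x) (orbitDeriv R P v s' x))
    (continuous_inner_tensor R.toEquivariantHermitian P.toEquivariantHermitian hs hs')
    ((continuous_inner_tensor R.toEquivariantHermitian P.toEquivariantHermitian hd hs').add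
      (continuous_inner_tensor R.toEquivariantHermitian P.toEquivariantHermitian hs hd')) (by
    intro x
    have h1 := hasDerivAt_inner_of_tensor (contDiff_tensorOrbit R P hs x)
      (contDiff_tensorOrbit R P hs' x) (momentForm X x) v (by simp [momentForm])
    rw [orbitDeriv_eq_covDeriv R P hs, orbitDeriv_eq_covDeriv R P hs']
    simp only [inner_tensorOrbit, tensorOrbit_zero] at h1
    exact h1)
  rw [integral_add (integrable_inner_tensor R P hvol hd hs')
    (integrable_inner_tensor R P hvol hs hd')] at h
  exact eq_neg_of_add_eq_zero_right h

/-- Both `c` and `∇_j` are skew and their signs cancel; the coefficients `g^{ij} c(v_i)` are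
parallel along orbits and may be moved across `∇_j`. -/
theorem integral_inner_orbitDirac (hg : IsInvariantMetric X.toTorusAction g)
    (hvol : IsRiemannianVolume g vol) {𝔥 : Submodule ℝ (Fin n → ℝ)} {B : Set M}
    (hfree : ∀ x ∈ B, ∀ v ∈ 𝔥, X.field v x = 0 → v = 0) {s s' : ∀ x : M, W x ⊗[ℂ] L x}
    (hs : IsSmoothTensor n FW s) (hs' : IsTestSection n FW B s') :
    ∫ x, inner ℂ (orbitDirac R P 𝔥 s x) (s' x) ∂vol =
      ∫ x, inner ℂ (s x) (orbitDirac R P 𝔥 s' x) ∂vol := by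
  obtain ⟨hs', C, hC, hCB, h0⟩ := hs'
  -- The symbol and the inverse Gram matrix are put on the compactly supported section: the `t j`
  -- are smooth on all of `M`, whereas `orbitDirac R P 𝔥 s` need not be smooth outside `B`.
  set t : Fin (Module.finrank ℝ 𝔥) → ∀ x : M, W x ⊗[ℂ] L x := fun j x =>
    ∑ i, (((gram X.toTorusAction g 𝔥 x)⁻¹ i j : ℝ) : ℂ) •
      cliff R L x (X.field (Module.finBasis ℝ 𝔥 i) x) (s' x) with ht
  have hts : ∀ j, IsSmoothTensor n FW (t j) := by
    intro j x
    by_cases hx : x ∈ C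
    · exact IsSmoothTensorAt.sum P.toEquivariantHermitian _ fun i _ =>
        (IsSmoothTensorAt.cliff R (hs' x) _).smul (eventually_contMDiffAt_gram_inv (hfree x (hCB hx)) i j)
    · refine isSmoothTensorAt_of_eventually_zero ?_
      filter_upwards [hC.isClosed.isOpen_compl.mem_nhds hx] with y hy
      simp only [ht, h0 y hy, map_zero]
      exact Finset.sum_eq_zero fun i _ => smul_zero _
  have e1 : ∀ x, inner ℂ (orbitDirac R P 𝔥 s x) (s' x) =
      ∑ j, -inner ℂ (orbitDeriv R P (Module.finBasis ℝ 𝔥 j : Fin n → ℝ) s x) (t j x) := by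
    intro x
    exact inner_sum_sum_smul_of_skew (gram X.toTorusAction g 𝔥 x)⁻¹
      (fun i => cliff R L x (X.field (Module.finBasis ℝ 𝔥 i) x))
      (fun i ξ η => inner_cliff R x _ ξ η) _ _
  have e2 : ∀ x, inner ℂ (s x) (orbitDirac R P 𝔥 s' x) =
      ∑ j, inner ℂ (s x) (orbitDeriv R P (Module.finBasis ℝ 𝔥 j : Fin n → ℝ) (t j) x) := by
    intro x
    have := finiteDimensional_tensor FW (W := W) (L := L) x
    have e3 : ∀ j, orbitDeriv R P (Module.finBasis ℝ 𝔥 j : Fin n → ℝ) (t j) x =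
        ∑ i, (((gram X.toTorusAction g 𝔥 x)⁻¹ i j : ℝ) : ℂ) •
          cliff R L x (X.field (Module.finBasis ℝ 𝔥 i) x)
            (orbitDeriv R P (Module.finBasis ℝ 𝔥 j : Fin n → ℝ) s' x) := by
      intro j
      -- The sum over `i` is written as a double sum with a one-column matrix, to match the form of
      -- `covDeriv_sum_smul_clm`.
      have e4 : tensorOrbit R P (t j) x = fun v => ∑ i, ∑ k : Unit,
          (((Matrix.of fun i (_ : Unit) => (gram X.toTorusAction g 𝔥 x)⁻¹ i j) i k : ℝ) : ℂ) •
          cliff R L x (X.field (Module.finBasis ℝ 𝔥 i) x) (tensorOrbit R P s' x v) := by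
        funext v
        rw [tensorOrbit, LinearEquiv.symm_apply_eq]
        simp only [ht, map_sum, map_smul, gram_act hg, ← tensorLift_cliff_field R P,
          tensorLift_tensorOrbit]
        simp
      rw [orbitDeriv_eq_covDeriv R P (hts j), e4, covDeriv_sum_smul_clm _ _ _ _
        (fun _ : Unit => tensorOrbit R P s' x) _
        (fun _ => (contDiff_tensorOrbit R P hs' x).differentiable (by simp) _)]
      simp only [Finset.univ_unique, Finset.sum_singleton, Matrix.of_apply,
        ← orbitDeriv_eq_covDeriv R P hs']
    have h := inner_sum (𝕜 := ℂ) (E := W x ⊗[ℂ] L x) Finset.univ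
      (fun j => orbitDeriv R P (Module.finBasis ℝ 𝔥 j : Fin n → ℝ) (t j) x) (s x)
    refine Eq.trans ?_ h
    rw [Finset.sum_congr rfl fun j _ => e3 j, Finset.sum_comm]
    rfl
  have hd : ∀ v, IsSmoothTensor n FW (orbitDeriv R P v s) := fun v x =>
    IsSmoothTensorAt.orbitDeriv R P (hs x) v
  simp only [e1, e2]
  simp only [Finset.sum_neg_distrib]
  rw [integral_neg, integral_finsetSum _ fun j _ => integrable_inner_tensor R P hvol (hd _) (hts j),
    ← Finset.sum_neg_distrib, integral_finsetSum _ fun j _ => integrable_inner_tensor R P hvol hs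
      (fun x => IsSmoothTensorAt.orbitDeriv R P (hts j x) _)]
  refine Finset.sum_congr rfl fun j _ => ?_
  rw [integral_orbitDeriv R P hg hvol hs (hts j)]

theorem orbitDirac_anticomm_of_le (hg : IsInvariantMetric X.toTorusAction g)
    {𝔥 𝔨 : Submodule ℝ (Fin n → ℝ)} (hle : 𝔥 ≤ 𝔨) {x : M}
    (hfree : ∀ v ∈ 𝔥, X.field v x = 0 → v = 0) (hfree' : ∀ v ∈ 𝔨, X.field v x = 0 → v = 0)
    {s : ∀ x : M, W x ⊗[ℂ] L x} (hs : IsSmoothTensor n FW s) :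
    orbitDirac R P 𝔥 (orbitDirac R P 𝔨 s) x + orbitDirac R P 𝔨 (orbitDirac R P 𝔥 s) x =
      (2 : ℂ) • orbitDirac R P 𝔥 (orbitDirac R P 𝔥 s) x := by
  have := finiteDimensional_tensor FW (W := W) (L := L) x
  simp only [orbitDirac_eq R P hg 𝔥 x, orbitDirac_eq R P hg 𝔨 x, tensorOrbit_orbitDirac R P hg]
  set b := Module.finBasis ℝ 𝔥
  set a := Module.finBasis ℝ 𝔨
  -- The matrix of the inclusion of `𝔥` into `𝔨`; the mixed Gram matrix of the two bases is then `B`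
  -- times that of `𝔨`.
  set B : Matrix (Fin (Module.finrank ℝ 𝔥)) (Fin (Module.finrank ℝ 𝔨)) ℝ :=
    Matrix.of fun i l => a.repr ⟨b i, hle (b i).2⟩ l with hBdef
  have hb : ∀ i, (b i : Fin n → ℝ) = ∑ l, B i l • (a l : Fin n → ℝ) := by
    intro i
    have := congrArg Subtype.val (a.sum_repr ⟨b i, hle (b i).2⟩)
    simp only [Submodule.coe_sum, Submodule.coe_smul] at this
    exact this.symm
  refine constDirac_anticomm_of_le (p := gram X.toTorusAction g 𝔥 x)
    (q := gram X.toTorusAction g 𝔨 x)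
    (gram_posDef hfree).det_pos.ne'.isUnit ?_ (gram_posDef hfree').det_pos.ne'.isUnit
    _ _ (momentForm X x) (fun i => (b i : Fin n → ℝ)) (fun l => (a l : Fin n → ℝ)) B hb ?_ ?_
    (contDiff_tensorOrbit R P hs x) 0
  · ext i j
    exact g.symm x _ _
  · intro i k ξ
    exact cliff_anticomm R x _ _ ξ
  · intro i k ξ
    rw [cliff_anticomm R x _ _ ξ]
    congr 4
    rw [hb i, Matrix.mul_apply, X.field_sum]
    simp only [map_sum, map_smul, sum_apply, smul_apply]
    rfl

/-- The anti-commutator is `2 D²` for the smaller torus, and moving one factor `D` to the other side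
gives `2 ∫ ‖D s‖²`. -/
theorem integral_anticomm_nonneg_of_le (hg : IsInvariantMetric X.toTorusAction g)
    (hvol : IsRiemannianVolume g vol) {𝔥 𝔨 : Submodule ℝ (Fin n → ℝ)} (hle : 𝔥 ≤ 𝔨) {B : Set M}
    (hB : ∀ x ∈ B, ∀ v, X.act v x ∈ B)
    (hfree : ∀ x ∈ B, ∀ v ∈ 𝔨, X.field v x = 0 → v = 0) {s : ∀ x : M, W x ⊗[ℂ] L x}
    (hs : IsTestSection n FW B s) :
    let I := ∫ x, inner ℂ (s x) (orbitDirac R P 𝔥 (orbitDirac R P 𝔨 s) x +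
      orbitDirac R P 𝔨 (orbitDirac R P 𝔥 s) x) ∂vol
    0 ≤ I.re ∧ I.im = 0 := by
  intro I
  have hfree' : ∀ x ∈ B, ∀ v ∈ 𝔥, X.field v x = 0 → v = 0 := fun x hx v hv => hfree x hx v (hle hv)
  have hD := isTestSection_orbitDirac R P hg hB hfree' hs
  have e : I = ∫ x, ((2 * ‖orbitDirac R P 𝔥 s x‖ ^ 2 : ℝ) : ℂ) ∂vol := by
    have e1 : I = ∫ x, 2 * inner ℂ (s x) (orbitDirac R P 𝔥 (orbitDirac R P 𝔥 s) x) ∂vol := by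
      refine integral_congr_ae (Filter.Eventually.of_forall fun x => ?_)
      obtain ⟨hs', C, hC, hCB, h0⟩ := hs
      -- The identity for the anti-commutator requires locally free orbits, known only on `B`;
      -- elsewhere `s` vanishes and with it both integrands.
      by_cases hx : x ∈ C
      · simp only [orbitDirac_anticomm_of_le R P hg hle (hfree' x (hCB hx)) (hfree x (hCB hx)) hs']
        exact inner_smul_right (𝕜 := ℂ) (E := W x ⊗[ℂ] L x) _ _ _
      · simp [h0 x hx]
    rw [e1, integral_const_mul, ← integral_inner_orbitDirac R P hg hvol hfree' hs.1 hD,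
      ← integral_const_mul]
    refine integral_congr_ae (Filter.Eventually.of_forall fun x => ?_)
    have h := inner_self_eq_norm_sq_to_K (𝕜 := ℂ) (E := W x ⊗[ℂ] L x) (orbitDirac R P 𝔥 s x)
    push_cast
    exact congrArg (2 * ·) h
  rw [e, integral_complex_ofReal]
  exact ⟨by rw [Complex.ofReal_re]; exact integral_nonneg fun x => by positivity, Complex.ofReal_im _⟩

end Integration

end

/-! ### The kernel of the operators along the leaves. -/

section

section Periodic

/-- Divergence theorem on the unit cube: opposite faces cancel by periodicity. -/
theorem integral_fderiv_eq_zero_of_periodic {k : ℕ} {F' : Type*} [NormedAddCommGroup F']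
    [NormedSpace ℝ F'] {ψ : (Fin k → ℝ) → F'} (hψ : ContDiff ℝ ∞ ψ)
    (hp : ∀ i y, ψ (y + Pi.single i 1) = ψ y) (w : Fin k → ℝ) :
    ∫ y in Icc (0 : Fin k → ℝ) 1, fderiv ℝ ψ y w = 0 := by
  cases k with
  | zero =>
    have : w = 0 := Subsingleton.elim _ _
    simp only [this, map_zero, integral_zero]
  | succ k =>
    have hd : ∀ y, fderiv ℝ ψ y w = ∑ i, (w i • fderiv ℝ ψ y) (Pi.single i 1) := by
      intro y
      conv_lhs => rw [← Finset.univ_sum_single w]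
      rw [map_sum]
      refine Finset.sum_congr rfl fun i _ => ?_
      rw [smul_apply, ← map_smul, ← Pi.single_smul, smul_eq_mul, mul_one]
    have hc : Continuous (fun y => fderiv ℝ ψ y w) :=
      (hψ.continuous_fderiv (by simp)).clm_apply continuous_const
    have h := integral_divergence_of_hasFDerivAt_off_countable' (0 : Fin (k + 1) → ℝ) 1 zero_le_one
      (fun i y => w i • ψ y) (fun i y => w i • fderiv ℝ ψ y) ∅ countable_empty
      (fun i => (continuous_const.smul hψ.continuous).continuousOn)
      (fun y _ i => ((hψ.differentiable (by simp) y).hasFDerivAt).const_smul (w i))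
      (by
        simp only [← hd]
        exact hc.continuousOn.integrableOn_compact isCompact_Icc)
    simp only [← hd] at h
    rw [h]
    refine Finset.sum_eq_zero fun i _ => ?_
    rw [sub_eq_zero]
    refine integral_congr_ae (Filter.Eventually.of_forall fun x => ?_)
    have e : (i.insertNth (1 : ℝ) x : Fin (k + 1) → ℝ) = i.insertNth (0 : ℝ) x + Pi.single i 1 := by
      funext j
      refine Fin.succAboveCases i ?_ (fun j => ?_) j
      · simp
      · simp [Fin.succAbove_ne]
    change w i • ψ (i.insertNth (1 : ℝ) x) = w i • ψ (i.insertNth (0 : ℝ) x)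
    rw [e, hp]

variable {ι E : Type*} [Fintype ι] [DecidableEq ι] [NormedAddCommGroup E] [InnerProductSpace ℂ E]

open scoped MatrixOrder Matrix.Norms.L2Operator in
-- Factor `q = Cᵀ C`; a real factorization also diagonalizes the Hermitian form on vectors of `E`.
theorem exists_sum_norm_sq_of_posDef {q : Matrix ι ι ℝ} (hq : q.PosDef) :
    ∃ C : Matrix ι ι ℝ, IsUnit C.det ∧ ∀ w : ι → E,
      ∑ j, ∑ l, (q j l : ℂ) * inner ℂ (w j) (w l) =
        ((∑ i, ‖∑ j, (C i j : ℂ) • w j‖ ^ 2 : ℝ) : ℂ) := by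
  obtain ⟨C, hC⟩ := CStarAlgebra.nonneg_iff_eq_star_mul_self.mp hq.posSemidef.nonneg
  rw [Matrix.star_eq_conjTranspose, Matrix.conjTranspose_eq_transpose_of_trivial] at hC
  refine ⟨C, ?_, fun w => ?_⟩
  · have h := hq.det_pos.ne'
    rw [hC, Matrix.det_mul] at h
    exact (right_ne_zero_of_mul h).isUnit
  · have h1 : ∀ i, (‖∑ j, (C i j : ℂ) • w j‖ ^ 2 : ℂ) =
        ∑ j, ∑ l, (C i j : ℂ) * (C i l : ℂ) * inner ℂ (w j) (w l) := by
      intro i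
      have := inner_self_eq_norm_sq_to_K (𝕜 := ℂ) (∑ j, (C i j : ℂ) • w j)
      refine this.symm.trans ?_
      rw [sum_inner]
      refine Finset.sum_congr rfl fun j _ => ?_
      rw [inner_sum]
      refine Finset.sum_congr rfl fun l _ => ?_
      rw [inner_smul_left, inner_smul_right, Complex.conj_ofReal, mul_assoc]
    push_cast
    rw [Finset.sum_congr rfl fun i _ => h1 i]
    refine Eq.trans ?_ Finset.sum_comm
    refine Finset.sum_congr rfl fun j _ => ?_
    refine Eq.trans ?_ Finset.sum_comm
    refine Finset.sum_congr rfl fun l _ => ?_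
    rw [hC, ← Finset.sum_mul]
    congr 1
    simp [Matrix.mul_apply]

theorem eq_zero_of_sum_smul_eq_zero {C : Matrix ι ι ℝ} (hC : IsUnit C.det) {w : ι → E}
    (h : ∀ i, ∑ j, (C i j : ℂ) • w j = 0) (j : ι) : w j = 0 := by
  have h1 : ∑ l, ((C⁻¹ * C) j l : ℂ) • w l = 0 := by
    simp only [Matrix.mul_apply]
    push_cast
    simp only [Finset.sum_smul, mul_smul]
    rw [Finset.sum_comm]
    simp only [← Finset.smul_sum, h, smul_zero, Finset.sum_const_zero]
  rw [Matrix.nonsing_inv_mul _ hC] at h1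
  simpa [Matrix.one_apply] using h1

variable {V : Type*} [NormedAddCommGroup V] [NormedSpace ℝ V]

theorem fderiv_inner_covDeriv {f h : V → E} (hf : ContDiff ℝ ∞ f) (hh : ContDiff ℝ ∞ h)
    (m : V →ₗ[ℝ] ℂ) (hm : ∀ v, (m v).re = 0) (v w : V) :
    fderiv ℝ (fun v => inner ℂ (f v) (h v)) v w =
      inner ℂ (covDeriv m w f v) (h v) + inner ℂ (f v) (covDeriv m w h v) := by
  rw [fderiv_inner_apply ℂ (hf.differentiable (by simp) v) (hh.differentiable (by simp) v)]
  have hc : (starRingEnd ℂ) (m w) = -m w := by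
    apply Complex.ext <;> simp [hm]
  simp only [covDeriv, inner_add_left, inner_add_right, inner_smul_left, inner_smul_right, hc]
  ring

/-- A periodic section in the kernel of the Dirac operator is parallel. -/
theorem covDeriv_eq_zero_of_periodic [FiniteDimensional ℂ E] {k : ℕ} (a : Module.Basis (Fin k) ℝ V)
    {p : Matrix ι ι ℝ} (hpos : p.PosDef) (c : ι → E →ₗ[ℂ] E) (m : V →ₗ[ℝ] ℂ)
    (hm : ∀ v, (m v).re = 0) (b : ι → V)
    (hp : ∀ i k ξ, c i (c k ξ) + c k (c i ξ) = (-(2 * (p i k : ℝ)) : ℂ) • ξ)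
    {f : V → E} (hf : ContDiff ℝ ∞ f) (hper : ∀ i v, f (v + a i) = f v)
    (h0 : ∀ v, constDirac p⁻¹ c (fun j => m (b j)) b f v = 0) (j : ι) (v : V) :
    covDeriv m (b j) f v = 0 := by
  have : FiniteDimensional ℝ V := a.finiteDimensional_of_finite
  have hsymm : p.transpose = p := by
    have := hpos.isHermitian
    rwa [Matrix.IsHermitian, Matrix.conjTranspose_eq_transpose_of_trivial] at this
  -- Applying the operator once more yields the Laplace equation for `f`.
  have hsq : ∀ v, ∑ j, ∑ l, (p⁻¹ j l : ℂ) • covDeriv m (b j) (covDeriv m (b l) f) v = 0 := by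
    intro v
    have h := constDirac_sq hpos.det_pos.ne'.isUnit hsymm c m b hp hf v
    have h0' : constDirac p⁻¹ c (fun j => m (b j)) b f = fun _ => 0 := funext h0
    rw [h0'] at h
    have : constDirac p⁻¹ c (fun j => m (b j)) b (fun _ => 0) v = 0 := by
      simp [constDirac, lineDeriv]
    rw [this] at h
    exact neg_eq_zero.1 h.symm
  have hcov : ∀ l, ContDiff ℝ ∞ (covDeriv m (b l) f) := fun l => contDiff_covDeriv m (b l) hf
  have hcovper : ∀ l i v, covDeriv m (b l) f (v + a i) = covDeriv m (b l) f v := by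
    intro l i v
    have e : (fun u => f (u + a i)) = f := funext (hper i)
    have h1 : fderiv ℝ f (v + a i) = fderiv ℝ f v := by
      rw [← fderiv_comp_add_right, e]
    rw [covDeriv, covDeriv, h1, hper]
  obtain ⟨C, hC, hCq⟩ := exists_sum_norm_sq_of_posDef (E := E) hpos.inv
  -- Coordinates in which the given periods are the unit vectors, so that the unit cube is a box of
  -- periods.
  set Φ : (Fin k → ℝ) →L[ℝ] V := LinearMap.toContinuousLinearMap a.equivFun.symm.toLinearMap with hΦ
  have hΦa : ∀ i, Φ (Pi.single i 1) = a i := fun i => by simp [hΦ]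
  have hΦs : ∀ w : V, Φ (a.equivFun w) = w := fun w => a.equivFun.symm_apply_apply w
  set N : V → ℝ := fun v => ∑ i, ‖∑ j, (C i j : ℂ) • covDeriv m (b j) f v‖ ^ 2 with hN
  have hNc : Continuous N := by
    refine continuous_finsetSum _ fun i _ => (Continuous.norm ?_).pow 2
    exact continuous_finsetSum _ fun j _ => (hcov j).continuous.const_smul _
  -- Bochner's trick: by the Laplace equation the energy density `∑ p⁻¹ j l ⟨∇_j f, ∇_l f⟩` equals
  -- the divergence `∑ p⁻¹ j l ∂_j ⟨f, ∇_l f⟩`.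
  have key : ∀ v, (N v : ℂ) = ∑ j, ∑ l, (p⁻¹ j l : ℂ) *
      fderiv ℝ (fun v => inner ℂ (f v) (covDeriv m (b l) f v)) v (b j) := by
    intro v
    simp only [fderiv_inner_covDeriv hf (hcov _) m hm, mul_add, Finset.sum_add_distrib]
    rw [hCq, left_eq_add]
    have := congrArg (inner ℂ (f v)) (hsq v)
    simpa only [inner_sum, inner_smul_right, inner_zero_right] using this
  have h_zero : ∫ y in Icc (0 : Fin k → ℝ) 1, N (v + Φ y) = 0 := by
    have h1 : ∀ j l, Continuous (fun y => (p⁻¹ j l : ℂ) *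
        fderiv ℝ (fun v => inner ℂ (f v) (covDeriv m (b l) f v)) (v + Φ y) (b j)) := by
      intro j l
      have h2 : ContDiff ℝ ∞ (fun v => inner ℂ (f v) (covDeriv m (b l) f v)) := hf.inner ℂ (hcov l)
      exact continuous_const.mul
        (((h2.continuous_fderiv (by simp)).clm_apply continuous_const).comp (continuous_const.add Φ.continuous))
    have h3 : ∫ y in Icc (0 : Fin k → ℝ) 1, (N (v + Φ y) : ℂ) = 0 := by
      simp only [key]
      rw [integral_finsetSum _ fun j _ => integrable_finsetSum _ fun l _ =>
        (h1 j l).continuousOn.integrableOn_compact isCompact_Icc]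
      refine Finset.sum_eq_zero fun j _ => ?_
      rw [integral_finsetSum _ fun l _ => (h1 j l).continuousOn.integrableOn_compact isCompact_Icc]
      refine Finset.sum_eq_zero fun l _ => ?_
      rw [integral_const_mul]
      have h2 : ContDiff ℝ ∞ (fun v => inner ℂ (f v) (covDeriv m (b l) f v)) := hf.inner ℂ (hcov l)
      have h4 := integral_fderiv_eq_zero_of_periodic (h2.comp (contDiff_const.add Φ.contDiff : ContDiff ℝ ∞ (fun y => v + Φ y))) (by
        intro i y
        simp only [Function.comp_apply, map_add, hΦa, ← add_assoc, hper, hcovper]) (a.equivFun (b j))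
      have h5 : ∀ y, fderiv ℝ ((fun v => inner ℂ (f v) (covDeriv m (b l) f v)) ∘ (fun y => v + Φ y)) y
          (a.equivFun (b j)) = fderiv ℝ (fun v => inner ℂ (f v) (covDeriv m (b l) f v)) (v + Φ y) (b j) := by
        intro y
        rw [fderiv_comp y (h2.differentiable (by simp) _) (Φ.differentiableAt.const_add v),
          fderiv_const_add, Φ.fderiv, ContinuousLinearMap.comp_apply, hΦs]
      simp only [h5] at h4
      rw [h4, mul_zero]
    rw [integral_complex_ofReal] at h3
    exact_mod_cast h3
  have hN0 : N v = 0 := by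
    have hn : ∀ y, 0 ≤ N (v + Φ y) := fun y => Finset.sum_nonneg fun i _ => by positivity
    have hc : Continuous (fun y => N (v + Φ y)) := hNc.comp (continuous_const.add Φ.continuous)
    have hci : IntegrableOn (fun y => N (v + Φ y)) (Icc (0 : Fin k → ℝ) 1) :=
      hc.continuousOn.integrableOn_compact isCompact_Icc
    rw [setIntegral_eq_zero_iff_of_nonneg_ae (Filter.Eventually.of_forall hn) hci] at h_zero
    -- The box is based at `v`, so the point of interest is a corner. As the box is the closure of
    -- its interior, vanishing almost everywhere extends to the corner by continuity.
    have hcl : Icc (0 : Fin k → ℝ) 1 ⊆ closure (interior (Icc (0 : Fin k → ℝ) 1)) := by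
      rw [← pi_univ_Icc, interior_pi_set finite_univ, closure_pi_set]
      simp
    have h := Measure.eqOn_of_ae_eq h_zero hc.continuousOn continuousOn_const hcl
      (left_mem_Icc.2 zero_le_one)
    simpa using h
  refine eq_zero_of_sum_smul_eq_zero hC (w := fun j => covDeriv m (b j) f v) (fun i => ?_) j
  have h := (Finset.sum_eq_zero_iff_of_nonneg fun i _ => by positivity).1 hN0 i (Finset.mem_univ i)
  simpa using h

/-- A parallel section is determined by its value at one point. -/
theorem exp_smul_eq_of_covDeriv_eq_zero (m : V →ₗ[ℝ] ℂ) [FiniteDimensional ℝ V] {f : V → E}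
    (hf : ContDiff ℝ ∞ f) (h : ∀ w v, covDeriv m w f v = 0) (v : V) :
    Complex.exp (m v) • f v = f 0 := by
  set m' : V →L[ℝ] ℂ := LinearMap.toContinuousLinearMap m with hm'
  have hd : ∀ v, HasFDerivAt (fun v => Complex.exp (m' v) • f v) (0 : V →L[ℝ] E) v := by
    intro v
    have h1 : HasFDerivAt (fun v => Complex.exp (m' v)) (Complex.exp (m' v) • m') v :=
      m'.hasFDerivAt.cexp
    refine (h1.smul (hf.differentiable (by simp) v).hasFDerivAt).congr_fderiv ?_
    ext w
    have h2 := h w v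
    rw [covDeriv] at h2
    change Complex.exp (m' v) • fderiv ℝ f v w + (Complex.exp (m' v) * m w) • f v = 0
    rw [mul_smul, ← smul_add, h2, smul_zero]
  have h3 := is_const_of_fderiv_eq_zero (𝕜 := ℝ) (fun v => (hd v).differentiableAt)
    (fun v => (hd v).fderiv) v 0
  simpa [hm'] using h3

end Periodic

/-- A basis is selected from the spanning lattice vectors. It may generate only a sublattice of the
integral lattice of `𝔥`, which is enough for a box of periods. -/
theorem IsRational.exists_basis {n : ℕ} {𝔥 : Submodule ℝ (Fin n → ℝ)} (h : IsRational 𝔥) :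
    ∃ (k : ℕ) (a : Module.Basis (Fin k) ℝ 𝔥), ∀ i, (a i : Fin n → ℝ) ∈ lattice n := by
  set S : Set 𝔥 := {v | (v : Fin n → ℝ) ∈ lattice n} with hS
  have hspan : Submodule.span ℝ S = ⊤ := by
    refine Submodule.map_injective_of_injective 𝔥.injective_subtype ?_
    rw [Submodule.map_span, Submodule.map_subtype_top]
    have e : 𝔥.subtype '' S = (𝔥 : Set (Fin n → ℝ)) ∩ lattice n := by
      ext v
      simp [hS, and_comm]
    rw [e]
    exact h
  obtain ⟨b, hbS, hbs, hli⟩ := exists_linearIndependent ℝ S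
  set B := Module.Basis.mk hli (by rw [Subtype.range_coe, hbs, hspan])
  have : Fintype b := FiniteDimensional.fintypeBasisIndex B
  refine ⟨_, B.reindex (Fintype.equivFin b), fun i => ?_⟩
  rw [Module.Basis.reindex_apply, Module.Basis.mk_apply]
  exact hbS (Subtype.coe_prop _)

/-- A periodic solution is parallel, so `exp(2π√-1 ⟨μ, u⟩) f(u) = f(0)`. A lattice vector `u` with
`⟨μ, u⟩` not an integer, where `f(u) = f(0)`, leaves only `f(0) = 0`. -/
theorem forall_eq_zero_of_constDirac_eq_zero {n : ℕ} {E : Type*} [NormedAddCommGroup E]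
    [InnerProductSpace ℂ E] [FiniteDimensional ℂ E] {𝔥 : Submodule ℝ (Fin n → ℝ)} (hrat : IsRational 𝔥)
    {ι : Type*} [Fintype ι] [DecidableEq ι] {p : Matrix ι ι ℝ} (hpos : p.PosDef)
    (c : ι → E →ₗ[ℂ] E) (b : Module.Basis ι ℝ 𝔥)
    (hp : ∀ i k ξ, c i (c k ξ) + c k (c i ξ) = (-(2 * (p i k : ℝ)) : ℂ) • ξ)
    {μ : Fin n → ℝ} (hμ : ¬ IsWeightOn 𝔥 μ) {f : 𝔥 → E} (hf : ContDiff ℝ ∞ f)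
    (hper : ∀ v a : 𝔥, (a : Fin n → ℝ) ∈ lattice n → f (v + a) = f v)
    (h0 : ∀ v, constDirac p⁻¹ c
      (fun j => (2 * Real.pi * Complex.I * (μ ⬝ᵥ (b j : Fin n → ℝ) : ℝ) : ℂ)) b f v = 0) (v : 𝔥) :
    f v = 0 := by
  obtain ⟨k, a, ha⟩ := hrat.exists_basis
  set m : 𝔥 →ₗ[ℝ] ℂ :=
    { toFun := fun v => 2 * Real.pi * Complex.I * (μ ⬝ᵥ (v : Fin n → ℝ) : ℝ)
      map_add' := fun v w => by rw [Submodule.coe_add, dotProduct_add]; push_cast; ring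
      map_smul' := fun r v => by
        rw [Submodule.coe_smul, dotProduct_smul, smul_eq_mul, RingHom.id_apply, Complex.real_smul]
        push_cast; ring } with hm
  have hmv : ∀ v : 𝔥, m v = 2 * Real.pi * Complex.I * (μ ⬝ᵥ (v : Fin n → ℝ) : ℝ) := fun v => rfl
  have h1 := covDeriv_eq_zero_of_periodic a hpos c m (fun v => by simp [hmv]) b hp hf
    (fun i v => hper v (a i) (ha i)) h0
  have h2 : ∀ w v, covDeriv m w f v = 0 := by
    intro w v
    rw [← b.sum_repr w, covDeriv_sum]
    exact Finset.sum_eq_zero fun l _ => by rw [h1, smul_zero]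
  have h3 := exp_smul_eq_of_covDeriv_eq_zero m hf h2
  have h4 : f 0 = 0 := by
    simp only [IsWeightOn, not_forall] at hμ
    obtain ⟨u, hu, hul, hk⟩ := hμ
    have h5 := h3 ⟨u, hu⟩
    have h6 := hper 0 ⟨u, hu⟩ hul
    rw [zero_add] at h6
    rw [h6] at h5
    by_contra hne
    have h7 : Complex.exp (m ⟨u, hu⟩) = 1 :=
      smul_left_injective ℂ hne (h5.trans (one_smul ℂ _).symm)
    rw [Complex.exp_eq_one_iff] at h7
    obtain ⟨j, hj⟩ := h7
    refine hk ⟨j, ?_⟩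
    have h8 : (2 * Real.pi * Complex.I) ≠ 0 := Complex.two_pi_I_ne_zero
    rw [hmv, mul_comm, mul_comm (j : ℂ)] at hj
    have h9 : ((μ ⬝ᵥ u : ℝ) : ℂ) = (j : ℂ) := by
      apply mul_left_cancel₀ h8
      rw [← hj, mul_comm]
    exact_mod_cast h9
  have h5 := h3 v
  rw [h4] at h5
  exact (smul_eq_zero.1 h5).resolve_left (Complex.exp_ne_zero _)

variable {n : ℕ} {M : Type*} [TopologicalSpace M] [ChartedSpace (Model n) M]
  [IsManifold (𝓡 (2 * n)) ∞ M] {X : ToricOrigami n M} {g : Metric n M}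
  {FW : Type*} [NormedAddCommGroup FW] [NormedSpace ℂ FW] [FiniteDimensional ℂ FW]
  {W : M → Type*} [∀ x, NormedAddCommGroup (W x)] [∀ x, InnerProductSpace ℂ (W x)]
  [TopologicalSpace (TotalSpace FW W)] [FiberBundle FW W] [VectorBundle ℝ FW W]
  [VectorBundle ℂ FW W] [ContMDiffVectorBundle ∞ FW W (𝓡 (2 * n))]
  {L : M → Type*} [∀ x, NormedAddCommGroup (L x)] [∀ x, InnerProductSpace ℂ (L x)]
  [TopologicalSpace (TotalSpace ℂ L)] [FiberBundle ℂ L] [VectorBundle ℝ ℂ L]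
  [VectorBundle ℂ ℂ L] [ContMDiffVectorBundle ∞ ℂ L (𝓡 (2 * n))]
  (R : CliffordBundle X.toTorusAction g FW W) (P : Prequantization X L)
  [T2Space M]

/-- The Dirac operator along a leaf has no kernel if the moment map is not a weight there. -/
theorem eq_zero_of_leafDirac_eq_zero (hg : IsInvariantMetric X.toTorusAction g)
    {𝔥 : Submodule ℝ (Fin n → ℝ)} (hrat : IsRational 𝔥) {x : M}
    (hfree : ∀ v ∈ 𝔥, X.field v x = 0 → v = 0) (hμ : ¬ IsWeightOn 𝔥 (X.μ x))
    {σ : ∀ v : 𝔥, W (X.act v x) ⊗[ℂ] L (X.act v x)} (hσ : IsLeafSection R P 𝔥 x σ)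
    (h0 : ∀ v, leafDirac R P 𝔥 x σ v = 0) (v : 𝔥) : σ v = 0 := by
  have := finiteDimensional_tensor FW (W := W) (L := L) x
  have h := forall_eq_zero_of_constDirac_eq_zero hrat (gram_posDef (g := g) hfree)
    (fun i => cliff R L x (X.field (Module.finBasis ℝ 𝔥 i) x)) (Module.finBasis ℝ 𝔥)
    (fun i k ξ => cliff_anticomm R x _ _ ξ) hμ hσ.1 hσ.2 (fun v => by
      have h1 := h0 v
      rw [leafDirac_eq R P hg] at h1
      exact (tensorLift R P v x).map_eq_zero_iff.1 h1) v
  exact (tensorLift R P v x).symm.map_eq_zero_iff.1 h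

end

/-! ### The top power of the form and the fold. -/

section

section Pfaffian

variable {n : ℕ} {V : Type*} [AddCommGroup V] [Module ℝ V]

theorem prod_eq_of_update {n : ℕ} {f f' : Fin n → ℝ} (i₀ : Fin n) (h : ∀ i ≠ i₀, f i = f' i) :
    ∏ i, f i = f i₀ * ∏ i ∈ Finset.univ.erase i₀, f' i := by
  rw [← Finset.mul_prod_erase Finset.univ f (Finset.mem_univ i₀)]
  congr 1
  exact Finset.prod_congr rfl fun i hi => h i (Finset.ne_of_mem_erase hi)

/-- The product of the values of a bilinear form on the successive pairs of vectors. -/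
def pairProd (n : ℕ) (B : V →ₗ[ℝ] V →ₗ[ℝ] ℝ) : MultilinearMap ℝ (fun _ : Fin (2 * n) => V) ℝ where
  toFun e := ∏ i : Fin n, B (e ⟨2 * i, by omega⟩) (e ⟨2 * i + 1, by omega⟩)
  map_update_add' e j x y := by
    have hj := j.2
    set i₀ : Fin n := ⟨j / 2, by omega⟩ with hi₀
    have hne : ∀ z (i : Fin n), i ≠ i₀ →
        B (Function.update e j z ⟨2 * i, by omega⟩) (Function.update e j z ⟨2 * i + 1, by omega⟩) =
          B (e ⟨2 * i, by omega⟩) (e ⟨2 * i + 1, by omega⟩) := by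
      intro z i hi
      have h : (i : ℕ) ≠ j / 2 := fun h => hi (Fin.ext h)
      rw [Function.update_of_ne, Function.update_of_ne] <;>
        · intro h'
          have := congrArg Fin.val h'
          simp only at this
          omega
    rw [prod_eq_of_update i₀ (hne _), prod_eq_of_update i₀ (hne _), prod_eq_of_update i₀ (hne _),
      ← add_mul]
    congr 1
    rcases Nat.even_or_odd' (j : ℕ) with ⟨k, hk | hk⟩
    · have e1 : (⟨2 * (i₀ : ℕ), by omega⟩ : Fin (2 * n)) = j := by
        ext; simp only [hi₀]; omega
      have e2 : (⟨2 * (i₀ : ℕ) + 1, by omega⟩ : Fin (2 * n)) ≠ j := by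
        intro h; have := congrArg Fin.val h; simp only [hi₀] at this; omega
      simp only [e1, Function.update_self, Function.update_of_ne e2, map_add, LinearMap.add_apply]
    · have e1 : (⟨2 * (i₀ : ℕ), by omega⟩ : Fin (2 * n)) ≠ j := by
        intro h; have := congrArg Fin.val h; simp only [hi₀] at this; omega
      have e2 : (⟨2 * (i₀ : ℕ) + 1, by omega⟩ : Fin (2 * n)) = j := by
        ext; simp only [hi₀]; omega
      simp only [e2, Function.update_self, Function.update_of_ne e1, map_add]
  map_update_smul' e j c x := by
    have hj := j.2
    set i₀ : Fin n := ⟨j / 2, by omega⟩ with hi₀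
    have hne : ∀ z (i : Fin n), i ≠ i₀ →
        B (Function.update e j z ⟨2 * i, by omega⟩) (Function.update e j z ⟨2 * i + 1, by omega⟩) =
          B (e ⟨2 * i, by omega⟩) (e ⟨2 * i + 1, by omega⟩) := by
      intro z i hi
      have h : (i : ℕ) ≠ j / 2 := fun h => hi (Fin.ext h)
      rw [Function.update_of_ne, Function.update_of_ne] <;>
        · intro h'
          have := congrArg Fin.val h'
          simp only at this
          omega
    rw [prod_eq_of_update i₀ (hne _), prod_eq_of_update i₀ (hne _), smul_eq_mul, ← mul_assoc]
    congr 1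
    rcases Nat.even_or_odd' (j : ℕ) with ⟨k, hk | hk⟩
    · have e1 : (⟨2 * (i₀ : ℕ), by omega⟩ : Fin (2 * n)) = j := by
        ext; simp only [hi₀]; omega
      have e2 : (⟨2 * (i₀ : ℕ) + 1, by omega⟩ : Fin (2 * n)) ≠ j := by
        intro h; have := congrArg Fin.val h; simp only [hi₀] at this; omega
      simp only [e1, Function.update_self, Function.update_of_ne e2, map_smul, LinearMap.smul_apply,
        smul_eq_mul]
    · have e1 : (⟨2 * (i₀ : ℕ), by omega⟩ : Fin (2 * n)) ≠ j := by
        intro h; have := congrArg Fin.val h; simp only [hi₀] at this; omega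
      have e2 : (⟨2 * (i₀ : ℕ) + 1, by omega⟩ : Fin (2 * n)) = j := by
        ext; simp only [hi₀]; omega
      simp only [e2, Function.update_self, Function.update_of_ne e1, map_smul, smul_eq_mul]

/-- The top power of a bilinear form on a space of dimension `2n`, up to a factor. -/
def pfaffian (n : ℕ) (B : V →ₗ[ℝ] V →ₗ[ℝ] ℝ) : V [⋀^Fin (2 * n)]→ₗ[ℝ] ℝ :=
  MultilinearMap.alternatization (pairProd n B)

theorem pfaffian_apply (B : V →ₗ[ℝ] V →ₗ[ℝ] ℝ) (e : Fin (2 * n) → V) :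
    pfaffian n B e = ∑ σ : Equiv.Perm (Fin (2 * n)), ((Equiv.Perm.sign σ : ℤ) : ℝ) *
      ∏ i : Fin n, B (e (σ ⟨2 * i, by omega⟩)) (e (σ ⟨2 * i + 1, by omega⟩)) := by
  rw [pfaffian, MultilinearMap.alternatization_apply]
  refine Finset.sum_congr rfl fun σ _ => ?_
  rw [Units.smul_def, zsmul_eq_mul]
  rfl

end Pfaffian

variable {n : ℕ} {M : Type*} [TopologicalSpace M] [ChartedSpace (Model n) M]
  [IsManifold (𝓡 (2 * n)) ∞ M]

/-- A continuous bilinear form as a bilinear form. -/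
def bilinOfCLM {V : Type*} [NormedAddCommGroup V] [NormedSpace ℝ V] (B : V →L[ℝ] V →L[ℝ] ℝ) :
    V →ₗ[ℝ] V →ₗ[ℝ] ℝ :=
  LinearMap.mk₂ ℝ (fun u w => B u w) (fun u u' w => by rw [map_add]; rfl)
    (fun c u w => by rw [map_smul]; rfl) (fun u w w' => by rw [map_add])
    (fun c u w => by rw [map_smul])

/-- The bilinear form of a covariant 2-tensor field at a point, on the model space. -/
def bilinAt (Ω : TwoTensor n M) (x : M) : Model n →ₗ[ℝ] Model n →ₗ[ℝ] ℝ := bilinOfCLM (Ω x)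

/-- The differential of the inverse of the chart at `x₀`, on the model space. -/
def chartFrame (x₀ : M) (y : Model n) : Model n →L[ℝ] Model n :=
  mfderiv 𝓘(ℝ, Model n) (𝓡 (2 * n)) (extChartAt (𝓡 (2 * n)) x₀).symm y

theorem chartFrame_injective {x₀ : M} {y : Model n} (hy : y ∈ (extChartAt (𝓡 (2 * n)) x₀).target) :
    Function.Injective (chartFrame x₀ y) := by
  set ψ := extChartAt (𝓡 (2 * n)) x₀
  have h1 : HasMFDerivAt 𝓘(ℝ, Model n) 𝓘(ℝ, Model n) (ψ ∘ ψ.symm) y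
      ((mfderiv (𝓡 (2 * n)) 𝓘(ℝ, Model n) ψ (ψ.symm y)).comp
        (mfderiv 𝓘(ℝ, Model n) (𝓡 (2 * n)) ψ.symm y)) :=
    (mdifferentiableAt_chart (ψ.map_target hy)).hasMFDerivAt.comp y
      (mdifferentiableAt_chart_symm hy).hasMFDerivAt
  have h2 : ψ ∘ ψ.symm =ᶠ[𝓝 y] id := by
    filter_upwards [(isOpen_chartTarget (n := n) x₀).mem_nhds hy] with z hz
    exact ψ.right_inv hz
  have h3 := hasMFDerivAt_unique (h1.congr_of_eventuallyEq h2.symm) (hasMFDerivAt_id y)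
  intro u w h
  have h4 : ∀ u : Model n, mfderiv (𝓡 (2 * n)) 𝓘(ℝ, Model n) ψ (ψ.symm y) (chartFrame x₀ y u) = u :=
    fun u => congrArg (fun l : Model n →L[ℝ] Model n => l u) h3
  rw [← h4 u, ← h4 w, h]

/-- A top degree alternating form is multiplied by `det T` under `T`. -/
theorem pfaffian_comp_eq_zero_iff (B : Model n →ₗ[ℝ] Model n →ₗ[ℝ] ℝ) {T : Model n →L[ℝ] Model n}
    (hT : Function.Injective T) :
    pfaffian n B (fun j => T (stdVec n j)) = 0 ↔ pfaffian n B (fun j => stdVec n j) = 0 := by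
  set b := (EuclideanSpace.basisFun (Fin (2 * n)) ℝ).toBasis with hb
  have hbe : ⇑b = fun j => stdVec n j := by
    funext j; simp [hb, stdVec]
  have h1 := (pfaffian n B).eq_smul_basis_det b
  have h2 := congrArg (fun f : (Model n) [⋀^Fin (2 * n)]→ₗ[ℝ] ℝ => f (fun j => T (stdVec n j))) h1
  simp only [AlternatingMap.smul_apply, smul_eq_mul, hbe] at h2
  have h3 : b.det (fun j => T (stdVec n j)) = LinearMap.det T.toLinearMap := by
    have := b.det_comp T.toLinearMap b
    rw [b.det_self, mul_one, hbe] at this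
    exact this
  have h4 : LinearMap.det T.toLinearMap ≠ 0 := by
    have : IsUnit (LinearMap.det T.toLinearMap) :=
      LinearMap.isUnit_det _ ((LinearMap.isUnit_iff_ker_eq_bot _).2 (LinearMap.ker_eq_bot.2 hT))
    exact this.ne_zero
  rw [h2, h3]
  simp [h4]

theorem topPower_eq_zero_iff (Ω : TwoTensor n M) {x₀ x : M}
    (hx : x ∈ (extChartAt (𝓡 (2 * n)) x₀).source) :
    topPower Ω x₀ x = 0 ↔ pfaffian n (bilinAt Ω x) (fun j => stdVec n j) = 0 := by
  set ψ := extChartAt (𝓡 (2 * n)) x₀ with hψ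
  have h1 : topPower Ω x₀ x =
      pfaffian n (bilinAt Ω (ψ.symm (ψ x))) (fun j => chartFrame x₀ (ψ x) (stdVec n j)) := by
    rw [pfaffian_apply]
    rfl
  rw [h1, pfaffian_comp_eq_zero_iff _ (chartFrame_injective (ψ.map_source hx)), ψ.left_inv hx]

/-- The fold is defined with the chart at each of its points. A coordinate change multiplies the top
power by a non-zero determinant, so near `x₀` the fold is the zero set of one smooth function. -/
theorem mem_fold_iff (Ω : TwoTensor n M) {x₀ x : M}
    (hx : x ∈ (extChartAt (𝓡 (2 * n)) x₀).source) : x ∈ fold Ω ↔ topPower Ω x₀ x = 0 := by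
  rw [topPower_eq_zero_iff Ω hx]
  exact (topPower_eq_zero_iff Ω (mem_extChartAt_source (I := 𝓡 (2 * n)) x))

theorem contMDiffAt_topPower {Ω : TwoTensor n M} (hΩ : ContMDiff (𝓡 (2 * n))
    ((𝓡 (2 * n)).prod 𝓘(ℝ, Model n →L[ℝ] Model n →L[ℝ] ℝ)) ∞
    (fun x ↦ TotalSpace.mk' (Model n →L[ℝ] Model n →L[ℝ] ℝ) x (Ω x))) (x : M) :
    ContMDiffAt (𝓡 (2 * n)) 𝓘(ℝ, ℝ) ∞ (topPower Ω x) x := by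
  have h1 : ContDiffAt ℝ ∞ (fun y => ∑ σ : Equiv.Perm (Fin (2 * n)), ((Equiv.Perm.sign σ : ℤ) : ℝ) *
      ∏ i : Fin n, chartCoeff Ω x (stdVec n (σ ⟨2 * i, by omega⟩))
        (stdVec n (σ ⟨2 * i + 1, by omega⟩)) y) (extChartAt (𝓡 (2 * n)) x x) :=
    ContDiffAt.sum fun σ _ => contDiffAt_const.mul
      (contDiffAt_prod fun i _ => contDiffAt_chartCoeff hΩ (mem_extChartAt_target x) _ _)
  exact h1.contMDiffAt.comp x (contMDiffAt_chart (mem_extChartAt_source x))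

theorem isClosed_fold {Ω : TwoTensor n M} (hΩ : ContMDiff (𝓡 (2 * n))
    ((𝓡 (2 * n)).prod 𝓘(ℝ, Model n →L[ℝ] Model n →L[ℝ] ℝ)) ∞
    (fun x ↦ TotalSpace.mk' (Model n →L[ℝ] Model n →L[ℝ] ℝ) x (Ω x))) : IsClosed (fold Ω) := by
  rw [← isOpen_compl_iff, isOpen_iff_mem_nhds]
  intro x hx
  have h := (contMDiffAt_topPower hΩ x).continuousAt.eventually_ne hx
  filter_upwards [h, (isOpen_extChartAt_source (I := 𝓡 (2 * n)) x).mem_nhds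
    (mem_extChartAt_source x)] with y hy hys
  rw [mem_compl_iff, mem_fold_iff Ω hys]
  exact hy

end

/-! ### Cartan's formula for the connection form. -/

section

/-- Cartan's formula for a 1-form that is invariant under a flow and is constant on its generator. -/
theorem fderiv_symm_of_invariant {E : Type*} [NormedAddCommGroup E] [NormedSpace ℝ E] {F : ℝ × E → E}
    {b : E → E →L[ℝ] ℝ} {y₀ : E} (hF : ContDiffAt ℝ ∞ F (0, y₀)) (hb : DifferentiableAt ℝ b y₀)
    (hF0 : ∀ᶠ y in 𝓝 y₀, F (0, y) = y) (h1 : ∀ᶠ y in 𝓝 y₀, b y (fderiv ℝ F (0, y) (1, 0)) = 1) (w : E)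
    (h2 : ∀ᶠ τ in 𝓝 (0 : ℝ), b (F (τ, y₀)) (fderiv ℝ F (τ, y₀) (0, w)) = b y₀ w) :
    fderiv ℝ b y₀ (fderiv ℝ F (0, y₀) (1, 0)) w = fderiv ℝ b y₀ w (fderiv ℝ F (0, y₀) (1, 0)) := by
  have hF1 : HasFDerivAt F (fderiv ℝ F (0, y₀)) (0, y₀) :=
    (hF.differentiableAt (by simp)).hasFDerivAt
  have hD : HasFDerivAt (fderiv ℝ F) (fderiv ℝ (fderiv ℝ F) (0, y₀)) (0, y₀) :=
    ((hF.fderiv_right (m := ∞) (by simp)).differentiableAt (by simp)).hasFDerivAt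
  have hs : IsSymmSndFDerivAt ℝ F (0, y₀) :=
    hF.isSymmSndFDerivAt
      (by rw [minSmoothness_of_isRCLikeNormedField]; exact WithTop.coe_le_coe.2 (le_top (a := (2 : ℕ∞))))
  have hc : HasDerivAt (fun τ : ℝ => (τ, y₀)) ((1 : ℝ), (0 : E)) 0 :=
    (hasDerivAt_id (0 : ℝ)).prodMk (hasDerivAt_const 0 y₀)
  have hi : HasFDerivAt (fun y : E => ((0 : ℝ), y)) (ContinuousLinearMap.inr ℝ ℝ E) y₀ :=
    hasFDerivAt_prodMk_right 0 y₀
  have e0 : F (0, y₀) = y₀ := hF0.self_of_nhds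
  -- The flow at time `0` is the identity, and so is its derivative in space.
  have hid : ∀ w, fderiv ℝ F (0, y₀) (0, w) = w := by
    intro w
    have h3 := (hF1.comp y₀ hi).congr_of_eventuallyEq
      (show (fun y => y) =ᶠ[𝓝 y₀] _ from by filter_upwards [hF0] with y hy; exact hy.symm)
    exact congrArg (fun l : E →L[ℝ] E => l w) (h3.unique (hasFDerivAt_id y₀))
  have hb' : HasFDerivAt b (fderiv ℝ b y₀) (F (0, y₀)) := by rw [e0]; exact hb.hasFDerivAt
  have hγ : HasDerivAt (fun τ : ℝ => b (F (τ, y₀))) (fderiv ℝ b y₀ (fderiv ℝ F (0, y₀) (1, 0))) 0 :=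
    hb'.comp_hasDerivAt (0 : ℝ) (hF1.comp_hasDerivAt (0 : ℝ) hc)
  have hDa : ∀ r : ℝ × E, HasFDerivAt (fun q => fderiv ℝ F q r)
      ((fderiv ℝ (fderiv ℝ F) (0, y₀)).flip r) (0, y₀) := fun r => by
    have h := hD.clm_apply (hasFDerivAt_const r ((0 : ℝ), y₀))
    rwa [ContinuousLinearMap.comp_zero, zero_add] at h
  have hδ : HasDerivAt (fun τ : ℝ => fderiv ℝ F (τ, y₀) (0, w))
      (fderiv ℝ (fderiv ℝ F) (0, y₀) (1, 0) (0, w)) 0 :=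
    HasFDerivAt.comp_hasDerivAt (l := fun q => fderiv ℝ F q (0, w)) (f := fun τ : ℝ => (τ, y₀))
      (l' := (fderiv ℝ (fderiv ℝ F) (0, y₀)).flip (0, w)) (0 : ℝ) (hDa (0, w)) hc
  -- Invariance under the flow, differentiated at time `0`.
  have k2 : fderiv ℝ b y₀ (fderiv ℝ F (0, y₀) (1, 0)) w +
      b y₀ (fderiv ℝ (fderiv ℝ F) (0, y₀) (1, 0) (0, w)) = 0 := by
    have h := ((hγ.clm_apply hδ).congr_of_eventuallyEq (f₁ := fun _ => b y₀ w)
      (by filter_upwards [h2] with τ hτ; exact hτ.symm)).unique (hasDerivAt_const (0 : ℝ) (b y₀ w))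
    rwa [hid, e0] at h
  have hε : HasFDerivAt (fun y => fderiv ℝ F (0, y) (1, 0))
      (((fderiv ℝ (fderiv ℝ F) (0, y₀)).flip (1, 0)).comp (ContinuousLinearMap.inr ℝ ℝ E)) y₀ :=
    (hDa (1, 0)).comp y₀ hi
  -- The normalization on the generator, differentiated in the direction `w`. It contains the same
  -- mixed second derivative of `F` as `k2`, by symmetry, and the difference of the two is the
  -- claim.
  have k3 : fderiv ℝ b y₀ w (fderiv ℝ F (0, y₀) (1, 0)) +
      b y₀ (fderiv ℝ (fderiv ℝ F) (0, y₀) (0, w) (1, 0)) = 0 := by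
    have h := ((hb.hasFDerivAt.clm_apply hε).congr_of_eventuallyEq (f₁ := fun _ => (1 : ℝ))
      (by filter_upwards [h1] with y hy; exact hy.symm)).unique (hasFDerivAt_const (1 : ℝ) y₀)
    have h' := congrArg (fun l : E →L[ℝ] ℝ => l w) h
    rw [add_comm]
    exact h'
  rw [hs.eq (1, 0) (0, w)] at k2
  exact add_right_cancel (k2.trans k3.symm)

variable {n : ℕ} {M : Type*} [TopologicalSpace M] [ChartedSpace (Model n) M]
  [IsManifold (𝓡 (2 * n)) ∞ M]

/-- The 1-form `β` in the chart at `x₀`. -/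
def chartForm (β : OneForm n M) (x₀ : M) (y : Model n) : Model n →L[ℝ] ℝ :=
  (β ((extChartAt (𝓡 (2 * n)) x₀).symm y) : Model n →L[ℝ] ℝ).comp (chartFrame x₀ y)

theorem chartForm_chart (β : OneForm n M) {x₀ x : M} (hx : x ∈ (extChartAt (𝓡 (2 * n)) x₀).source)
    (u : TangentSpace (𝓡 (2 * n)) x) :
    chartForm β x₀ (extChartAt (𝓡 (2 * n)) x₀ x)
      (mfderiv (𝓡 (2 * n)) 𝓘(ℝ, Model n) (extChartAt (𝓡 (2 * n)) x₀) x u) = β x u := by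
  set ψ := extChartAt (𝓡 (2 * n)) x₀
  have h1 : HasMFDerivAt (𝓡 (2 * n)) (𝓡 (2 * n)) (ψ.symm ∘ ψ) x
      ((mfderiv 𝓘(ℝ, Model n) (𝓡 (2 * n)) ψ.symm (ψ x)).comp
        (mfderiv (𝓡 (2 * n)) 𝓘(ℝ, Model n) ψ x)) :=
    (mdifferentiableAt_chart_symm (ψ.map_source hx)).hasMFDerivAt.comp x
      (mdifferentiableAt_chart hx).hasMFDerivAt
  have h2 : ψ.symm ∘ ψ =ᶠ[𝓝 x] id := by
    filter_upwards [(isOpen_extChartAt_source (I := 𝓡 (2 * n)) x₀).mem_nhds hx] with z hz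
    exact ψ.left_inv hz
  have h3 := hasMFDerivAt_unique (h1.congr_of_eventuallyEq h2.symm) (hasMFDerivAt_id x)
  have h4 := congrArg (fun l : Model n →L[ℝ] Model n => l u) h3
  have hcongr : ∀ z z' : M, z = z' → ∀ a : Model n,
      (β z : Model n →L[ℝ] ℝ) a = (β z' : Model n →L[ℝ] ℝ) a := by
    rintro z _ rfl a; rfl
  refine (hcongr _ _ (ψ.left_inv hx) _).trans ?_
  exact congrArg (β x : Model n →L[ℝ] ℝ) h4

theorem differentiableAt_chartForm {β : OneForm n M} {O : Set M} (hO : IsOpen O)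
    (hβ : ContMDiffOn (𝓡 (2 * n)) ((𝓡 (2 * n)).prod 𝓘(ℝ, Model n →L[ℝ] ℝ)) ∞
      (fun x ↦ TotalSpace.mk' (Model n →L[ℝ] ℝ)
        (E := fun x : M => TangentSpace (𝓡 (2 * n)) x →L[ℝ] ℝ) x (β x)) O) {x : M} (hx : x ∈ O) :
    DifferentiableAt ℝ (chartForm β x) (extChartAt (𝓡 (2 * n)) x x) := by
  set ψ := extChartAt (𝓡 (2 * n)) x with hψ
  set U := ψ.target ∩ ψ.symm ⁻¹' O with hU
  have hUo : IsOpen U := (continuousOn_extChartAt_symm x).isOpen_inter_preimage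
    (isOpen_chartTarget (n := n) x) hO
  have hxU : ψ x ∈ U := ⟨mem_extChartAt_target x, by
    rw [mem_preimage, hψ, extChartAt_to_inv]; exact hx⟩
  have h : ContDiffOn ℝ ∞ (chartForm β x) U := by
    rw [contDiffOn_clm_apply]
    intro w y hy
    have : ContMDiffAt 𝓘(ℝ, Model n) ((𝓡 (2 * n)).prod 𝓘(ℝ, ℝ)) ∞
        (fun y ↦ TotalSpace.mk' ℝ (E := Bundle.Trivial M ℝ) (ψ.symm y)
          (β (ψ.symm y) (chartVec x y w))) y := by
      apply ContMDiffAt.clm_bundle_apply (F₁ := Model n)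
        (E₁ := fun x : M => TangentSpace (𝓡 (2 * n)) x)
      · exact (hβ.contMDiffAt (hO.mem_nhds hy.2)).comp y (contMDiffAt_chart_symm hy.1)
      · exact contMDiffAt_chartVec hy.1 w
    simp only [contMDiffAt_totalSpace] at this
    exact this.2.contDiffAt.contDiffWithinAt
  exact (h.contDiffAt (hUo.mem_nhds hxU)).differentiableAt (by simp)

/-- Cartan: `ι_v dβ = ℒ_v β - d(β(v))`, and both terms vanish for an invariant form with `β(v) = 1`.
The computation is carried out for the flow read in the chart at `x`. -/
theorem extDerivOne_field_eq_zero (A : TorusAction n M) {β : OneForm n M} {O : Set M} (hO : IsOpen O)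
    (hβ : ContMDiffOn (𝓡 (2 * n)) ((𝓡 (2 * n)).prod 𝓘(ℝ, Model n →L[ℝ] ℝ)) ∞
      (fun x ↦ TotalSpace.mk' (Model n →L[ℝ] ℝ)
        (E := fun x : M => TangentSpace (𝓡 (2 * n)) x →L[ℝ] ℝ) x (β x)) O)
    (hinv : ∀ x ∈ O, ∀ v (u : TangentSpace (𝓡 (2 * n)) x), β (A.act v x) (A.push v x u) = β x u)
    {v : Fin n → ℝ} (hv : ∀ x ∈ O, β x (A.field v x) = 1) {x : M} (hx : x ∈ O)
    (u : TangentSpace (𝓡 (2 * n)) x) : extDerivOne β x (A.field v x) u = 0 := by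
  set ψ := extChartAt (𝓡 (2 * n)) x with hψ
  have hxs : x ∈ ψ.source := mem_extChartAt_source x
  have hxt : ψ x ∈ ψ.target := mem_extChartAt_target x
  have hinvx : ψ.symm (ψ x) = x := ψ.left_inv hxs
  set F : ℝ × Model n → Model n := fun q => ψ (A.act (q.1 • v) (ψ.symm q.2)) with hFdef
  have hFc : ∀ τ y, y ∈ ψ.target → A.act (τ • v) (ψ.symm y) ∈ ψ.source → ContDiffAt ℝ ∞ F (τ, y) := by
    intro τ y hy hs
    have h1 : ContMDiffAt 𝓘(ℝ, ℝ × Model n) (𝓘(ℝ, ℝ).prod (𝓡 (2 * n))) ∞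
        (fun q : ℝ × Model n => (q.1, ψ.symm q.2)) (τ, y) :=
      (contDiff_fst.contMDiff.contMDiffAt).prodMk
        (ContMDiffAt.comp (τ, y) (g := ψ.symm) (f := Prod.snd) (contMDiffAt_chart_symm hy)
          contDiff_snd.contMDiff.contMDiffAt)
    have h2 : ContMDiffAt 𝓘(ℝ, ℝ × Model n) (𝓡 (2 * n)) ∞
        (fun q : ℝ × Model n => A.act (q.1 • v) (ψ.symm q.2)) (τ, y) :=
      ContMDiffAt.comp (τ, y) (g := fun q : ℝ × M => A.act (q.1 • v) q.2)
        (A.contMDiff_flow v _) h1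
    exact (ContMDiffAt.comp (τ, y) (contMDiffAt_chart hs) h2).contDiffAt
  have hact0 : ∀ z, A.act ((0 : ℝ) • v) z = z := fun z => by rw [zero_smul, A.act_zero]
  have htgt : ∀ᶠ y in 𝓝 (ψ x), y ∈ ψ.target := (isOpen_chartTarget (n := n) x).mem_nhds hxt
  have hFc0 : ∀ y ∈ ψ.target, ContDiffAt ℝ ∞ F (0, y) := fun y hy =>
    hFc 0 y hy (by rw [hact0]; exact ψ.map_target hy)
  have hξ : ∀ y ∈ ψ.target, fderiv ℝ F (0, y) (1, 0) =
      (mfderiv (𝓡 (2 * n)) 𝓘(ℝ, Model n) ψ (ψ.symm y) (A.field v (ψ.symm y)) : Model n) := by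
    intro y hy
    have h1 := A.hasDerivAt_comp_curve (mdifferentiableAt_chart (ψ.map_target hy)) v
    have hc : HasDerivAt (fun τ : ℝ => (τ, y)) ((1 : ℝ), (0 : Model n)) 0 :=
      (hasDerivAt_id (0 : ℝ)).prodMk (hasDerivAt_const 0 y)
    have h2 := ((hFc0 y hy).differentiableAt (by simp)).hasFDerivAt.comp_hasDerivAt (0 : ℝ) hc
    exact h2.unique h1
  have hξ0 : fderiv ℝ F (0, ψ x) (1, 0) = chartCoord x (A.field v x) := by
    rw [hξ _ hxt]
    have hcongr : ∀ z z' : M, z = z' →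
        (mfderiv (𝓡 (2 * n)) 𝓘(ℝ, Model n) ψ z (A.field v z) : Model n) =
          mfderiv (𝓡 (2 * n)) 𝓘(ℝ, Model n) ψ z' (A.field v z') := by
      rintro z _ rfl; rfl
    exact hcongr _ _ hinvx
  have hb := differentiableAt_chartForm hO hβ hx
  have hOe : ∀ᶠ y in 𝓝 (ψ x), ψ.symm y ∈ O := by
    have hc : ContinuousAt ψ.symm (ψ x) := continuousAt_extChartAt_symm x
    refine hc.eventually (hO.mem_nhds ?_)
    rw [hinvx]; exact hx
  have key := fderiv_symm_of_invariant (b := chartForm β x) (hFc0 _ hxt) hb (by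
      filter_upwards [htgt] with y hy
      simp only [hFdef, hact0]
      exact ψ.right_inv hy) (by
      filter_upwards [htgt, hOe] with y hy hyO
      rw [hξ y hy]
      have e : chartForm β x y = chartForm β x (ψ (ψ.symm y)) := by rw [ψ.right_inv hy]
      rw [e]
      exact (chartForm_chart β (ψ.map_target hy) _).trans (hv _ hyO)) (chartCoord x u) (by
      have hc : ContinuousAt (fun τ : ℝ => A.act (τ • v) (ψ.symm (ψ x))) 0 :=
        (A.contMDiff_curve v _).continuous.continuousAt
      have hmem : A.act ((0 : ℝ) • v) (ψ.symm (ψ x)) ∈ ψ.source := by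
        rw [hact0]; exact ψ.map_target hxt
      filter_upwards [hc.eventually ((isOpen_extChartAt_source (I := 𝓡 (2 * n)) x).mem_nhds hmem)]
        with τ hτ
      have h1 : HasMFDerivAt 𝓘(ℝ, Model n) 𝓘(ℝ, Model n)
          (ψ ∘ (A.act (τ • v) ∘ ψ.symm)) (ψ x) _ :=
        (mdifferentiableAt_chart hτ).hasMFDerivAt.comp (ψ x)
          ((A.mdifferentiableAt_act (τ • v) _).hasMFDerivAt.comp (ψ x)
            (mdifferentiableAt_chart_symm hxt).hasMFDerivAt)
      have h2 : HasFDerivAt (fun y => F (τ, y)) _ (ψ x) :=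
        ((hFc τ _ hxt hτ).differentiableAt (by simp)).hasFDerivAt.comp (ψ x)
          (hasFDerivAt_prodMk_right τ (ψ x))
      have h3 := hasMFDerivAt_unique h1 h2.hasMFDerivAt
      have h4 := congrArg (fun l : Model n →L[ℝ] Model n => l (chartCoord x u)) h3
      have h5 : fderiv ℝ F (τ, ψ x) (0, chartCoord x u) =
          (mfderiv (𝓡 (2 * n)) 𝓘(ℝ, Model n) ψ (A.act (τ • v) (ψ.symm (ψ x)))
            (A.push (τ • v) (ψ.symm (ψ x)) (chartVec x (ψ x) (chartCoord x u))) : Model n) := h4.symm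
      rw [h5]
      refine (chartForm_chart β hτ _).trans ?_
      exact hinv _ (hOe.self_of_nhds) _ _)
  have hap : ∀ w : Model n, fderiv ℝ (fun y => chartForm β x y w) (ψ x) =
      (fderiv ℝ (chartForm β x) (ψ x)).flip w := by
    intro w
    have := (hb.hasFDerivAt.clm_apply (hasFDerivAt_const w (ψ x))).fderiv
    rw [this, ContinuousLinearMap.comp_zero, zero_add]
  rw [hξ0] at key
  unfold extDerivOne
  have e1 := hap (chartCoord x u)
  have e2 := hap (chartCoord x (A.field v x))
  have e1' := congrArg (fun l : Model n →L[ℝ] ℝ => l (chartCoord x (A.field v x))) e1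
  have e2' := congrArg (fun l : Model n →L[ℝ] ℝ => l (chartCoord x u)) e2
  simp only [ContinuousLinearMap.flip_apply] at e1' e2'
  exact sub_eq_zero.2 (e1'.trans (key.trans e2'.symm))

end

/-! ### The moment map of the null circle in the collar. -/

section

variable {n : ℕ} {M : Type*} [TopologicalSpace M] [ChartedSpace (Model n) M]
  [IsManifold (𝓡 (2 * n)) ∞ M] {X : ToricOrigami n M}

theorem eventually_eq_of_differential_eq_zero {H : M → ℝ} {O : Set M} (hO : IsOpen O)
    (hH : ContMDiffOn (𝓡 (2 * n)) 𝓘(ℝ, ℝ) ∞ H O)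
    (h0 : ∀ x ∈ O, ∀ u : TangentSpace (𝓡 (2 * n)) x, differential n H x u = 0) {x : M} (hx : x ∈ O) :
    ∀ᶠ y in 𝓝 x, H y = H x := by
  set ψ := extChartAt (𝓡 (2 * n)) x with hψ
  set U := ψ.target ∩ ψ.symm ⁻¹' O with hU
  have hUo : IsOpen U := (continuousOn_extChartAt_symm x).isOpen_inter_preimage
    (isOpen_chartTarget (n := n) x) hO
  have hinvx : ψ.symm (ψ x) = x := ψ.left_inv (mem_extChartAt_source x)
  have hxU : ψ x ∈ U := ⟨mem_extChartAt_target x, by rw [mem_preimage, hinvx]; exact hx⟩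
  obtain ⟨r, hr, hrU⟩ := Metric.isOpen_iff.1 hUo _ hxU
  have hd : ∀ y ∈ U, HasFDerivAt (H ∘ ψ.symm) (0 : Model n →L[ℝ] ℝ) y := by
    intro y hy
    have h1 := ((hH.contMDiffAt (hO.mem_nhds hy.2)).mdifferentiableAt (by simp)).hasMFDerivAt.comp y
      (mdifferentiableAt_chart_symm hy.1).hasMFDerivAt
    have h2 := h1.hasFDerivAt
    refine h2.congr_fderiv ?_
    ext u
    exact h0 _ hy.2 _
  have hconst : ∀ y ∈ Metric.ball (ψ x) r, H (ψ.symm y) = H x := by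
    intro y hy
    have h1 := (convex_ball (ψ x) r).is_const_of_fderivWithin_eq_zero (𝕜 := ℝ) (f := H ∘ ψ.symm)
      (fun z hz => (hd z (hrU hz)).differentiableAt.differentiableWithinAt)
      (fun z hz => ((hd z (hrU hz)).hasFDerivWithinAt).fderivWithin
        (Metric.isOpen_ball.uniqueDiffWithinAt hz)) hy (Metric.mem_ball_self hr)
    simpa [hinvx] using h1
  have hc : ContinuousAt ψ x := continuousAt_extChartAt x
  filter_upwards [hc.eventually (Metric.ball_mem_nhds _ hr),
    (isOpen_extChartAt_source (I := 𝓡 (2 * n)) x).mem_nhds (mem_extChartAt_source x)] with y hy hys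
  rw [← hconst _ hy, ψ.left_inv hys]

namespace Collar

variable (K : Collar X)

theorem zero_mem : (0 : ℝ) ∈ Ioo (-K.ε₀) K.ε₀ := ⟨neg_lt_zero.2 K.ε₀_pos, K.ε₀_pos⟩

theorem mem_of_mem_Z {z : M} (hz : z ∈ X.Z) : z ∈ K.𝒰 ∧ K.p z = z ∧ K.t z = 0 := by
  have h := K.map_φ z hz 0 K.zero_mem
  rwa [K.φ_zero z hz] at h

theorem mem_Z_iff {x : M} (hx : x ∈ K.𝒰) : x ∈ X.Z ↔ K.t x = 0 := by
  refine ⟨fun h => (K.mem_of_mem_Z h).2.2, fun h => ?_⟩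
  obtain ⟨h1, -, h3⟩ := K.map_pt x hx
  rw [h, K.φ_zero _ h1] at h3
  rwa [← h3]

theorem act_mem_Z (K : Collar X) {z : M} (hz : z ∈ X.Z) (v : Fin n → ℝ) : X.act v z ∈ X.Z := by
  obtain ⟨h1, -, h3⟩ := K.mem_of_mem_Z hz
  obtain ⟨h4, -, h5⟩ := K.equivariant z h1 v
  rw [K.mem_Z_iff h4, h5, h3]

theorem act_mem_Z_iff (K : Collar X) {x : M} (v : Fin n → ℝ) : X.act v x ∈ X.Z ↔ x ∈ X.Z := by
  refine ⟨fun h => ?_, fun h => K.act_mem_Z h v⟩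
  have := K.act_mem_Z h (-v)
  rwa [X.act_neg_act] at this

theorem contMDiffAt_p {x : M} (hx : x ∈ K.𝒰) : ContMDiffAt (𝓡 (2 * n)) (𝓡 (2 * n)) ∞ K.p x :=
  K.smooth_p.contMDiffAt (K.isOpen.mem_nhds hx)

theorem mdifferentiableAt_p {x : M} (hx : x ∈ K.𝒰) :
    MDifferentiableAt (𝓡 (2 * n)) (𝓡 (2 * n)) K.p x :=
  (K.contMDiffAt_p hx).mdifferentiableAt (by simp)

theorem mdifferentiableAt_t {x : M} (hx : x ∈ K.𝒰) :
    MDifferentiableAt (𝓡 (2 * n)) 𝓘(ℝ, ℝ) K.t x :=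
  (K.smooth_t.contMDiffAt (K.isOpen.mem_nhds hx)).mdifferentiableAt (by simp)

theorem mfderiv_p_field {x : M} (hx : x ∈ K.𝒰) (v : Fin n → ℝ) :
    mfderiv (𝓡 (2 * n)) (𝓡 (2 * n)) K.p x (X.field v x) = X.field v (K.p x) := by
  have e : X.act ((0 : ℝ) • v) x = x := by rw [zero_smul, X.act_zero]
  have h1 : HasMFDerivAt 𝓘(ℝ, ℝ) (𝓡 (2 * n)) (K.p ∘ fun s : ℝ => X.act (s • v) x) 0
      ((mfderiv (𝓡 (2 * n)) (𝓡 (2 * n)) K.p (X.act ((0 : ℝ) • v) x)).comp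
        (mfderiv 𝓘(ℝ, ℝ) (𝓡 (2 * n)) (fun s : ℝ => X.act (s • v) x) 0)) :=
    (K.mdifferentiableAt_p (by rw [e]; exact hx)).hasMFDerivAt.comp 0
      (X.mdifferentiableAt_curve v x 0).hasMFDerivAt
  have h2 : (K.p ∘ fun s : ℝ => X.act (s • v) x) = fun s : ℝ => X.act (s • v) (K.p x) := by
    funext s
    exact (K.equivariant x hx (s • v)).2.1
  rw [h2] at h1
  have h3 := hasMFDerivAt_unique h1 (X.mdifferentiableAt_curve v (K.p x) 0).hasMFDerivAt
  have h4 := congrArg (fun l : ℝ →L[ℝ] Model n => l 1) h3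
  have hcongr : ∀ z z' : M, z = z' → ∀ a : Model n,
      (mfderiv (𝓡 (2 * n)) (𝓡 (2 * n)) K.p z : Model n →L[ℝ] Model n) a =
        (mfderiv (𝓡 (2 * n)) (𝓡 (2 * n)) K.p z' : Model n →L[ℝ] Model n) a := by
    rintro z _ rfl a; rfl
  exact (hcongr _ _ e.symm _).trans h4

theorem differential_t_field {x : M} (hx : x ∈ K.𝒰) (v : Fin n → ℝ) :
    differential n K.t x (X.field v x) = 0 := by
  have h1 := X.hasDerivAt_comp_curve (K.mdifferentiableAt_t hx) v
  have h2 : (fun s : ℝ => K.t (X.act (s • v) x)) = fun _ => K.t x := by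
    funext s; exact (K.equivariant x hx _).2.2
  rw [h2] at h1
  exact h1.unique (hasDerivAt_const (0 : ℝ) (K.t x))

theorem β_field {x : M} (hx : x ∈ K.𝒰) : K.β x (X.field (X.nullGen (K.p x)) x) = 1 := by
  rw [K.β_pullback x hx, K.mfderiv_p_field hx, K.β_vertical _ (K.map_pt x hx).1]

/-- `p` takes values in the fold, so the defining function of the fold composed with `p` is locally
zero. -/
theorem mfderiv_p_mem_foldTangent {x : M} (hx : x ∈ K.𝒰) (u : TangentSpace (𝓡 (2 * n)) x) :
    mfderiv (𝓡 (2 * n)) (𝓡 (2 * n)) K.p x u ∈ foldTangent X.Ω (K.p x) := by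
  have hp := K.mdifferentiableAt_p hx
  have h1 : HasMFDerivAt (𝓡 (2 * n)) 𝓘(ℝ, ℝ) (topPower X.Ω (K.p x) ∘ K.p) x
      ((mfderiv (𝓡 (2 * n)) 𝓘(ℝ, ℝ) (topPower X.Ω (K.p x)) (K.p x)).comp
        (mfderiv (𝓡 (2 * n)) (𝓡 (2 * n)) K.p x)) :=
    ((contMDiffAt_topPower X.smooth_form (K.p x)).mdifferentiableAt (by simp)).hasMFDerivAt.comp x
      hp.hasMFDerivAt
  have h2 : topPower X.Ω (K.p x) ∘ K.p =ᶠ[𝓝 x] fun _ => 0 := by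
    filter_upwards [K.isOpen.mem_nhds hx, hp.continuousAt.eventually
      ((isOpen_extChartAt_source (I := 𝓡 (2 * n)) (K.p x)).mem_nhds (mem_extChartAt_source _))]
      with y hy hys
    exact (mem_fold_iff X.Ω hys).1 (K.map_pt y hy).1
  have h3 := hasMFDerivAt_unique (h1.congr_of_eventuallyEq h2.symm) (hasMFDerivAt_const (0 : ℝ) x)
  exact congrArg (fun l : Model n →L[ℝ] ℝ => l u) h3

/-- The null direction pairs to zero with all vectors tangent to the fold, in particular with the
image of `dp`; this removes the pulled-back term of the normal form. -/
theorem form_field_mfderiv_p {x : M} (hx : x ∈ K.𝒰) (u : TangentSpace (𝓡 (2 * n)) x) :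
    X.Ω (K.p x) (X.field (X.nullGen (K.p x)) (K.p x))
      (mfderiv (𝓡 (2 * n)) (𝓡 (2 * n)) K.p x u) = 0 := by
  have hz := (K.map_pt x hx).1
  have h : X.field (X.nullGen (K.p x)) (K.p x) ∈ nullSpace X.Ω (K.p x) := by
    rw [X.null_eq _ hz]
    exact Submodule.mem_span_singleton_self _
  exact h.2 _ (K.mfderiv_p_mem_foldTangent hx u)

theorem eventually_nullGen_eq_within {z : M} (hz : z ∈ X.Z) :
    ∀ᶠ y in 𝓝[X.Z] z, X.nullGen y = X.nullGen z := by
  have h := (X.nullVec_locallyConstant z hz).eventually (IsOpen.mem_nhds (isOpen_discrete {X.nullVec z}) rfl)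
  filter_upwards [h] with y hy
  have : X.nullVec y = X.nullVec z := hy
  exact funext fun i => congrArg (fun w : Fin n → ℤ => (w i : ℝ)) this

theorem eventually_nullGen_eq {x : M} (hx : x ∈ K.𝒰) :
    ∀ᶠ y in 𝓝 x, X.nullGen (K.p y) = X.nullGen (K.p x) := by
  have hp : Filter.Tendsto K.p (𝓝 x) (𝓝[X.Z] (K.p x)) := by
    refine tendsto_nhdsWithin_iff.2 ⟨(K.mdifferentiableAt_p hx).continuousAt, ?_⟩
    filter_upwards [K.isOpen.mem_nhds hx] with y hy using (K.map_pt y hy).1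
  exact hp.eventually (eventually_nullGen_eq_within (K.map_pt x hx).1)

/-- The open set over which the null circle is generated by `v`. -/
def chamber (v : Fin n → ℝ) : Set M := {x ∈ K.𝒰 | X.nullGen (K.p x) = v}

theorem isOpen_chamber (v : Fin n → ℝ) : IsOpen (K.chamber v) := by
  rw [isOpen_iff_mem_nhds]
  intro x hx
  filter_upwards [K.isOpen.mem_nhds hx.1, K.eventually_nullGen_eq hx.1] with y hy h
  exact ⟨hy, h.trans hx.2⟩

/-- Contract the normal form with the null generator `v`: the term from the fold vanishes, `dt(v) =
0`, `β(v) = 1` and `ι_v dβ = 0`, which leaves `d⟨μ, v⟩ = -2t dt`. -/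
theorem differential_moment_add_sq {v : Fin n → ℝ} {x : M} (hx : x ∈ K.chamber v)
    (u : TangentSpace (𝓡 (2 * n)) x) :
    differential n (fun y => X.μ y ⬝ᵥ v + K.t y ^ 2) x u = 0 := by
  obtain ⟨hxU, rfl⟩ := hx
  set v := X.nullGen (K.p x) with hv
  have hμ : MDifferentiableAt (𝓡 (2 * n)) 𝓘(ℝ, ℝ) (fun y => X.μ y ⬝ᵥ v) x := by
    have h0 : ContDiff ℝ ∞ (fun ξ : Fin n → ℝ => ξ ⬝ᵥ v) := by
      simp only [dotProduct]
      exact ContDiff.sum fun i _ => (contDiff_apply ℝ ℝ i).mul contDiff_const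
    exact (h0.contMDiff.comp X.smooth_moment).mdifferentiable (by simp) x
  have ht := K.mdifferentiableAt_t hxU
  have ht2 : HasMFDerivAt (𝓡 (2 * n)) 𝓘(ℝ, ℝ) (fun y => K.t y ^ 2) x
      ((2 * K.t x) • (mfderiv (𝓡 (2 * n)) 𝓘(ℝ, ℝ) K.t x : Model n →L[ℝ] ℝ)) := by
    have h1 : HasFDerivAt (fun r : ℝ => r ^ 2) ((2 * K.t x) • (1 : ℝ →L[ℝ] ℝ)) (K.t x) := by
      have := (hasDerivAt_pow 2 (K.t x)).hasFDerivAt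
      refine this.congr_fderiv ?_
      ext
      simp
    refine (h1.hasMFDerivAt.comp x ht.hasMFDerivAt).congr_mfderiv ?_
    ext u
    rfl
  have h1 : differential n (fun y => X.μ y ⬝ᵥ v + K.t y ^ 2) x u =
      differential n (fun y => X.μ y ⬝ᵥ v) x u + 2 * K.t x * differential n K.t x u := by
    have h2 := (hμ.hasMFDerivAt.add ht2).mfderiv
    exact congrArg (fun l : Model n →L[ℝ] ℝ => l u) h2
  -- On the chamber the null generator is one fixed vector, so `β` equals `1` on its field
  -- throughout an open set, as Cartan's formula requires.
  have hdβ : extDerivOne K.β x (X.field v x) u = 0 := by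
    refine extDerivOne_field_eq_zero X.toTorusAction (K.isOpen_chamber v)
      (K.smooth_β.mono fun y hy => hy.1) (fun y hy => K.β_invariant y hy.1) ?_ ⟨hxU, rfl⟩ u
    intro y hy
    have := K.β_field hy.1
    rwa [hy.2] at this
  rw [h1, X.moment_eq, K.normal_form x hxU, K.mfderiv_p_field hxU, K.form_field_mfderiv_p hxU,
    K.differential_t_field hxU, K.β_field hxU, hdβ]
  ring

theorem eventually_moment_eq {x : M} (hx : x ∈ K.𝒰) :
    ∀ᶠ y in 𝓝 x, X.μ y ⬝ᵥ X.nullGen (K.p x) + K.t y ^ 2 =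
      X.μ x ⬝ᵥ X.nullGen (K.p x) + K.t x ^ 2 := by
  refine eventually_eq_of_differential_eq_zero (n := n)
    (H := fun y => X.μ y ⬝ᵥ X.nullGen (K.p x) + K.t y ^ 2)
    (K.isOpen_chamber (X.nullGen (K.p x))) ?_
    (fun y hy u => K.differential_moment_add_sq hy u) ⟨hx, rfl⟩
  have h0 : ContDiff ℝ ∞ (fun ξ : Fin n → ℝ => ξ ⬝ᵥ X.nullGen (K.p x)) := by
    simp only [dotProduct]
    exact ContDiff.sum fun i _ => (contDiff_apply ℝ ℝ i).mul contDiff_const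
  have h1 := (h0.contMDiff.comp X.smooth_moment).contMDiffOn (s := K.chamber (X.nullGen (K.p x)))
  have h2 : ContMDiffOn (𝓡 (2 * n)) 𝓘(ℝ, ℝ) ∞ (fun y => K.t y ^ 2)
      (K.chamber (X.nullGen (K.p x))) :=
    (contDiff_id.pow 2 : ContDiff ℝ ∞ (fun r : ℝ => r ^ 2)).contMDiff.comp_contMDiffOn
      (K.smooth_t.mono fun y hy => hy.1)
  exact h1.add h2

/-- The moment map of the null circle in the collar. -/
theorem moment_nullGen {x : M} (hx : x ∈ K.𝒰) :
    X.μ x ⬝ᵥ X.nullGen (K.p x) = X.μ (K.p x) ⬝ᵥ X.nullGen (K.p x) - K.t x ^ 2 := by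
  obtain ⟨hz, htx, hφ⟩ := K.map_pt x hx
  set z := K.p x with hzdef
  -- `φ` is only known to be continuous, so there is no chain rule along the ray; local constancy of
  -- the function on `M` makes `h` locally constant instead.
  set h : ℝ → ℝ := fun s => X.μ (K.φ z s) ⬝ᵥ X.nullGen z + K.t (K.φ z s) ^ 2 with hh
  have hd : ∀ s ∈ Ioo (-K.ε₀) K.ε₀, HasDerivAt h 0 s := by
    intro s hs
    obtain ⟨h1, h2, -⟩ := K.map_φ z hz s hs
    have hc : ContinuousAt (fun s => K.φ z s) s := by
      have h3 : ContinuousOn (fun s : ℝ => K.φ z s) (Ioo (-K.ε₀) K.ε₀) :=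
        K.continuousOn_φ.comp (f := fun s : ℝ => (z, s)) (by fun_prop) fun s hs => ⟨hz, hs⟩
      exact h3.continuousAt (Ioo_mem_nhds hs.1 hs.2)
    have h4 := hc.eventually (K.eventually_moment_eq h1)
    rw [h2] at h4
    exact (hasDerivAt_const s (h s)).congr_of_eventuallyEq h4
  have hconst : h (K.t x) = h 0 :=
    isOpen_Ioo.is_const_of_deriv_eq_zero isPreconnected_Ioo
      (fun s hs => (hd s hs).differentiableAt.differentiableWithinAt)
      (fun s hs => (hd s hs).deriv) htx K.zero_mem
  simp only [hh] at hconst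
  rw [hφ, K.φ_zero z hz, (K.mem_of_mem_Z hz).2.2] at hconst
  linarith

theorem eventually_moment_nullGen_eq (K : Collar X) {z : M} (hz : z ∈ X.Z) :
    ∀ᶠ y in 𝓝[X.Z] z, X.μ y ⬝ᵥ X.nullGen y = X.μ z ⬝ᵥ X.nullGen z := by
  obtain ⟨h1, h2, h3⟩ := K.mem_of_mem_Z hz
  have h := K.eventually_moment_eq h1
  rw [h2] at h
  filter_upwards [nhdsWithin_le_nhds h, eventually_nullGen_eq_within hz, self_mem_nhdsWithin]
    with y h4 h5 h6
  rw [(K.mem_of_mem_Z h6).2.2, h3] at h4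
  rw [h5]
  linarith

theorem exists_forall_sub_ne_int (r : ℝ) : ∃ δ > 0, ∀ s, 0 < s → s < δ → ∀ k : ℤ, r - s ≠ k := by
  -- The distance to the largest integer strictly below `r`; it is positive also when `r` is an
  -- integer, which is why `s = 0` has to be excluded.
  refine ⟨r - (⌈r⌉ - 1), by linarith [Int.ceil_lt_add_one r], fun s h1 h2 k hk => ?_⟩
  have h3 : ((⌈r⌉ - 1 : ℤ) : ℝ) < (k : ℝ) := by push_cast; linarith
  have h4 : (k : ℝ) < (⌈r⌉ : ℝ) := by linarith [Int.le_ceil r]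
  have h5 := Int.cast_lt.1 h3
  have h6 := Int.cast_lt.1 h4
  omega

/-- Near the fold but off it, the moment map of the null circle is not a weight. -/
theorem exists_forall_moment_ne_int [CompactSpace M] : ∃ ε₁ > 0, ε₁ ≤ K.ε₀ ∧ ∀ x ∈ K.𝒰,
    x ∉ X.Z → |K.t x| < ε₁ → ∀ k : ℤ, X.μ x ⬝ᵥ X.nullGen (K.p x) ≠ k := by
  have hZ : IsCompact X.Z := (isClosed_fold X.smooth_form).isCompact
  obtain ⟨δ, hδ, h⟩ : ∃ δ > 0, ∀ z ∈ X.Z, ∀ s, 0 < s → s < δ → ∀ k : ℤ,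
      X.μ z ⬝ᵥ X.nullGen z - s ≠ k := by
    -- The function `⟨μ, v_Z⟩` is locally constant on the compact fold, so the bound for a single
    -- value becomes uniform.
    refine hZ.induction_on (p := fun S => ∃ δ > 0, ∀ z ∈ S, ∀ s, 0 < s → s < δ → ∀ k : ℤ,
      X.μ z ⬝ᵥ X.nullGen z - s ≠ k) ⟨1, one_pos, by simp⟩ ?_ ?_ ?_
    · rintro S S' hS ⟨δ, hδ, h⟩
      exact ⟨δ, hδ, fun z hz => h z (hS hz)⟩
    · rintro S S' ⟨δ, hδ, h⟩ ⟨δ', hδ', h'⟩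
      refine ⟨min δ δ', lt_min hδ hδ', ?_⟩
      rintro z (hz | hz) s h0 hs
      · exact h z hz s h0 (hs.trans_le (min_le_left _ _))
      · exact h' z hz s h0 (hs.trans_le (min_le_right _ _))
    · intro z hz
      obtain ⟨δ, hδ, h⟩ := exists_forall_sub_ne_int (X.μ z ⬝ᵥ X.nullGen z)
      refine ⟨_, K.eventually_moment_nullGen_eq hz, δ, hδ, fun y hy => ?_⟩
      have hy' : X.μ y ⬝ᵥ X.nullGen y = X.μ z ⬝ᵥ X.nullGen z := hy
      rw [hy']
      exact h
  -- With `|t| < 1` one has `t² ≤ |t| < δ`.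
  refine ⟨min K.ε₀ (min 1 δ), lt_min K.ε₀_pos (lt_min one_pos hδ), min_le_left _ _, ?_⟩
  intro x hx hxZ ht k
  rw [K.moment_nullGen hx]
  have h0 : K.t x ≠ 0 := fun h => hxZ ((K.mem_Z_iff hx).2 h)
  have h1 : |K.t x| < 1 := ht.trans_le ((min_le_right _ _).trans (min_le_left _ _))
  have h2 : |K.t x| < δ := ht.trans_le ((min_le_right _ _).trans (min_le_right _ _))
  refine h _ (K.map_pt x hx).1 _ (by positivity) ?_ k
  rw [← sq_abs]
  nlinarith [abs_nonneg (K.t x)]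

end Collar

end

/-! ### Rational subtori, the good fibration and acyclicity. -/

section

section Rational

variable {n : ℕ}

theorem isRational_span {S : Set (Fin n → ℝ)} (hS : S ⊆ lattice n) :
    IsRational (Submodule.span ℝ S) := by
  refine le_antisymm (Submodule.span_le.2 inter_subset_left) (Submodule.span_mono ?_)
  exact fun v hv => ⟨Submodule.subset_span hv, hS hv⟩

theorem exists_smul_mem_lattice (c : Fin n → ℚ) :
    ∃ N : ℕ, N ≠ 0 ∧ (N : ℝ) • (fun i => (c i : ℝ)) ∈ lattice n := by
  refine ⟨∏ i, (c i).den, Finset.prod_ne_zero_iff.2 fun i _ => (c i).den_nz, fun i => ?_⟩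
  refine ⟨(∏ j ∈ Finset.univ.erase i, ((c j).den : ℤ)) * (c i).num, ?_⟩
  have h : ((c i).den : ℝ) * (c i : ℝ) = ((c i).num : ℝ) := by
    exact_mod_cast Rat.den_mul_eq_num (c i)
  rw [Pi.smul_apply, smul_eq_mul, ← Finset.mul_prod_erase Finset.univ _ (Finset.mem_univ i)]
  push_cast
  rw [← h]
  ring

/-- The orthogonal complement of a rational subspace for a rational form is rational. -/
theorem IsRational.orthogonal {𝔥 : Submodule ℝ (Fin n → ℝ)} (h : IsRational 𝔥)
    (Q : Matrix (Fin n) (Fin n) ℚ) :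
    IsRational ((Matrix.toBilin' (Q.map (fun q : ℚ => (q : ℝ)))).orthogonal 𝔥) := by
  set B := Matrix.toBilin' (Q.map (fun q : ℚ => (q : ℝ))) with hB
  refine le_antisymm (Submodule.span_le.2 inter_subset_left) fun x hx => ?_
  -- Expanding the coordinates of `x` in a basis of `ℝ` over `ℚ` writes `x` as a real combination of
  -- rational vectors `c k`. The equations expressing orthogonality to lattice vectors have rational
  -- coefficients, so each `c k` satisfies them separately.
  set b := Module.Basis.ofVectorSpace ℚ ℝ with hb
  set c : Module.Basis.ofVectorSpaceIndex ℚ ℝ → Fin n → ℚ := fun k i => b.repr (x i) k with hc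
  have hcx : ∀ k, (fun i => (c k i : ℝ)) ∈ B.orthogonal 𝔥 := by
    intro k
    have h1 : 𝔥 ≤ LinearMap.ker (B.flip (fun i => (c k i : ℝ))) := by
      rw [← h, Submodule.span_le]
      rintro u ⟨hu, hul⟩
      choose m hm using hul
      have h2 : B u x = 0 := (LinearMap.BilinForm.mem_orthogonal_iff.1 hx) u hu
      have h3 : ∀ y : Fin n → ℝ, B u y = ∑ i, ∑ j, (m i * Q i j : ℚ) • y j := by
        intro y
        rw [hB, Matrix.toBilin'_apply]
        refine Finset.sum_congr rfl fun i _ => Finset.sum_congr rfl fun j _ => ?_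
        rw [hm i, Matrix.map_apply, Rat.smul_def]
        push_cast
        ring
      rw [h3] at h2
      have h4 := congrArg (b.coord k) h2
      simp only [map_sum, map_smul, map_zero, Module.Basis.coord_apply, smul_eq_mul] at h4
      change B u (fun i => (c k i : ℝ)) = 0
      rw [h3]
      simp only [Rat.smul_def]
      exact_mod_cast h4
    rw [LinearMap.BilinForm.mem_orthogonal_iff]
    intro u hu
    exact h1 hu
  have hmem : ∀ k, (fun i => (c k i : ℝ)) ∈
      Submodule.span ℝ ((B.orthogonal 𝔥 : Set (Fin n → ℝ)) ∩ lattice n) := by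
    intro k
    obtain ⟨N, hN, hl⟩ := exists_smul_mem_lattice (c k)
    have h1 : (fun i => (c k i : ℝ)) = (N : ℝ)⁻¹ • ((N : ℝ) • fun i => (c k i : ℝ)) := by
      rw [smul_smul, inv_mul_cancel₀ (by exact_mod_cast hN), one_smul]
    rw [h1]
    exact Submodule.smul_mem _ _ (Submodule.subset_span ⟨Submodule.smul_mem _ _ (hcx k), hl⟩)
  classical
  set J := Finset.univ.biUnion fun i => (b.repr (x i)).support with hJ
  have hx' : x = ∑ k ∈ J, b k • (fun i => (c k i : ℝ)) := by
    funext i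
    have h1 : ∑ k ∈ J, b.repr (x i) k • b k = x i := by
      rw [← Finsupp.sum_of_support_subset _
        (Finset.subset_biUnion_of_mem (fun i => (b.repr (x i)).support) (Finset.mem_univ i))
        (fun k a => a • b k) (fun k _ => zero_smul _ _), ← Finsupp.linearCombination_apply]
      exact b.linearCombination_repr (x i)
    refine h1.symm.trans ?_
    rw [Finset.sum_apply]
    refine Finset.sum_congr rfl fun k _ => ?_
    rw [Pi.smul_apply, smul_eq_mul, Rat.smul_def, mul_comm]
  rw [hx']
  exact Submodule.sum_mem _ fun k _ => Submodule.smul_mem _ _ (hmem k)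

theorem eq_zero_of_forall_smul_mem_lattice {v : Fin n → ℝ} (h : ∀ s : ℝ, s • v ∈ lattice n) :
    v = 0 := by
  funext i
  by_contra hne
  -- For this `s` the coordinate is `1/2`.
  obtain ⟨k, hk⟩ := h ((2 * v i)⁻¹) i
  have hne' : v i ≠ 0 := hne
  rw [Pi.smul_apply, smul_eq_mul, mul_inv, mul_assoc, inv_mul_cancel₀ hne', mul_one] at hk
  have h2 : (2 * k : ℝ) = 1 := by rw [← hk]; norm_num
  have h3 : 2 * k = 1 := by exact_mod_cast h2
  omega

end Rational

variable {n : ℕ} {M : Type*} [TopologicalSpace M] [ChartedSpace (Model n) M]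
  [IsManifold (𝓡 (2 * n)) ∞ M] {X : ToricOrigami n M}

/-- Orbits are connected, being images of `ℝⁿ`, so they stay in one component of an invariant set.
-/
theorem TorusAction.act_mem_connectedComponentIn (A : TorusAction n M) {Y : Set M}
    (hY : ∀ x ∈ Y, ∀ v, A.act v x ∈ Y) {x₀ x : M} (hx : x ∈ connectedComponentIn Y x₀)
    (v : Fin n → ℝ) : A.act v x ∈ connectedComponentIn Y x₀ := by
  have hxY := connectedComponentIn_subset Y x₀ hx
  rw [connectedComponentIn_eq hx]
  have h1 : IsPreconnected (range fun v => A.act v x) :=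
    isPreconnected_range (A.contMDiff_orbit x).continuous
  refine h1.subset_connectedComponentIn ⟨0, A.act_zero x⟩ ?_ ⟨v, rfl⟩
  rintro _ ⟨w, rfl⟩
  exact hY x hxY w

namespace Collar

variable (K : Collar X)

theorem act_mem_nhd {ε : ℝ} {x : M} (hx : x ∈ K.nhd ε) (v : Fin n → ℝ) : X.act v x ∈ K.nhd ε := by
  obtain ⟨h1, -, h2⟩ := K.equivariant x hx.1 v
  exact ⟨h1, by rw [h2]; exact hx.2⟩

theorem act_mem_sheet (K : Collar X) {N : Set M} (hN : X.IsSheet N) {x : M} (hx : x ∈ N)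
    (v : Fin n → ℝ) : X.act v x ∈ N := by
  obtain ⟨x₀, -, rfl⟩ := hN
  have h : ∀ y ∈ X.Zᶜ, ∀ w, X.act w y ∈ X.Zᶜ := fun y hy w h => hy ((K.act_mem_Z_iff w).1 h)
  exact X.act_mem_connectedComponentIn h hx v

theorem act_mem_foldComponent (K : Collar X) {C : Set M} (hC : X.IsFoldComponent C) {x : M}
    (hx : x ∈ C) (v : Fin n → ℝ) : X.act v x ∈ C := by
  obtain ⟨x₀, -, rfl⟩ := hC
  exact X.act_mem_connectedComponentIn (fun y hy w => K.act_mem_Z hy w) hx v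

end Collar

theorem ToricOrigami.nullGen_eq_of_mem_foldComponent {C : Set M} (hC : X.IsFoldComponent C) {z z' : M}
    (hz : z ∈ C) (hz' : z' ∈ C) : X.nullGen z = X.nullGen z' := by
  obtain ⟨x₀, -, rfl⟩ := hC
  have h := isPreconnected_connectedComponentIn.constant
    (X.nullVec_locallyConstant.mono (connectedComponentIn_subset X.Z x₀)) hz hz'
  exact funext fun i => congrArg (fun w : Fin n → ℤ => (w i : ℝ)) h

theorem ToricOrigami.nullGen_mem_lattice (z : M) : X.nullGen z ∈ lattice n :=
  fun i => ⟨X.nullVec z i, rfl⟩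

namespace FaceCover

variable {K : Collar X} {ε : ℝ} {S : FaceStabilizers X} {Q : Matrix (Fin n) (Fin n) ℚ}
  (c : FaceCover K ε S Q)

theorem act_mem_regularStratum {N : Set M} {F : Set (Fin n → ℝ)} (hN : X.IsSheet N) {x : M}
    (hx : x ∈ c.regularStratum N F) (v : Fin n → ℝ) : X.act v x ∈ c.regularStratum N F := by
  obtain ⟨⟨h1, h2⟩, h3⟩ := hx
  refine ⟨⟨K.act_mem_sheet hN h1 v, ?_⟩, ?_⟩
  · rw [X.moment_invariant]; exact h2
  · rw [X.moment_invariant]; exact h3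

theorem act_mem_crack {N : Set M} {F : Set (Fin n → ℝ)} (hN : X.IsSheet N) {x : M}
    (hx : x ∈ c.crack N F) (v : Fin n → ℝ) : X.act v x ∈ c.crack N F := by
  refine ⟨K.act_mem_sheet hN hx.1 v, ?_⟩
  rw [X.moment_invariant]; exact hx.2

theorem act_mem_domain {x : M} (hx : x ∈ c.domain) (v : Fin n → ℝ) : X.act v x ∈ c.domain := by
  refine ⟨?_, ?_⟩
  · rcases hx.1 with h | h
    · exact Or.inl (K.act_mem_nhd h v)
    · right
      simp only [mem_iUnion] at h ⊢
      obtain ⟨N, hN, F, hF, h⟩ := h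
      exact ⟨N, hN, F, hF, c.act_mem_regularStratum hN h v⟩
  · rintro (h | h)
    · exact hx.2 (Or.inl ((K.act_mem_Z_iff v).1 h))
    · refine hx.2 (Or.inr ?_)
      simp only [mem_iUnion] at h ⊢
      obtain ⟨N, hN, F, hF, h⟩ := h
      refine ⟨N, hN, F, hF, ?_⟩
      have := c.act_mem_crack hN h (-v)
      rwa [X.act_neg_act] at this

theorem perp_polytope {N : Set M} (hN : X.IsSheet N) : S.perp Q N (X.polytope N) = ⊤ := by
  rw [FaceStabilizers.perp, S.stab_top N hN, eq_top_iff]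
  intro v _
  rw [LinearMap.BilinForm.mem_orthogonal_iff]
  intro u hu
  rw [(Submodule.mem_bot ℝ).1 hu]
  simp

/-- Over the open polytope stabilizers are trivial, so a vanishing fundamental vector would put a
whole line into the lattice. For the other faces this is the smallness of the neighbourhoods. -/
theorem locallyFree_stratum {N : Set M} {F : Set (Fin n → ℝ)} (hN : X.IsSheet N) (hF : X.IsFace N F)
    {x : M} (hx : x ∈ c.stratum N F) {v : Fin n → ℝ} (hv : v ∈ S.perp Q N F)
    (h0 : X.field v x = 0) : v = 0 := by
  by_cases hne : F = X.polytope N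
  · subst hne
    have hμ := hx.2
    rw [c.nbd_top N hN] at hμ
    refine eq_zero_of_forall_smul_mem_lattice fun s => ?_
    obtain ⟨u, hu, hl⟩ := (S.stab_eq N _ hN hF x hx.1 (interior_subset_intrinsicInterior hμ)
      (s • v)).1 (X.act_smul_eq_self h0 s)
    rw [S.stab_top N hN, Submodule.mem_bot] at hu
    rwa [hu, sub_zero] at hl
  · exact c.locallyFree N F hN hF hne x hx.1 hx.2 v hv h0

theorem algebra_inl_eq {C : {C : Set M // X.IsFoldComponent C}} {z : M} (hz : z ∈ C.1) :
    c.algebra (Sum.inl C) = Submodule.span ℝ {X.nullGen z} := by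
  have h : X.nullGen '' C.1 = {X.nullGen z} := by
    refine Subset.antisymm ?_ ?_
    · rintro _ ⟨y, hy, rfl⟩
      exact ToricOrigami.nullGen_eq_of_mem_foldComponent C.2 hy hz
    · rintro _ rfl
      exact ⟨z, hz, rfl⟩
  change Submodule.span ℝ (X.nullGen '' C.1) = _
  rw [h]

/-- The connection form takes the value `1` on the fundamental field of the null generator. -/
theorem locallyFree_collar {C : {C : Set M // X.IsFoldComponent C}} {x : M} (hx : x ∈ K.𝒰)
    (hp : K.p x ∈ C.1) {v : Fin n → ℝ} (hv : v ∈ c.algebra (Sum.inl C)) (h0 : X.field v x = 0) :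
    v = 0 := by
  rw [c.algebra_inl_eq hp] at hv
  obtain ⟨s, rfl⟩ := Submodule.mem_span_singleton.1 hv
  have h1 := K.β_field hx
  rw [X.field_smul] at h0
  have h2 := congrArg (K.β x) h0
  rw [map_smul, h1, map_zero, smul_eq_mul, mul_one] at h2
  rw [h2, zero_smul]

/-- The neighbourhoods of proper faces avoid the moment image of the closed collar, so only the set
over the open polytope can meet the collar, and its group is the full torus. -/
theorem nested_collar_stratum (hε : 0 < ε) {N : Set M} {F : Set (Fin n → ℝ)} (hN : X.IsSheet N)
    (hF : X.IsFace N F) {x : M} (hx : x ∈ K.nhd (ε / 2)) (hxF : x ∈ c.stratum N F) :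
    S.perp Q N F = ⊤ := by
  by_cases hne : F = X.polytope N
  · subst hne
    exact perp_polytope hN
  · obtain ⟨O, -, hO⟩ := c.nbd_open N F hN hF hne
    have h1 := hxF.2
    rw [hO] at h1
    refine absurd ⟨x, ⟨⟨hx.1, ?_⟩, subset_closure hxF.1⟩, rfl⟩ h1.2.2
    have := hx.2
    linarith

/-- Different sheets are disjoint, so both faces belong to one polytope; if one of them is the
polytope itself, its group is everything. -/
theorem nested_strata {N N' : Set M} {F F' : Set (Fin n → ℝ)} (hN : X.IsSheet N) (hF : X.IsFace N F)
    (hN' : X.IsSheet N') (hF' : X.IsFace N' F') {x : M} (hx : x ∈ c.stratum N F)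
    (hx' : x ∈ c.stratum N' F') :
    S.perp Q N F ≤ S.perp Q N' F' ∨ S.perp Q N' F' ≤ S.perp Q N F := by
  have e : N = N' := by
    obtain ⟨y, -, rfl⟩ := hN
    obtain ⟨y', -, rfl⟩ := hN'
    exact (connectedComponentIn_eq hx.1).trans (connectedComponentIn_eq hx'.1).symm
  subst e
  by_cases h : F = X.polytope N
  · subst h
    rw [perp_polytope hN]
    exact Or.inr le_top
  · by_cases h' : F' = X.polytope N
    · subst h'
      rw [perp_polytope hN]
      exact Or.inl le_top
    · exact c.nested N F F' hN hF hF' h h' ⟨_, hx.2, hx'.2⟩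

theorem isGoodFibration (hε : 0 < ε) : IsGoodFibration X c.domain c.piece c.algebra where
  covers := by
    refine Subset.antisymm (iUnion_subset ?_) fun x hx => ?_
    · rintro (C | P)
      · exact inter_subset_right
      · exact inter_subset_right
    · rw [mem_iUnion]
      rcases hx.1 with h | h
      · have hz := (K.map_pt x h.1).1
        exact ⟨Sum.inl ⟨_, K.p x, hz, rfl⟩, ⟨h, mem_connectedComponentIn hz⟩, hx⟩
      · simp only [mem_iUnion] at h
        obtain ⟨N, hN, F, hF, h⟩ := h
        exact ⟨Sum.inr ⟨(N, F), hN, hF⟩, h, hx⟩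
  invariant := by
    rintro (C | P) x hx v
    · refine ⟨⟨K.act_mem_nhd hx.1.1 v, ?_⟩, c.act_mem_domain hx.2 v⟩
      rw [(K.equivariant x hx.1.1.1 v).2.1]
      exact K.act_mem_foldComponent C.2 hx.1.2 v
    · exact ⟨c.act_mem_regularStratum P.2.1 hx.1 v, c.act_mem_domain hx.2 v⟩
  rational := by
    rintro (C | P)
    · refine isRational_span ?_
      rintro _ ⟨z, -, rfl⟩
      exact ToricOrigami.nullGen_mem_lattice z
    · exact (S.rational _ _ P.2.1 P.2.2).orthogonal Q
  locallyFree := by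
    rintro (C | P) x hx v hv h0
    · exact c.locallyFree_collar hx.1.1.1 hx.1.2 hv h0
    · exact c.locallyFree_stratum P.2.1 P.2.2 hx.1.1 hv h0
  nested := by
    rintro (C | P) (C' | P') ⟨x, hx, hx'⟩
    · left
      rw [c.algebra_inl_eq hx.1.2, c.algebra_inl_eq hx'.1.2]
    · left
      have := c.nested_collar_stratum hε P'.2.1 P'.2.2 hx.1.1 hx'.1.1
      exact le_top.trans this.ge
    · right
      have := c.nested_collar_stratum hε P.2.1 P.2.2 hx'.1.1 hx.1.1
      exact le_top.trans this.ge
    · exact c.nested_strata P.2.1 P.2.2 P'.2.1 P'.2.2 hx.1.1 hx'.1.1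

/-- In the collar the null generator is itself a lattice vector with a non-integral pairing, as the
fold has been removed from the domain; on the other sets it is their definition. -/
theorem not_isWeightOn {ε₁ : ℝ} (hε : 0 < ε) (hε₁ : ε < ε₁)
    (h : ∀ x ∈ K.𝒰, x ∉ X.Z → |K.t x| < ε₁ → ∀ k : ℤ, X.μ x ⬝ᵥ X.nullGen (K.p x) ≠ k)
    (i : Index X) {x : M} (hx : x ∈ c.piece i) : ¬ IsWeightOn (c.algebra i) (X.μ x) := by
  rcases i with C | P
  · intro hw
    obtain ⟨k, hk⟩ := hw (X.nullGen (K.p x)) (Submodule.subset_span ⟨_, hx.1.2, rfl⟩)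
      (ToricOrigami.nullGen_mem_lattice _)
    have h1 := hx.1.1.2
    exact h x hx.1.1.1 (fun hz => hx.2.2 (Or.inl hz)) (by linarith) k hk
  · exact hx.1.2

end FaceCover

section Operators

variable {g : Metric n M}
  {FW : Type*} [NormedAddCommGroup FW] [NormedSpace ℂ FW] [FiniteDimensional ℂ FW]
  {W : M → Type*} [∀ x, NormedAddCommGroup (W x)] [∀ x, InnerProductSpace ℂ (W x)]
  [TopologicalSpace (TotalSpace FW W)] [FiberBundle FW W] [VectorBundle ℝ FW W]
  [VectorBundle ℂ FW W] [ContMDiffVectorBundle ∞ FW W (𝓡 (2 * n))]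
  {L : M → Type*} [∀ x, NormedAddCommGroup (L x)] [∀ x, InnerProductSpace ℂ (L x)]
  [TopologicalSpace (TotalSpace ℂ L)] [FiberBundle ℂ L] [VectorBundle ℝ ℂ L]
  [VectorBundle ℂ ℂ L] [ContMDiffVectorBundle ∞ ℂ L (𝓡 (2 * n))]
  (R : CliffordBundle X.toTorusAction g FW W) (P : Prequantization X L)
  [T2Space M] [CompactSpace M] [MeasurableSpace M] [BorelSpace M] {vol : Measure M}
  {ι : Type*} {V : Set M} {B : ι → Set M} {𝔥 : ι → Submodule ℝ (Fin n → ℝ)}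

theorem IsGoodFibration.isCompatibleSystem (h : IsGoodFibration X V B 𝔥)
    (hg : IsInvariantMetric X.toTorusAction g) (hvol : IsRiemannianVolume g vol) :
    IsCompatibleSystem R P vol B 𝔥 where
  symbol i _ hs _ hf x _ := orbitDirac_smul R P hg (𝔥 i) hs hf x
  odd i _ hs x _ := orbitDirac_gradeTensor R P hg (𝔥 i) hs x
  selfAdjoint i _ _ hs hs' := integral_inner_orbitDirac R P hg hvol (h.locallyFree i) hs.1 hs'
  restricts i s _ x _ v := leafDirac_restrict R P hg (𝔥 i) x s v
  anticommutes i x _ u hu σ hσ v := leafDirac_cliff_anticomm R P hg (𝔥 i) x u hu σ hσ v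

theorem IsGoodFibration.isAcyclic (h : IsGoodFibration X V B 𝔥)
    (hg : IsInvariantMetric X.toTorusAction g) (hvol : IsRiemannianVolume g vol)
    (hw : ∀ i, ∀ x ∈ B i, ¬ IsWeightOn (𝔥 i) (X.μ x)) : IsAcyclic R P vol B 𝔥 where
  kernel i x hx _ hσ h0 v :=
    eq_zero_of_leafDirac_eq_zero R P hg (h.rational i) (h.locallyFree i x hx) (hw i x hx) hσ h0 v
  nonneg i j s hs := by
    by_cases hne : (B i ∩ B j).Nonempty
    · have hB : ∀ x ∈ B i ∩ B j, ∀ v, X.act v x ∈ B i ∩ B j := fun x hx v =>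
        ⟨h.invariant i x hx.1 v, h.invariant j x hx.2 v⟩
      rcases h.nested i j hne with hle | hle
      · exact integral_anticomm_nonneg_of_le R P hg hvol hle hB
          (fun x hx => h.locallyFree j x hx.2) hs
      · have := integral_anticomm_nonneg_of_le R P hg hvol hle hB
          (fun x hx => h.locallyFree i x hx.1) hs
        simp only [add_comm (orbitDirac R P (𝔥 i) (orbitDirac R P (𝔥 j) s) _)]
        exact this
    -- Nestedness is available only for overlapping sets; for disjoint ones the test section is
    -- zero.
    · obtain ⟨-, C, -, hC, h0⟩ := hs
      rw [not_nonempty_iff_eq_empty.1 hne, subset_empty_iff] at hC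
      have hs0 : ∀ x, s x = 0 := fun x => h0 x (by simp [hC])
      simp [hs0]

end Operators

end

end Origami

end

/-! ### The theorem. -/

theorem proposition5p6 {n : ℕ} {M : Type*} [TopologicalSpace M] [ChartedSpace (Origami.Model n) M]
    [IsManifold (𝓡 (2 * n)) ∞ M] [T2Space M] [CompactSpace M] [ConnectedSpace M]
    [MeasurableSpace M] [BorelSpace M]
    (X : Origami.ToricOrigami n M)
    (g : Origami.Metric n M) (hg : Origami.IsInvariantMetric X.toTorusAction g)
    (vol : Measure M) (hvol : Origami.IsRiemannianVolume g vol)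
    {FW : Type*} [NormedAddCommGroup FW] [NormedSpace ℂ FW] [FiniteDimensional ℂ FW]
    {W : M → Type*} [∀ x, NormedAddCommGroup (W x)] [∀ x, InnerProductSpace ℂ (W x)]
    [TopologicalSpace (TotalSpace FW W)] [FiberBundle FW W] [VectorBundle ℝ FW W]
    [VectorBundle ℂ FW W] [ContMDiffVectorBundle ∞ FW W (𝓡 (2 * n))]
    (R : Origami.CliffordBundle X.toTorusAction g FW W)
    {L : M → Type*} [∀ x, NormedAddCommGroup (L x)] [∀ x, InnerProductSpace ℂ (L x)]
    [TopologicalSpace (TotalSpace ℂ L)] [FiberBundle ℂ L] [VectorBundle ℝ ℂ L]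
    [VectorBundle ℂ ℂ L] [ContMDiffVectorBundle ∞ ℂ L (𝓡 (2 * n))]
    (P : Origami.Prequantization X L)
    (K : Origami.Collar X) (S : Origami.FaceStabilizers X)
    (Q : Matrix (Fin n) (Fin n) ℚ) (hQ : (Q.map (fun q : ℚ => (q : ℝ))).PosDef) :
    ∃ ε₁ > 0, ε₁ ≤ K.ε₀ ∧ ∀ ε : ℝ, 0 < ε → ε < ε₁ → ∀ c : Origami.FaceCover K ε S Q,
      Origami.IsGoodFibration X c.domain c.piece c.algebra ∧
      Origami.IsCompatibleSystem R P vol c.piece c.algebra ∧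
      Origami.IsAcyclic R P vol c.piece c.algebra := by
  obtain ⟨ε₁, h1, h2, h3⟩ := K.exists_forall_moment_ne_int
  refine ⟨ε₁, h1, h2, fun ε hε hε₁ c => ?_⟩
  have hF := c.isGoodFibration hε
  exact ⟨hF, hF.isCompatibleSystem R P hg hvol,
    hF.isAcyclic R P hg hvol fun i x hx => c.not_isWeightOn hε hε₁ h3 i hx⟩
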